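/- **Setting.** Let $G=SL(2,\mathbb R)$, $P\subset G$ the lower triangular matrices, $H\subset P$ the diagonal matrices, $w=\begin{pmatrix}0&-1\\1&0\end{pmatrix}$, and identify $G/P$ with $\mathbb P^1(\mathbb R)$ by $gP\mapsto[g\binom01]$, with coordinate $\zeta\leftrightarrow[\zeta:1]$. For $\lambda\in\mathbb C$ let $\mathcal L_\lambda$ be the line bundle over $G/P$ whose smooth sections are the smooth functions on $\mathbb R^2\setminus\{0\}$ with $\varphi(tv)=|t|^{-\lambda}\varphi(v)$ for $t\in\mathbb R^\times$, and write $\varphi(\zeta)=\varphi(\zeta,1)$. Let $\mathcal L$ be the line bundle whose sections satisfy $\varphi(tv)=t^{-1}\varphi(v)$. Let $t_+^\mu=t^\mu$ for $t>0$ and $0$ for $t\le0$, and $t_-^\mu=(-t)_+^\mu$. Put $$Q(\zeta_1,\zeta_2;\zeta,t)=(\zeta_1-\zeta)(\zeta_2-\zeta)+t(\zeta_1-\zeta_2),\qquad K_\pm^\mu(\zeta_1,\zeta_2;\zeta)=\Big(\frac{(\zeta_1-\zeta)(\zeta_2-\zeta)}{\zeta_1-\zeta_2}\Big)_\pm^\mu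 .$$ The de Sitter space $\mathrm{dS}^2=\{x^2+y^2-z^2=1\}$ is identified with $G/H$ through $gH\mapsto \mathrm{Ad}(g)\,\mathrm{diag}(1,-1)=\begin{pmatrix}x&y+z\\y-z&-x\end{pmatrix}$, and embedded in $G/P\times G/P$ by $gH\mapsto(gP,gwP)$. It carries the invariant measure $d\mu_{G/H}=\cosh t\,dt\,d\theta$ in the coordinates $(\cosh t\cos\theta,\cosh t\sin\theta,\sinh t)$. The pull-back $\iota_1^*$ of (possibly only off the diagonal defined) sections of $\mathcal L\boxtimes\mathcal L$ to $\mathrm{dS}^2$ is $(\iota_1^*f)(gH)=f(g\binom01,gw\binom01)$, i.e. $(\zeta_1-\zeta_2)f(\zeta_1,\zeta_2)$, and $\mathcal K_\pm^\mu$ is the pull-back of $K_\pm^\mu$ to $\mathrm{dS}^2\times G/P$. The following operators are defined by convergent integrals in the indicated range and by meromorphic continuation elsewhere. * Poisson transform: $\mathcal P_\lambda^\pm=\iota_1^*\circ H^\pm_{\lambda/2-1}$ on $C^\infty(G/P,\mathcal L_\lambda)$, where $(H_\mu^\pm\varphi)(\zeta_1,\zeta_2)=\frac1{\zeta_1-\zeta_2}\int_{\mathbb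 R}\varphi(\zeta)K_\mp^\mu(\zeta_1,\zeta_2;\zeta)\,d\zeta$ for $\zeta_1\ne\zeta_2$, $\mu=\frac\lambda2-1$ (convergent for $\operatorname{Re}\lambda>0$; continued in $\lambda$ along sections with fixed restriction to the unit circle). * The operators built from the generating operator: $(T_\mu^\pm f)(\zeta)=\frac1{(2\pi\sqrt{-1})^2}\int_{\mathbb R^2}f(\zeta_1,\zeta_2)\,\langle t_\pm^\mu,\tfrac1{Q(\zeta_1,\zeta_2;\zeta,t)}\rangle\,d\zeta_1d\zeta_2$ for smooth sections $f$ of $\mathcal L\boxtimes\mathcal L$ over $G/P\times G/P$ (convergent for $-1<\operatorname{Re}\mu<0$), where the bracket is taken in the sense of hyperfunctions: $$\langle t_\pm^\mu,\tfrac1Q\rangle=\lim_{\delta\downarrow0}\Big(\int_{\mathbb R}\frac{t_\pm^\mu\,dt}{Q(\zeta_1,\zeta_2;\zeta,t+\sqrt{-1}\delta)}-\int_{\mathbb R}\frac{t_\pm^\mu\,dt}{Q(\zeta_1,\zeta_2;\zeta,t-\sqrt{-1}\delta)}\Big).$$ * Fourier transform: $\mathcal F_\lambda^\pm h$, for $h\in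 C_c^\infty(\mathrm{dS}^2)$, is the section in $C^\infty(G/P,\mathcal L_\lambda)$ with $\int_{\mathbb R}(\mathcal F_\lambda^\pm h)(\zeta)\varphi(\zeta)\,d\zeta=\int_{G/H}h\cdot\mathcal P_{2-\lambda}^\pm\varphi\,d\mu_{G/H}$ for all $\varphi\in C^\infty(G/P,\mathcal L_{2-\lambda})$. **Proposition (Fourier transform).** 1. For every sign, every $\lambda\in\mathbb C\setminus\{2,4,6,\dots\}$ and every $h\in C_c^\infty(\mathrm{dS}^2)$, the section $\mathcal F_\lambda^\pm h\in C^\infty(G/P,\mathcal L_\lambda)$ exists, and at every point of $G/P$ $$(\mathcal F_\lambda^\pm h)(\zeta)=\int_{G/H}\mathcal K_\mp^{-\lambda/2}(x,y,z;\zeta)\,h(x,y,z)\,d\mu_{G/H},$$ where the integral converges absolutely for $\operatorname{Re}\lambda<2$ and is understood by meromorphic continuation in $\lambda$ otherwise. 2. Up to a non-zero scalar, $\mathcal F_\lambda^\pm\circ\iota_1^*=T^\pm_{-\lambda/2}$. Precisely, there is a constant $c\neq0$, independent of the sign, of $\lambda$ and of $f$, such that for every smooth section $f$ of $\mathcal L\boxtimes\mathcal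 L$ over $G/P\times G/P$ and every point of $G/P$: (a) if $\iota_1^*f\in C_c^\infty(\mathrm{dS}^2)$, then $T^\pm_{-\lambda/2}f$ is defined and $\mathcal F_\lambda^\pm(\iota_1^*f)=c\,T^\pm_{-\lambda/2}f$ for all $\lambda\in\mathbb C\setminus\{2,4,6,\dots\}$; (b) for general $f$ and $0<\operatorname{Re}\lambda<2$, the integrals $\int_{G/H}\mathcal K_\mp^{-\lambda/2}\,\iota_1^*f\,d\mu_{G/H}$ and the one defining $T^\pm_{-\lambda/2}f$ converge absolutely, and the former is $c$ times the latter; (c) for general $f$ and any $\lambda\in\mathbb C$, the meromorphic continuation of one of the two integrals in (b) exists and is regular at $\lambda$ if and only if that of the other does, and their values at $\lambda$ are in the same ratio $c$. -/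

import Mathlib

open MeasureTheory Filter Topology
open scoped ContDiff MatrixGroups

noncomputable section

/-! ## Powers and meromorphic continuation of integrals -/

/-- The function `t_ε^μ` on the real line: `t_+^μ` is `t ^ μ` for `t > 0` and `0` for `t ≤ 0`,
and `t_-^μ = (-t)_+^μ`. The sign `ε` is a unit of `ℤ`, that is `1` or `-1`. -/
def signedPow (ε : ℤˣ) (μ : ℂ) (t : ℝ) : ℂ :=
  if 0 < ((ε : ℤ) : ℝ) * t then ((((ε : ℤ) : ℝ) * t : ℝ) : ℂ) ^ μ else 0

/-- `I` is the value at `ν₀` of the meromorphic continuation of `ν ↦ ∫ k ν dm`: the integral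
converges absolutely on `S`, there is a meromorphic function on `ℂ` that agrees with it on `S`,
and this function is holomorphic at `ν₀` with value `I`. When `S` is open and non-empty,
`I` is unique by the identity theorem. -/
def HasContinuedIntegral {X : Type*} [MeasurableSpace X] (m : Measure X) (S : Set ℂ)
    (k : ℂ → X → ℂ) (ν₀ : ℂ) (I : ℂ) : Prop :=
  ∃ M : ℂ → ℂ, MeromorphicOn M Set.univ ∧
    (∀ ν ∈ S, Integrable (k ν) m ∧ M ν = ∫ x, k ν x ∂m) ∧
    AnalyticAt ℂ M ν₀ ∧ M ν₀ = I

/-! ## Line bundles over `G/P`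

`G = SL(2,ℝ)`, `P` the lower triangular matrices. Since `P` is the stabilizer of the line through
`(0,1)`, `gP ↦ [g (0,1)]` identifies `G/P` with the projective line, and a section of the bundle of
the character `χ` is a homogeneous function `φ` on `ℝ² ∖ {0}`. The Bruhat coordinate `ζ` is the
point `[ζ : 1]`, and the section is written `φ (ζ, 1)` in it. Values at `0` are irrelevant. -/

/-- Smooth sections over `G/P` of `ℒ_lam = ℒ_lam^+`, the bundle of the character `|a|^{-lam}`. -/
structure IsSection (lam : ℂ) (φ : ℝ × ℝ → ℂ) : Prop where
  smooth : ContDiffOn ℝ ∞ φ {v | v ≠ 0}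
  homogeneous : ∀ (t : ℝ) (v : ℝ × ℝ), t ≠ 0 → v ≠ 0 →
    φ (t • v) = ((|t| : ℝ) : ℂ) ^ (-lam) * φ v

/-- Smooth sections over `G/P × G/P` of `ℒ ⊠ ℒ`, where `ℒ = ℒ_1^-` is the bundle of the character
`|a|^{-1} sgn a`; so they scale by `|t|⁻¹ sgn t = t⁻¹` in each variable. -/
structure IsBiSection (f : ℝ × ℝ → ℝ × ℝ → ℂ) : Prop where
  smooth : ContDiffOn ℝ ∞ (fun q : (ℝ × ℝ) × (ℝ × ℝ) => f q.1 q.2) {q | q.1 ≠ 0 ∧ q.2 ≠ 0}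
  homogeneous : ∀ (s t : ℝ) (v w : ℝ × ℝ), s ≠ 0 → t ≠ 0 → v ≠ 0 → w ≠ 0 →
    f (s • v) (t • w) = (s : ℂ)⁻¹ * (t : ℂ)⁻¹ * f v w

/-- The determinant of two vectors of the plane; for `(ζ₁, 1)`, `(ζ₂, 1)` it is `ζ₁ - ζ₂`. -/
def wedge (v w : ℝ × ℝ) : ℝ := v.1 * w.2 - v.2 * w.1

/-- The kernel `K_ε^μ (ζ₁, ζ₂; ζ) = ((ζ₁ - ζ) (ζ₂ - ζ) / (ζ₁ - ζ₂))_ε^μ`, in homogeneous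
coordinates. -/
def kernelK (ε : ℤˣ) (μ : ℂ) (v₁ v₂ v : ℝ × ℝ) : ℂ :=
  signedPow ε μ (wedge v₁ v * wedge v₂ v / wedge v₁ v₂)

/-! ## The operators `T_μ^±` -/

/-- `Q (ζ₁, ζ₂; ζ, t) = (ζ₁ - ζ) (ζ₂ - ζ) + t (ζ₁ - ζ₂)`, in homogeneous coordinates. Its inverse
is the integral kernel of the generating operator of the Rankin–Cohen brackets. -/
def kernelQ (v₁ v₂ v : ℝ × ℝ) (t : ℂ) : ℂ :=
  ((wedge v₁ v * wedge v₂ v : ℝ) : ℂ) + t * ((wedge v₁ v₂ : ℝ) : ℂ)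

/-- The pairing `⟨t_ε^μ, 1 / Q(ζ₁, ζ₂; ζ, t)⟩` for `-1 < Re μ < 0`, as a hyperfunction. Since
`1 / Q = (ζ₁ - ζ₂)⁻¹ / (t + w)` with `w = (ζ₁ - ζ) (ζ₂ - ζ) / (ζ₁ - ζ₂)`, moving `t` to `t ± i δ`
is moving `w` to `w ± i δ`, and the hyperfunction is the jump (value at `w + i 0` minus value at
`w - i 0`). -/
def pairingQ (ε : ℤˣ) (μ : ℂ) (v₁ v₂ v : ℝ × ℝ) : ℂ :=
  limUnder (𝓝[>] (0 : ℝ)) fun δ : ℝ =>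
    (∫ t : ℝ, signedPow ε μ t / kernelQ v₁ v₂ v (t + δ * Complex.I)) -
      ∫ t : ℝ, signedPow ε μ t / kernelQ v₁ v₂ v (t - δ * Complex.I)

/-- The integrand of `T_μ^ε f` at the point `[v]` of `G/P`, in the coordinates
`z = (ζ₁, ζ₂)`. -/
def integrandT (ε : ℤˣ) (f : ℝ × ℝ → ℝ × ℝ → ℂ) (v : ℝ × ℝ) (μ : ℂ) (z : ℝ × ℝ) : ℂ :=
  (2 * (Real.pi : ℂ) * Complex.I)⁻¹ ^ 2 *
    (f (z.1, 1) (z.2, 1) * pairingQ ε μ (z.1, 1) (z.2, 1) v)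

/-- `(T_μ^ε f)(v) = A`: the integral converges for `-1 < Re μ < 0`, and `T_μ^ε` is its meromorphic
continuation. -/
def HasT (ε : ℤˣ) (μ : ℂ) (f : ℝ × ℝ → ℝ × ℝ → ℂ) (v : ℝ × ℝ) (A : ℂ) : Prop :=
  HasContinuedIntegral (volume : Measure (ℝ × ℝ)) {ν | -1 < ν.re ∧ ν.re < 0}
    (integrandT ε f v) μ A

/-! ## The de Sitter space -/

/-- The de Sitter space `x² + y² - z² = 1`. -/
def deSitter : Set (ℝ × ℝ × ℝ) := {p | p.1 ^ 2 + p.2.1 ^ 2 - p.2.2 ^ 2 = 1}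

/-- A point of the de Sitter space as a traceless matrix of determinant `-1`. -/
def deSitterMatrix (p : deSitter) : Matrix (Fin 2) (Fin 2) ℝ :=
  !![p.1.1, p.1.2.1 + p.1.2.2; p.1.2.1 - p.1.2.2, -p.1.1]

/-- `Ad(g) E = p`, where `E = diag(1, -1)`; the stabilizer of `E` is `H`, the group of diagonal
matrices of `G`, so this means that `p` corresponds to the coset `g H`. -/
def Represents (g : SL(2, ℝ)) (p : deSitter) : Prop :=
  (g : Matrix (Fin 2) (Fin 2) ℝ) * !![1, 0; 0, -1] * ((g⁻¹ : SL(2, ℝ)) : Matrix (Fin 2) (Fin 2) ℝ)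
    = deSitterMatrix p

theorem represents_iff (g : SL(2, ℝ)) (p : deSitter) :
    Represents g p ↔
      p.1.1 = g 0 0 * g 1 1 + g 0 1 * g 1 0 ∧ p.1.2.1 + p.1.2.2 = -2 * g 0 0 * g 0 1 ∧
        p.1.2.1 - p.1.2.2 = 2 * g 1 0 * g 1 1 := by
  unfold Represents deSitterMatrix
  rw [Matrix.SpecialLinearGroup.coe_inv, Matrix.adjugate_fin_two]
  constructor
  · intro h
    have h00 := congrFun (congrFun h 0) 0
    have h01 := congrFun (congrFun h 0) 1
    have h10 := congrFun (congrFun h 1) 0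
    simp [Matrix.mul_apply, Fin.sum_univ_two] at h00 h01 h10
    refine ⟨?_, ?_, ?_⟩ <;> linarith
  · rintro ⟨h1, h2, h3⟩
    ext i j
    fin_cases i <;> fin_cases j <;> simp [Matrix.mul_apply, Fin.sum_univ_two] <;> linarith

theorem exists_entries (a b c d : ℝ) (h : a * d - b * c = 1) :
    ∃ g : SL(2, ℝ), g 0 0 = a ∧ g 0 1 = b ∧ g 1 0 = c ∧ g 1 1 = d := by
  have hdet : (!![a, b; c, d] : Matrix (Fin 2) (Fin 2) ℝ).det = 1 := by
    rw [Matrix.det_fin_two_of, h]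
  obtain ⟨g, hg⟩ : ∃ g : SL(2, ℝ), (g : Matrix (Fin 2) (Fin 2) ℝ) = !![a, b; c, d] :=
    ⟨⟨!![a, b; c, d], hdet⟩, rfl⟩
  exact ⟨g, by rw [hg]; rfl, by rw [hg]; rfl, by rw [hg]; rfl, by rw [hg]; rfl⟩

theorem exists_represents (p : deSitter) : ∃ g : SL(2, ℝ), Represents g p := by
  obtain ⟨⟨x, y, z⟩, hp⟩ := p
  have hp' : x ^ 2 + y ^ 2 - z ^ 2 = 1 := hp
  suffices hs : ∃ a b c d : ℝ, a * d - b * c = 1 ∧ x = a * d + b * c ∧ y + z = -2 * a * b ∧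
      y - z = 2 * c * d by
    obtain ⟨a, b, c, d, h, h1, h2, h3⟩ := hs
    obtain ⟨g, ha, hb, hc, hd⟩ := exists_entries a b c d h
    refine ⟨g, (represents_iff _ _).2 ?_⟩
    rw [ha, hb, hc, hd]
    exact ⟨h1, h2, h3⟩
  by_cases hx : x + 1 = 0
  · have hx' : x = -1 := by linarith
    subst hx'
    have h0 : (y + z) * (y - z) = 0 := by nlinarith
    rcases mul_eq_zero.mp h0 with h | h
    · exact ⟨0, -1, 1, (y - z) / 2, by ring, by ring, by linarith, by ring⟩
    · exact ⟨-(y + z) / 2, 1, -1, 0, by ring, by ring, by ring, by linarith⟩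
  · have key : (y + z) / (x + 1) * ((y - z) / 2) = (1 - x) / 2 := by
      field_simp
      nlinarith
    refine ⟨(x + 1) / 2, -((y + z) / (x + 1)), (y - z) / 2, 1, by linarith, by linarith, ?_,
      by ring⟩
    field_simp

/-- A representative `g` of the coset `g H` that corresponds to `p`. -/
def rep (p : deSitter) : SL(2, ℝ) := (exists_represents p).choose

/-- The vector `g (0, 1)`, which spans the line of `g P`. -/
def lineP (g : SL(2, ℝ)) : ℝ × ℝ := (g 0 1, g 1 1)

/-- The vector `g w (0, 1)`, which spans the line of `g w P`, for `w = !![0, -1; 1, 0]`. -/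
def lineWP (g : SL(2, ℝ)) : ℝ × ℝ := (-g 0 0, -g 1 0)

/-- Two representatives of the same point differ by `diag(t, t⁻¹)`, so the definitions below, which
only involve functions with `f (t⁻¹ • v) (t • w) = f v w`, do not depend on the choice of `rep`. -/
theorem represents_unique {g r : SL(2, ℝ)} {p : deSitter} (hg : Represents g p)
    (hr : Represents r p) :
    ∃ t : ℝ, t ≠ 0 ∧ lineP r = t⁻¹ • lineP g ∧ lineWP r = t • lineWP g := by
  have dg : g 0 0 * g 1 1 - g 0 1 * g 1 0 = 1 := by rw [← Matrix.det_fin_two]; exact g.2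
  have dr : r 0 0 * r 1 1 - r 0 1 * r 1 0 = 1 := by rw [← Matrix.det_fin_two]; exact r.2
  obtain ⟨g1, g2, g3⟩ := (represents_iff _ _).1 hg
  obtain ⟨r1, r2, r3⟩ := (represents_iff _ _).1 hr
  rw [g1] at r1
  rw [g2] at r2
  rw [g3] at r3
  unfold lineP lineWP
  generalize g 0 0 = a at *
  generalize g 0 1 = b at *
  generalize g 1 0 = c at *
  generalize g 1 1 = d at *
  generalize r 0 0 = a' at *
  generalize r 0 1 = b' at *
  generalize r 1 0 = c' at *
  generalize r 1 1 = d' at *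
  have p1 : a * (d * b' - b * d') = 0 := by
    linear_combination b' / 2 * r1 + d' / 2 * r2 + b' / 2 * dg - b' / 2 * dr
  have p2 : c * (d * b' - b * d') = 0 := by
    linear_combination b' / 2 * r3 - d' / 2 * r1 + d' / 2 * dg - d' / 2 * dr
  have h01 : d * b' - b * d' = 0 := by
    linear_combination d * p1 - b * p2 - (d * b' - b * d') * dg
  have q1 : b * (a * c' - c * a') = 0 := by
    linear_combination -a' / 2 * r1 - c' / 2 * r2 + a' / 2 * dg - a' / 2 * dr
  have q2 : d * (a * c' - c * a') = 0 := by
    linear_combination c' / 2 * r1 - a' / 2 * r3 + c' / 2 * dg - c' / 2 * dr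
  have h10 : a * c' - c * a' = 0 := by
    linear_combination a * q2 - c * q1 - (a * c' - c * a') * dg
  have ht : (d * a' - b * c') * (a * d' - c * b') = 1 := by
    linear_combination (a' * d' - b' * c') * dg + dr + (a * c' - c * a') * h01
  have ht0 : d * a' - b * c' ≠ 0 := left_ne_zero_of_mul_eq_one ht
  have hinv : (d * a' - b * c')⁻¹ = a * d' - c * b' := inv_eq_of_mul_eq_one_right ht
  refine ⟨d * a' - b * c', ht0, ?_, ?_⟩
  · rw [hinv]
    ext
    · simp only [Prod.smul_mk, smul_eq_mul]
      linear_combination -b' * dg + a * h01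
    · simp only [Prod.smul_mk, smul_eq_mul]
      linear_combination -d' * dg + c * h01
  · ext
    · simp only [Prod.smul_mk, smul_eq_mul]
      linear_combination a' * dg - b * h10
    · simp only [Prod.smul_mk, smul_eq_mul]
      linear_combination c' * dg - d * h10

/-- The pull-back `ι₁^*` of `ℒ ⊠ ℒ` along `g H ↦ (g P, g w P)`. The section need only be given
off the diagonal. In the Bruhat coordinates it is `f(ζ₁, ζ₂) ↦ (ζ₁ - ζ₂) f(ζ₁, ζ₂)`. -/
def pullback (f : ℝ × ℝ → ℝ × ℝ → ℂ) (p : deSitter) : ℂ :=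
  f (lineP (rep p)) (lineWP (rep p))

/-- The kernel `𝒦_ε^μ(x, y, z; ζ)`: the pull-back of `K_ε^μ` along `g H ↦ (g P, g w P)`. -/
def pulledKernel (ε : ℤˣ) (μ : ℂ) (p : deSitter) (v : ℝ × ℝ) : ℂ :=
  kernelK ε μ (lineP (rep p)) (lineWP (rep p)) v

/-- The coordinates `(cosh t cos θ, cosh t sin θ, sinh t)` of the de Sitter space. -/
def deSitterParam (s : ℝ × ℝ) : deSitter :=
  ⟨(Real.cosh s.1 * Real.cos s.2, Real.cosh s.1 * Real.sin s.2, Real.sinh s.1), by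
    have h1 := Real.cosh_sq s.1
    have h2 := Real.sin_sq_add_cos_sq s.2
    change (Real.cosh s.1 * Real.cos s.2) ^ 2 + (Real.cosh s.1 * Real.sin s.2) ^ 2
      - Real.sinh s.1 ^ 2 = 1
    linear_combination (Real.cosh s.1) ^ 2 * h2 + h1⟩

/-- The invariant measure `cosh t dt dθ` of the de Sitter space, which is the one of its Lorentzian
metric. -/
def deSitterMeasure : Measure deSitter :=
  (((volume : Measure (ℝ × ℝ)).restrict (Set.univ ×ˢ Set.Ioc (-Real.pi) Real.pi)).withDensity
    fun s => ENNReal.ofReal (Real.cosh s.1)).map deSitterParam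

/-- `C_c^∞` of the de Sitter space. It is a closed submanifold of `ℝ³`, so these are the restrictions
of the smooth compactly supported functions on `ℝ³`. -/
def IsTestFunction (h : deSitter → ℂ) : Prop :=
  ∃ H : ℝ × ℝ × ℝ → ℂ, ContDiff ℝ ∞ H ∧ HasCompactSupport H ∧ ∀ p : deSitter, h p = H p

/-! ## Poisson and Fourier transforms -/

/-- `Ψ = H_μ^ε φ` off the diagonal, where `μ = lam / 2 - 1` and `φ` is a section of `ℒ_lam`:
`Ψ(ζ₁, ζ₂) = (ζ₁ - ζ₂)⁻¹ ∫ φ(ζ) K_{-ε}^μ(ζ₁, ζ₂; ζ) dζ`. The integral converges for `0 < Re lam`,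
and is continued meromorphically in `lam`, along the sections `φ_ν(v) = φ(v) |v|^{lam - ν}` of
`ℒ_ν`, which have the same restriction to the unit circle as `φ`. -/
def IsHolographic (ε : ℤˣ) (lam : ℂ) (φ : ℝ × ℝ → ℂ) (Ψ : ℝ × ℝ → ℝ × ℝ → ℂ) : Prop :=
  ∀ v₁ v₂ : ℝ × ℝ, wedge v₁ v₂ ≠ 0 →
    HasContinuedIntegral (volume : Measure ℝ) {ν | 0 < ν.re}
      (fun ν ζ => ((wedge v₁ v₂ : ℝ) : ℂ)⁻¹ *
        (φ (ζ, 1) * ((1 + ζ ^ 2 : ℝ) : ℂ) ^ ((lam - ν) / 2) *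
          kernelK (-ε) (ν / 2 - 1) v₁ v₂ (ζ, 1)))
      lam (Ψ v₁ v₂)

/-- `u = 𝒫_lam^ε φ`, where `𝒫_lam^ε = ι₁^* ∘ H_{lam / 2 - 1}^ε`. -/
def IsPoissonTransform (ε : ℤˣ) (lam : ℂ) (φ : ℝ × ℝ → ℂ) (u : deSitter → ℂ) : Prop :=
  ∃ Ψ : ℝ × ℝ → ℝ × ℝ → ℂ, IsHolographic ε lam φ Ψ ∧ u = pullback Ψ

/-- `F = ℱ_lam^ε h`: the section `F` of `ℒ_lam` is the image of `h` under the dual of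
`𝒫_{2 - lam}^ε`. The pairing of sections of `ℒ_lam` and `ℒ_{2 - lam}` over `G/P` is the integral
over the Bruhat coordinate `ζ`. -/
def IsFourierTransform (ε : ℤˣ) (lam : ℂ) (h : deSitter → ℂ) (F : ℝ × ℝ → ℂ) : Prop :=
  IsSection lam F ∧ ∀ φ : ℝ × ℝ → ℂ, IsSection (2 - lam) φ →
    ∃ u : deSitter → ℂ, IsPoissonTransform ε (2 - lam) φ u ∧
      Integrable (fun p => h p * u p) deSitterMeasure ∧
      ∫ ζ : ℝ, F (ζ, 1) * φ (ζ, 1) = ∫ p, h p * u p ∂deSitterMeasure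

end

/-! ## Signed powers -/

/-! Representing a point `p` of the de Sitter space by two vectors of determinant one, the kernel
becomes a signed power of a quadratic form in `v` whose coefficients are the coordinates of `p`
(`pulledKernel_eq`). In the coordinates `(t, θ)`, and at the unit vector of angle `α`, this form is
`kap t (θ + 2 * α)` with `kap t φ = (sinh t + cosh t * sin φ) / 2`. Both transforms are therefore
integrals of smooth amplitudes against the same power `kap ^ μ`, `μ = -lam / 2`, over the de Sitter
space for the Fourier transform and over the circle for the Poisson transform. They converge for `-1
< Re μ`.

Continuation is by integration by parts, which raises `μ` by one at the price of a factor `(μ +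
1)⁻¹`. On the Fourier side one differentiates in `t`, where `∂_t kap > 0` (`shiftFamily_intF`). On
the Poisson side only the circle is available and `∂_α kap` has zeros, but `(∂_α kap)² = 1 + 4 kap
(sinh t - kap)`, so that the missing part carries a factor `kap` and also raises the exponent
(`shiftFamily_intP`). The structure `ShiftFamily` treats both cases: the continuation is a finite
expression in convergent integrals, its poles lie at the negative integers (hence `lam = 2, 4, 6,
...`), and it inherits smoothness in `v` and commutes with integration over parameters.

For the first part, Fubini gives the duality with the Poisson transform for `-1 < Re μ`
(`jointF_eq_jointP`), and the identity theorem carries it to the continuations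
(`integral_fourierSection_mul`). Thus the continued kernel integral `fourierSection` is a Fourier
transform. It is the only one: the difference of two pairs to zero with its own weighted conjugate,
so its square norm on the circle vanishes.

For the second part, the Sokhotski–Plemelj formula shows that the jump of `1 / (t + w)` is `-2πi`
times the point mass at `t = -w`. Hence the pairing with `1 / Q` is `-2πi (ζ₁ - ζ₂)⁻¹` times the
kernel of opposite sign (`pairingQ_eq`). The invariant measure is `2 (ζ₁ - ζ₂)⁻² dζ₁ dζ₂`, and the
constant is `c = -4πi`. Convergence for general `f` in the strip rests on `|ι₁^* f| ≤ C / cosh t`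
and on the integrability of `|kap| ^ σ` for `-1 < σ < 0` over the whole, non-compact coordinate
domain. -/

theorem units_int_cast_eq (ε : ℤˣ) : ((ε : ℤ) : ℝ) = 1 ∨ ((ε : ℤ) : ℝ) = -1 := by
  rcases Int.units_eq_one_or ε with rfl | rfl <;> simp

theorem units_int_cast_mul_self_complex (ε : ℤˣ) : ((ε : ℤ) : ℂ) * ((ε : ℤ) : ℂ) = 1 := by
  rcases Int.units_eq_one_or ε with rfl | rfl <;> simp

theorem units_int_cast_pos_abs {ε : ℤˣ} {t : ℝ} (h : 0 < ((ε : ℤ) : ℝ) * t) :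
    ((ε : ℤ) : ℝ) * t = |t| := by
  rcases units_int_cast_eq ε with h1 | h1 <;> rw [h1] at h ⊢
  · rw [abs_of_pos (by linarith), one_mul]
  · rw [abs_of_neg (by linarith), neg_one_mul]

theorem signedPow_zero_right (ε : ℤˣ) (μ : ℂ) : signedPow ε μ 0 = 0 := by
  simp [signedPow]

theorem signedPow_of_pos {ε : ℤˣ} {t : ℝ} (μ : ℂ) (h : 0 < ((ε : ℤ) : ℝ) * t) :
    signedPow ε μ t = ((|t| : ℝ) : ℂ) ^ μ := by
  rw [signedPow, if_pos h, units_int_cast_pos_abs h]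

theorem signedPow_of_nonpos {ε : ℤˣ} {t : ℝ} (μ : ℂ) (h : ((ε : ℤ) : ℝ) * t ≤ 0) :
    signedPow ε μ t = 0 := by
  rw [signedPow, if_neg (not_lt.2 h)]

theorem signedPow_neg_right (ε : ℤˣ) (μ : ℂ) (t : ℝ) :
    signedPow ε μ (-t) = signedPow (-ε) μ t := by
  simp [signedPow]

theorem norm_signedPow_le (ε : ℤˣ) (μ : ℂ) (t : ℝ) : ‖signedPow ε μ t‖ ≤ |t| ^ μ.re := by
  by_cases h : 0 < ((ε : ℤ) : ℝ) * t
  · have ht : t ≠ 0 := by rintro rfl; simp at h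
    rw [signedPow_of_pos μ h, Complex.norm_cpow_eq_rpow_re_of_pos (abs_pos.2 ht)]
  · rw [signedPow_of_nonpos μ (not_lt.1 h), norm_zero]
    positivity

theorem signedPow_mul_of_pos (ε : ℤˣ) (μ : ℂ) {r : ℝ} (hr : 0 < r) (t : ℝ) :
    signedPow ε μ (r * t) = (r : ℂ) ^ μ * signedPow ε μ t := by
  by_cases h : 0 < ((ε : ℤ) : ℝ) * t
  · have h' : 0 < ((ε : ℤ) : ℝ) * (r * t) := by
      rw [mul_left_comm]; exact mul_pos hr h
    rw [signedPow_of_pos μ h, signedPow_of_pos μ h', abs_mul, abs_of_pos hr, Complex.ofReal_mul,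
      Complex.mul_cpow_ofReal_nonneg hr.le (abs_nonneg t)]
  · have h' : ((ε : ℤ) : ℝ) * (r * t) ≤ 0 := by
      rw [mul_left_comm]; exact mul_nonpos_of_nonneg_of_nonpos hr.le (not_lt.1 h)
    rw [signedPow_of_nonpos μ (not_lt.1 h), signedPow_of_nonpos μ h', mul_zero]

/-- On the support `|t| = ε t`, so one more power of `|t|` is the factor `ε t`. This trades a factor
`kap` for a shift of the exponent. -/
theorem signedPow_add_one (ε : ℤˣ) (μ : ℂ) (t : ℝ) :
    signedPow ε (μ + 1) t = ((ε : ℤ) : ℂ) * (t * signedPow ε μ t) := by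
  by_cases h : 0 < ((ε : ℤ) : ℝ) * t
  · have ht : t ≠ 0 := by rintro rfl; simp at h
    rw [signedPow_of_pos _ h, signedPow_of_pos _ h,
      Complex.cpow_add _ _ (by exact_mod_cast (abs_pos.2 ht).ne'), Complex.cpow_one,
      ← units_int_cast_pos_abs h]
    push_cast
    ring
  · rw [signedPow_of_nonpos _ (not_lt.1 h), signedPow_of_nonpos _ (not_lt.1 h)]
    simp

theorem measurable_signedPow (ε : ℤˣ) (μ : ℂ) : Measurable (signedPow ε μ) := by
  unfold signedPow
  refine Measurable.ite (measurableSet_lt measurable_const (measurable_id.const_mul _)) ?_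
    measurable_const
  exact (Complex.measurable_ofReal.comp (measurable_id.const_mul _)).pow_const _

theorem hasDerivAt_signedPow_of_ne (ε : ℤˣ) (μ : ℂ) {t : ℝ} (ht : t ≠ 0) :
    HasDerivAt (signedPow ε (μ + 1)) (((ε : ℤ) : ℂ) * (μ + 1) * signedPow ε μ t) t := by
  rcases lt_or_gt_of_ne (show ((ε : ℤ) : ℝ) * t ≠ 0 from mul_ne_zero
    (by rcases units_int_cast_eq ε with h | h <;> rw [h] <;> norm_num) ht) with h | h
  · rw [signedPow_of_nonpos μ h.le, mul_zero]
    refine (hasDerivAt_const t (0 : ℂ)).congr_of_eventuallyEq ?_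
    filter_upwards [(isOpen_lt (continuous_const.mul continuous_id) continuous_const).mem_nhds h]
      with s hs using signedPow_of_nonpos _ (le_of_lt hs)
  · have h1 : HasDerivAt (fun s : ℝ => (((((ε : ℤ) : ℝ) * s : ℝ)) : ℂ)) ((ε : ℤ) : ℂ) t := by
      have := ((hasDerivAt_id t).const_mul (((ε : ℤ) : ℝ))).ofReal_comp
      simpa using this
    have h2 := ((hasDerivAt_id' ((((ε : ℤ) : ℝ) * t : ℝ) : ℂ)).cpow_const (c := μ + 1)
      (Or.inl (by simpa using h))).scomp t h1
    have h3 : HasDerivAt (signedPow ε (μ + 1)) (((ε : ℤ) : ℂ) • ((μ + 1) *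
        (((((ε : ℤ) : ℝ) * t : ℝ)) : ℂ) ^ (μ + 1 - 1) * 1)) t := by
      refine h2.congr_of_eventuallyEq ?_
      filter_upwards [(isOpen_lt continuous_const (continuous_const.mul continuous_id)).mem_nhds h]
        with s hs
      exact if_pos hs
    rw [signedPow, if_pos h]
    convert h3 using 1
    rw [add_sub_cancel_right, smul_eq_mul]
    ring

theorem hasDerivAt_signedPow (ε : ℤˣ) {μ : ℂ} (hμ : 0 < μ.re) (t : ℝ) :
    HasDerivAt (signedPow ε (μ + 1)) (((ε : ℤ) : ℂ) * (μ + 1) * signedPow ε μ t) t := by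
  rcases eq_or_ne t 0 with rfl | ht
  · rw [signedPow_zero_right, mul_zero, hasDerivAt_iff_tendsto_slope]
    -- The slope at the origin is `signedPow ε μ s` up to sign, and it tends to `0` because `0 <
    -- μ.re`.
    have hb : ∀ s : ℝ, ‖slope (signedPow ε (μ + 1)) 0 s‖ ≤ |s| ^ μ.re := by
      intro s
      rcases eq_or_ne s 0 with rfl | hs
      · simp only [slope_same, norm_zero]; positivity
      rw [slope_def_module, signedPow_zero_right, sub_zero, sub_zero, signedPow_add_one, norm_smul,
        norm_mul, norm_mul, Complex.norm_real, norm_inv]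
      have h1 : ‖((ε : ℤ) : ℂ)‖ = 1 := by
        rcases Int.units_eq_one_or ε with rfl | rfl <;> simp
      rw [h1, one_mul, inv_mul_cancel_left₀ (norm_ne_zero_iff.2 hs)]
      exact norm_signedPow_le ε μ s
    refine squeeze_zero_norm hb ?_
    have : ContinuousAt (fun s : ℝ => |s| ^ μ.re) 0 :=
      (continuous_abs.continuousAt).rpow_const (Or.inr hμ.le)
    have h2 := this.tendsto
    simp only [abs_zero, Real.zero_rpow hμ.ne'] at h2
    exact h2.mono_left nhdsWithin_le_nhds
  · exact hasDerivAt_signedPow_of_ne ε μ ht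

theorem continuous_signedPow (ε : ℤˣ) {μ : ℂ} (hμ : 0 < μ.re) : Continuous (signedPow ε μ) := by
  rw [continuous_iff_continuousAt]
  intro t
  rcases eq_or_ne t 0 with rfl | ht
  · rw [ContinuousAt, signedPow_zero_right]
    refine squeeze_zero_norm (norm_signedPow_le ε μ) ?_
    have : ContinuousAt (fun s : ℝ => |s| ^ μ.re) 0 :=
      (continuous_abs.continuousAt).rpow_const (Or.inr hμ.le)
    simpa [ContinuousAt, Real.zero_rpow hμ.ne'] using this
  · have := hasDerivAt_signedPow_of_ne ε (μ - 1) ht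
    rw [sub_add_cancel] at this
    exact this.continuousAt

theorem continuousAt_signedPow (ε : ℤˣ) (μ : ℂ) {t : ℝ} (ht : t ≠ 0) :
    ContinuousAt (signedPow ε μ) t := by
  have := hasDerivAt_signedPow_of_ne ε (μ - 1) ht
  rw [sub_add_cancel] at this
  exact this.continuousAt

/-! ## Holomorphy of integrals of signed powers -/

/-- The logarithm costs at most `x ^ (-η) / η` below `1` and `x ^ η / η` above `1`. The bound is
uniform in `σ` and dominates the derivative of a power in its exponent. -/
theorem abs_log_mul_rpow_le {x η σ₀ σ : ℝ} (hx : 0 < x) (hη : 0 < η) (h : |σ - σ₀| < η) :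
    x ^ σ * |Real.log x| ≤ (x ^ (σ₀ - 2 * η) + x ^ (σ₀ + 2 * η)) / η := by
  obtain ⟨h1, h2⟩ := abs_lt.1 h
  rw [le_div_iff₀ hη]
  rcases le_total x 1 with h' | h'
  · have hl : |Real.log x| * η ≤ x ^ (-η) := by
      rw [abs_of_nonpos (Real.log_nonpos hx.le h'), ← Real.log_inv]
      have := Real.log_le_rpow_div (inv_pos.2 hx).le hη
      rw [le_div_iff₀ hη, Real.inv_rpow hx.le, ← Real.rpow_neg hx.le] at this
      exact this
    calc x ^ σ * |Real.log x| * η = x ^ σ * (|Real.log x| * η) := by ring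
      _ ≤ x ^ σ * x ^ (-η) := by gcongr
      _ = x ^ (σ - η) := by rw [← Real.rpow_add hx]; ring_nf
      _ ≤ x ^ (σ₀ - 2 * η) := Real.rpow_le_rpow_of_exponent_ge hx h' (by linarith)
      _ ≤ _ := le_add_of_nonneg_right (by positivity)
  · have hl : |Real.log x| * η ≤ x ^ η := by
      rw [abs_of_nonneg (Real.log_nonneg h')]
      have := Real.log_le_rpow_div hx.le hη
      rwa [le_div_iff₀ hη] at this
    calc x ^ σ * |Real.log x| * η = x ^ σ * (|Real.log x| * η) := by ring
      _ ≤ x ^ σ * x ^ η := by gcongr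
      _ = x ^ (σ + η) := by rw [← Real.rpow_add hx]
      _ ≤ x ^ (σ₀ + 2 * η) := Real.rpow_le_rpow_of_exponent_le h' (by linarith)
      _ ≤ _ := le_add_of_nonneg_left (by positivity)

section
variable {X : Type*} [MeasurableSpace X] {m : Measure X} {g : X → ℂ} {κ : X → ℝ}

theorem aestronglyMeasurable_mul_signedPow (hg : AEStronglyMeasurable g m) (hκ : Measurable κ)
    (ε : ℤˣ) (μ : ℂ) : AEStronglyMeasurable (fun x => g x * signedPow ε μ (κ x)) m :=
  hg.mul ((measurable_signedPow ε μ).comp hκ).aestronglyMeasurable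

theorem integrable_mul_signedPow (hg : AEStronglyMeasurable g m) (hκ : Measurable κ)
    (ε : ℤˣ) {μ : ℂ} (hi : Integrable (fun x => ‖g x‖ * |κ x| ^ μ.re) m) :
    Integrable (fun x => g x * signedPow ε μ (κ x)) m := by
  refine hi.mono' (aestronglyMeasurable_mul_signedPow hg hκ ε μ) (Eventually.of_forall fun x => ?_)
  rw [norm_mul]
  gcongr
  exact norm_signedPow_le _ _ _

/-- Differentiation under the integral sign; the logarithmic factor is absorbed by slightly changed
exponents, at which integrability is still assumed. -/
theorem differentiableOn_integral_mul_signedPow (hg : AEStronglyMeasurable g m)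
    (hκ : Measurable κ) (ε : ℤˣ)
    (hi : ∀ σ : ℝ, -1 < σ → Integrable (fun x => ‖g x‖ * |κ x| ^ σ) m) :
    DifferentiableOn ℂ (fun μ => ∫ x, g x * signedPow ε μ (κ x) ∂m) {μ | -1 < μ.re} := by
  intro μ₀ hμ₀
  have hμ₀' : -1 < μ₀.re := hμ₀
  -- One `η` is spent on the radius of the ball around `μ₀` and one on the logarithm, so `μ₀.re - 2
  -- * η` must stay above `-1`.
  obtain ⟨η, hη, hη'⟩ : ∃ η : ℝ, 0 < η ∧ -1 < μ₀.re - 2 * η :=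
    ⟨(μ₀.re + 1) / 3, by linarith, by linarith⟩
  have hderiv := hasDerivAt_integral_of_dominated_loc_of_deriv_le (μ := m) (𝕜 := ℂ)
    (F := fun μ x => g x * signedPow ε μ (κ x))
    (F' := fun μ x => g x * (signedPow ε μ (κ x) * ((Real.log |κ x| : ℝ) : ℂ)))
    (x₀ := μ₀) (s := Metric.ball μ₀ η)
    (bound := fun x => (‖g x‖ * |κ x| ^ (μ₀.re - 2 * η) + ‖g x‖ * |κ x| ^ (μ₀.re + 2 * η)) / η)
    (Metric.ball_mem_nhds _ hη)
    (Eventually.of_forall fun μ => aestronglyMeasurable_mul_signedPow hg hκ ε μ)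
    (integrable_mul_signedPow hg hκ ε (hi _ hμ₀'))
    (hg.mul (((measurable_signedPow ε μ₀).comp hκ).mul (Complex.measurable_ofReal.comp
      (Real.measurable_log.comp hκ.abs))).aestronglyMeasurable)
    (Eventually.of_forall fun x μ hμ => ?_) ?_ (Eventually.of_forall fun x μ _ => ?_)
  · exact hderiv.2.differentiableAt.differentiableWithinAt
  · rw [norm_mul, norm_mul, Complex.norm_real, ← mul_add, mul_div_assoc]
    gcongr
    rcases eq_or_ne (κ x) 0 with h0 | h0
    · rw [h0, signedPow_zero_right, norm_zero, zero_mul]; positivity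
    refine le_trans (mul_le_mul_of_nonneg_right (norm_signedPow_le _ _ _) (norm_nonneg _)) ?_
    refine abs_log_mul_rpow_le (abs_pos.2 h0) hη ?_
    rw [← Complex.sub_re]
    exact lt_of_le_of_lt (Complex.abs_re_le_norm _) (by simpa [dist_eq_norm] using hμ)
  · exact ((hi _ hη').add (hi _ (by linarith))).div_const η
  · refine HasDerivAt.const_mul _ ?_
    by_cases h : 0 < ((ε : ℤ) : ℝ) * κ x
    · have h0 : κ x ≠ 0 := by intro h0; rw [h0] at h; simp at h
      have h1 : ((|κ x| : ℝ) : ℂ) ≠ 0 := by exact_mod_cast (abs_pos.2 h0).ne'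
      have := (hasDerivAt_id μ).const_cpow (c := ((|κ x| : ℝ) : ℂ)) (Or.inl h1)
      rw [signedPow_of_pos μ h, Complex.ofReal_log (abs_nonneg _)]
      simpa [signedPow_of_pos _ h] using this
    · simp only [signedPow_of_nonpos _ (not_lt.1 h), zero_mul]
      exact hasDerivAt_const _ _

end

/-! ## Continuation by a functional equation -/

/-- The `k`-fold iterate of the functional equation
`J g μ = ε ((μ + 1)⁻¹ J (A g) (μ + 1) + J (B g) (μ + 1))`. -/
noncomputable def shiftedIterate {𝒢 : Type*} (ε : ℤˣ) (A B : 𝒢 → 𝒢) (J : 𝒢 → ℂ → ℂ) :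
    ℕ → 𝒢 → ℂ → ℂ
  | 0, g, μ => J g μ
  | k + 1, g, μ => ((ε : ℤ) : ℂ) * ((μ + 1)⁻¹ * shiftedIterate ε A B J k (A g) (μ + 1) +
      shiftedIterate ε A B J k (B g) (μ + 1))

/-- The continuation of `J g` to the complex plane by its functional equation. -/
noncomputable def continuation {𝒢 : Type*} (ε : ℤˣ) (A B : 𝒢 → 𝒢) (J : 𝒢 → ℂ → ℂ) (g : 𝒢) (μ : ℂ) :
    ℂ :=
  shiftedIterate ε A B J ⌈-μ.re⌉₊ g μ

/-- A family of holomorphic functions on the half-plane `-1 < Re μ` that satisfies the functional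
equation of `shiftedIterate`. -/
structure ShiftFamily {𝒢 : Type*} (ε : ℤˣ) (A B : 𝒢 → 𝒢) (J : 𝒢 → ℂ → ℂ) (Adm : 𝒢 → Prop) :
    Prop where
  admA : ∀ g, Adm g → Adm (A g)
  admB : ∀ g, Adm g → Adm (B g)
  diff : ∀ g, Adm g → DifferentiableOn ℂ (J g) {μ | -1 < μ.re}
  eqn : ∀ g, Adm g → ∀ μ : ℂ, -1 < μ.re →
    J g μ = ((ε : ℤ) : ℂ) * ((μ + 1)⁻¹ * J (A g) (μ + 1) + J (B g) (μ + 1))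

/-- The complement of the negative integers. -/
def nonPole : Set ℂ := {μ | ∀ n : ℕ, μ ≠ -((n : ℂ) + 1)}

theorem nonPole_add_one {μ : ℂ} (h : μ ∈ nonPole) : μ + 1 ∈ nonPole := by
  intro n hn
  refine h (n + 1) ?_
  push_cast
  linear_combination hn

theorem nonPole_add_one_ne {μ : ℂ} (h : μ ∈ nonPole) : μ + 1 ≠ 0 := by
  intro h0
  refine h 0 ?_
  push_cast
  linear_combination h0

theorem isOpen_nonPole : IsOpen nonPole := by
  have h : nonPole = (Set.range fun n : ℕ => -((n : ℂ) + 1))ᶜ := by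
    ext μ
    simp only [nonPole, Set.mem_ofPred_eq, Set.mem_compl_iff, Set.mem_range, not_exists]
    exact ⟨fun h n hn => h n hn.symm, fun h n hn => h n hn.symm⟩
  rw [h, isOpen_compl_iff]
  have h2 : Set.range (fun n : ℕ => -((n : ℂ) + 1)) =
      Set.range ((fun k : ℤ => (k : ℂ)) ∘ fun n : ℕ => -((n : ℤ) + 1)) := by
    congr 1; ext n; simp
  rw [h2, Set.range_comp]
  exact Complex.isClosedEmbedding_intCast.isClosedMap _ (isClosed_discrete _)

/-- A countable set does not disconnect a real vector space of dimension greater than one. -/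
theorem isPreconnected_nonPole : IsPreconnected nonPole := by
  have h : nonPole = (Set.range fun n : ℕ => -((n : ℂ) + 1))ᶜ := by
    ext μ
    simp only [nonPole, Set.mem_ofPred_eq, Set.mem_compl_iff, Set.mem_range, not_exists]
    exact ⟨fun h n hn => h n hn.symm, fun h n hn => h n hn.symm⟩
  rw [h]
  refine ((Set.countable_range _).isConnected_compl_of_one_lt_rank ?_).isPreconnected
  rw [Complex.rank_real_complex]
  norm_num

theorem mem_nonPole_of_re {μ : ℂ} (h : -1 < μ.re) : μ ∈ nonPole := by
  intro n hn
  rw [hn] at h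
  simp at h
  have : (0 : ℝ) ≤ n := n.cast_nonneg
  linarith

theorem isOpen_halfPlane (a : ℝ) : IsOpen {μ : ℂ | a < μ.re} :=
  isOpen_lt continuous_const Complex.continuous_re

theorem isPreconnected_halfPlane (a : ℝ) : IsPreconnected {μ : ℂ | a < μ.re} :=
  (convex_halfSpace_re_gt a).isPreconnected

namespace ShiftFamily

variable {𝒢 : Type*} {ε : ℤˣ} {A B : 𝒢 → 𝒢} {J : 𝒢 → ℂ → ℂ} {Adm : 𝒢 → Prop}

/-- The extra iteration acts at the innermost level, where the argument has been shifted into `-1 <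
Re μ` and the functional equation holds. -/
theorem shiftedIterate_succ (H : ShiftFamily ε A B J Adm) (k : ℕ) :
    ∀ g, Adm g → ∀ μ : ℂ, -1 - (k : ℝ) < μ.re →
      shiftedIterate ε A B J (k + 1) g μ = shiftedIterate ε A B J k g μ := by
  induction k with
  | zero =>
    intro g hg μ hμ
    simp only [shiftedIterate]
    exact (H.eqn g hg μ (by simpa using hμ)).symm
  | succ k ih =>
    intro g hg μ hμ
    have h : -1 - (k : ℝ) < (μ + 1).re := by
      push_cast at hμ
      simp only [Complex.add_re, Complex.one_re]
      linarith
    conv_lhs => rw [shiftedIterate]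
    rw [ih _ (H.admA g hg) _ h, ih _ (H.admB g hg) _ h]
    rfl

theorem shiftedIterate_add (H : ShiftFamily ε A B J Adm) (k j : ℕ) {g : 𝒢} (hg : Adm g) {μ : ℂ}
    (hμ : -1 - (k : ℝ) < μ.re) :
    shiftedIterate ε A B J (k + j) g μ = shiftedIterate ε A B J k g μ := by
  induction j with
  | zero => rfl
  | succ j ih =>
    rw [← add_assoc, H.shiftedIterate_succ (k + j) g hg μ, ih]
    push_cast
    linarith [(j.cast_nonneg : (0 : ℝ) ≤ j)]

/-- The number of iterations in `continuation` jumps with `μ`. Since additional iterations change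
nothing, a fixed `k` serves on a whole half-plane, and regularity can be checked there. -/
theorem continuation_eq (H : ShiftFamily ε A B J Adm) (k : ℕ) {g : 𝒢} (hg : Adm g) {μ : ℂ}
    (hμ : -1 - (k : ℝ) < μ.re) :
    continuation ε A B J g μ = shiftedIterate ε A B J k g μ := by
  have h0 : -1 - ((⌈-μ.re⌉₊ : ℕ) : ℝ) < μ.re := by
    have := Nat.le_ceil (-μ.re)
    linarith
  unfold continuation
  rcases le_total ⌈-μ.re⌉₊ k with h | h
  · obtain ⟨j, hj⟩ := Nat.exists_eq_add_of_le h
    have h1 := H.shiftedIterate_add _ j hg h0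
    rw [← hj] at h1
    exact h1.symm
  · obtain ⟨j, hj⟩ := Nat.exists_eq_add_of_le h
    rw [hj, H.shiftedIterate_add _ _ hg hμ]

theorem continuation_of_re (H : ShiftFamily ε A B J Adm) {g : 𝒢} (hg : Adm g) {μ : ℂ}
    (hμ : -1 < μ.re) : continuation ε A B J g μ = J g μ := by
  rw [H.continuation_eq 0 hg (by simpa using hμ)]
  rfl

/-- Poles arise only from the factors `(μ + 1)⁻¹`, and the complement of the negative integers is
stable under `μ ↦ μ + 1`. -/
theorem differentiableAt_shiftedIterate (H : ShiftFamily ε A B J Adm) (k : ℕ) :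
    ∀ g, Adm g → ∀ μ : ℂ, -1 - (k : ℝ) < μ.re → μ ∈ nonPole →
      DifferentiableAt ℂ (shiftedIterate ε A B J k g) μ := by
  induction k with
  | zero =>
    intro g hg μ hμ _
    exact (H.diff g hg).differentiableAt ((isOpen_halfPlane (-1)).mem_nhds (by simpa using hμ))
  | succ k ih =>
    intro g hg μ hμ hp
    have h : -1 - (k : ℝ) < (μ + 1).re := by
      push_cast at hμ
      simp only [Complex.add_re, Complex.one_re]
      linarith
    have hs : DifferentiableAt ℂ (fun z : ℂ => z + 1) μ := by fun_prop
    have h1 := (ih _ (H.admA g hg) _ h (nonPole_add_one hp)).comp μ hs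
    have h2 := (ih _ (H.admB g hg) _ h (nonPole_add_one hp)).comp μ hs
    exact (((hs.inv (nonPole_add_one_ne hp)).mul h1).add h2).const_mul _

theorem meromorphicAt_shiftedIterate (H : ShiftFamily ε A B J Adm) (k : ℕ) :
    ∀ g, Adm g → ∀ μ : ℂ, -1 - (k : ℝ) < μ.re →
      MeromorphicAt (shiftedIterate ε A B J k g) μ := by
  induction k with
  | zero =>
    intro g hg μ hμ
    exact ((H.diff g hg).analyticAt
      ((isOpen_halfPlane (-1)).mem_nhds (by simpa using hμ))).meromorphicAt
  | succ k ih =>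
    intro g hg μ hμ
    have h : -1 - (k : ℝ) < (μ + 1).re := by
      push_cast at hμ
      simp only [Complex.add_re, Complex.one_re]
      linarith
    have hs : AnalyticAt ℂ (fun z : ℂ => z + 1) μ := by fun_prop
    have h1 :=
      MeromorphicAt.comp_analyticAt (g := fun z : ℂ => z + 1) (f := shiftedIterate ε A B J k (A g)) 
        (ih _ (H.admA g hg) _ h) hs
    have h2 :=
      MeromorphicAt.comp_analyticAt (g := fun z : ℂ => z + 1) (f := shiftedIterate ε A B J k (B g)) 
        (ih _ (H.admB g hg) _ h) hs
    exact (MeromorphicAt.const _ _).mul ((hs.meromorphicAt.inv.mul h1).add h2)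

theorem continuation_eventuallyEq (H : ShiftFamily ε A B J Adm) {g : 𝒢} (hg : Adm g) (μ : ℂ) :
    ∃ k : ℕ, -1 - (k : ℝ) < μ.re ∧
      continuation ε A B J g =ᶠ[𝓝 μ] shiftedIterate ε A B J k g := by
  obtain ⟨k, hk⟩ := exists_nat_gt (-1 - μ.re)
  have hk' : -1 - (k : ℝ) < μ.re := by linarith
  refine ⟨k, hk', ?_⟩
  filter_upwards [(isOpen_halfPlane (-1 - (k : ℝ))).mem_nhds hk'] with z hz
  exact H.continuation_eq k hg hz

theorem analyticOnNhd_continuation (H : ShiftFamily ε A B J Adm) {g : 𝒢} (hg : Adm g) :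
    AnalyticOnNhd ℂ (continuation ε A B J g) nonPole := by
  have hd : DifferentiableOn ℂ (continuation ε A B J g) nonPole := by
    intro μ hμ
    obtain ⟨k, hk, he⟩ := H.continuation_eventuallyEq hg μ
    exact ((H.differentiableAt_shiftedIterate k g hg μ hk hμ).congr_of_eventuallyEq
      he).differentiableWithinAt
  exact hd.analyticOnNhd isOpen_nonPole

theorem meromorphic_continuation (H : ShiftFamily ε A B J Adm) {g : 𝒢} (hg : Adm g) (μ : ℂ) :
    MeromorphicAt (continuation ε A B J g) μ := by
  obtain ⟨k, hk, he⟩ := H.continuation_eventuallyEq hg μ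
  exact (H.meromorphicAt_shiftedIterate k g hg μ hk).congr (he.symm.filter_mono nhdsWithin_le_nhds)

/-- Two continuations that agree on the half-plane of convergence agree off the poles. -/
theorem continuation_unique {𝒢' : Type*} {ε' : ℤˣ} {A' B' : 𝒢' → 𝒢'} {J' : 𝒢' → ℂ → ℂ}
    {Adm' : 𝒢' → Prop} (H : ShiftFamily ε A B J Adm) (H' : ShiftFamily ε' A' B' J' Adm')
    {g : 𝒢} (hg : Adm g) {g' : 𝒢'} (hg' : Adm' g')
    (h : ∀ μ : ℂ, -1 < μ.re → J g μ = J' g' μ) {μ : ℂ} (hμ : μ ∈ nonPole) :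
    continuation ε A B J g μ = continuation ε' A' B' J' g' μ := by
  refine (H.analyticOnNhd_continuation hg).eqOn_of_preconnected_of_eventuallyEq
    (H'.analyticOnNhd_continuation hg') isPreconnected_nonPole
    (z₀ := 0) (mem_nonPole_of_re (by simp)) ?_ hμ
  filter_upwards [(isOpen_halfPlane (-1)).mem_nhds (show (-1 : ℝ) < (0 : ℂ).re by simp)] with z hz
  rw [H.continuation_of_re hg hz, H'.continuation_of_re hg' hz, h z hz]

/-- It suffices to have the functional equation on a smaller half-plane. -/
theorem of_eqn_re_pos (hA : ∀ g, Adm g → Adm (A g)) (hB : ∀ g, Adm g → Adm (B g))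
    (hd : ∀ g, Adm g → DifferentiableOn ℂ (J g) {μ | -1 < μ.re})
    (he : ∀ g, Adm g → ∀ μ : ℂ, 0 < μ.re →
      J g μ = ((ε : ℤ) : ℂ) * ((μ + 1)⁻¹ * J (A g) (μ + 1) + J (B g) (μ + 1))) :
    ShiftFamily ε A B J Adm := by
  refine ⟨hA, hB, hd, fun g hg μ hμ => ?_⟩
  have hs : DifferentiableOn ℂ (fun z : ℂ => z + 1) {μ | -1 < μ.re} := by fun_prop
  have hm : Set.MapsTo (fun z : ℂ => z + 1) {μ | -1 < μ.re} {μ | -1 < μ.re} := by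
    intro z hz
    simp only [Set.mem_ofPred_eq, Complex.add_re, Complex.one_re] at hz ⊢
    linarith
  have h2 : DifferentiableOn ℂ (fun μ => ((ε : ℤ) : ℂ) * ((μ + 1)⁻¹ * J (A g) (μ + 1) +
      J (B g) (μ + 1))) {μ | -1 < μ.re} := by
    refine (((hs.inv fun z hz => nonPole_add_one_ne (mem_nonPole_of_re hz)).mul
      ((hd _ (hA g hg)).comp hs hm)).add ((hd _ (hB g hg)).comp hs hm)).const_mul _
  -- Both sides are holomorphic for `-1 < Re μ`, so the identity theorem applies. In the
  -- applications `0 < Re μ` makes `signedPow ε (μ + 1)` continuously differentiable, as integration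
  -- by parts requires.
  refine ((hd g hg).analyticOnNhd (isOpen_halfPlane _)).eqOn_of_preconnected_of_eventuallyEq
    (h2.analyticOnNhd (isOpen_halfPlane _)) (isPreconnected_halfPlane _)
    (z₀ := 1) (by simp) ?_ hμ
  filter_upwards [(isOpen_halfPlane 0).mem_nhds (show (0 : ℝ) < (1 : ℂ).re by simp)] with z hz
  exact he g hg z hz

/-- Integration of a family of continuations over a parameter. -/
theorem integral_shiftedIterate {W : Type*} [MeasurableSpace W] {n : Measure W} {c : W → ℂ}
    {J : W → 𝒢 → ℂ → ℂ} (hA : ∀ g, Adm g → Adm (A g)) (hB : ∀ g, Adm g → Adm (B g))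
    (hi : ∀ g, Adm g → ∀ μ : ℂ, -1 < μ.re → Integrable (fun w => c w * J w g μ) n) (k : ℕ) :
    ∀ g, Adm g → ∀ μ : ℂ, -1 - (k : ℝ) < μ.re →
      Integrable (fun w => c w * shiftedIterate ε A B (J w) k g μ) n ∧
      ∫ w, c w * shiftedIterate ε A B (J w) k g μ ∂n =
        shiftedIterate ε A B (fun g μ => ∫ w, c w * J w g μ ∂n) k g μ := by
  induction k with
  | zero =>
    intro g hg μ hμ
    exact ⟨hi g hg μ (by simpa using hμ), rfl⟩
  | succ k ih =>
    intro g hg μ hμ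
    have h : -1 - (k : ℝ) < (μ + 1).re := by
      push_cast at hμ
      simp only [Complex.add_re, Complex.one_re]
      linarith
    obtain ⟨i1, e1⟩ := ih _ (hA g hg) _ h
    obtain ⟨i2, e2⟩ := ih _ (hB g hg) _ h
    have hf : (fun w => c w * shiftedIterate ε A B (J w) (k + 1) g μ) = fun w =>
        ((ε : ℤ) : ℂ) * ((μ + 1)⁻¹ * (c w * shiftedIterate ε A B (J w) k (A g) (μ + 1)) +
          c w * shiftedIterate ε A B (J w) k (B g) (μ + 1)) := by
      funext w
      simp only [shiftedIterate]
      ring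
    rw [hf]
    refine ⟨((i1.const_mul _).add i2).const_mul _, ?_⟩
    rw [integral_const_mul, integral_add (i1.const_mul _) i2, integral_const_mul, e1, e2]
    rfl

/-- The number of iterations depends on `μ` alone and not on the parameter `w`, so the integral
passes through finitely many linear operations. -/
theorem integral_continuation {W : Type*} [MeasurableSpace W] {n : Measure W} {c : W → ℂ}
    {J : W → 𝒢 → ℂ → ℂ} (hA : ∀ g, Adm g → Adm (A g)) (hB : ∀ g, Adm g → Adm (B g))
    (hi : ∀ g, Adm g → ∀ μ : ℂ, -1 < μ.re → Integrable (fun w => c w * J w g μ) n)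
    {g : 𝒢} (hg : Adm g) (μ : ℂ) :
    Integrable (fun w => c w * continuation ε A B (J w) g μ) n ∧
      ∫ w, c w * continuation ε A B (J w) g μ ∂n =
        continuation ε A B (fun g μ => ∫ w, c w * J w g μ ∂n) g μ := by
  have h0 : -1 - ((⌈-μ.re⌉₊ : ℕ) : ℝ) < μ.re := by
    have := Nat.le_ceil (-μ.re)
    linarith
  exact integral_shiftedIterate hA hB hi _ g hg μ h0

end ShiftFamily

/-! ## Continued integrals -/

/-- The difference of the two meromorphic functions has order `⊤` at a point of `S`, and this
propagates over the connected plane. -/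
theorem HasContinuedIntegral.unique {X : Type*} [MeasurableSpace X] {m : Measure X} {S : Set ℂ}
    {k : ℂ → X → ℂ} {ν₀ I I' : ℂ} (hS : IsOpen S) (hS' : S.Nonempty)
    (h : HasContinuedIntegral m S k ν₀ I) (h' : HasContinuedIntegral m S k ν₀ I') : I = I' := by
  obtain ⟨M, hM, hMS, hMa, rfl⟩ := h
  obtain ⟨M', hM', hMS', hMa', rfl⟩ := h'
  have hD : MeromorphicOn (M - M') Set.univ := hM.sub hM'
  obtain ⟨z, hz⟩ := hS'
  have hz0 : meromorphicOrderAt (M - M') z = ⊤ := by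
    rw [meromorphicOrderAt_eq_top_iff]
    refine Eventually.filter_mono nhdsWithin_le_nhds ?_
    filter_upwards [hS.mem_nhds hz] with w hw
    rw [Pi.sub_apply, (hMS w hw).2, (hMS' w hw).2, sub_self]
  have hν : meromorphicOrderAt (M - M') ν₀ = ⊤ := by
    by_contra hne
    have := (hD.exists_meromorphicOrderAt_ne_top_iff_forall isConnected_univ).1
      ⟨⟨ν₀, Set.mem_univ _⟩, hne⟩ ⟨z, Set.mem_univ _⟩
    exact this hz0
  rw [meromorphicOrderAt_eq_top_iff] at hν
  -- Order `⊤` gives vanishing only on a punctured neighbourhood; holomorphy at `ν₀` recovers the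
  -- value itself.
  have hc : ContinuousAt (M - M') ν₀ := (hMa.sub hMa').continuousAt
  have h1 : Tendsto (M - M') (𝓝[≠] ν₀) (𝓝 ((M - M') ν₀)) :=
    hc.tendsto.mono_left nhdsWithin_le_nhds
  have h2 : Tendsto (M - M') (𝓝[≠] ν₀) (𝓝 0) := tendsto_const_nhds.congr' (by
    filter_upwards [hν] with w hw using hw.symm)
  exact sub_eq_zero.1 (tendsto_nhds_unique h1 h2)

/-- Needed because test functions give convergence on `Re ν < 2`, general sections only on the strip
`0 < Re ν < 2`. -/
theorem HasContinuedIntegral.congr {X : Type*} [MeasurableSpace X] {m : Measure X} {S S' : Set ℂ}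
    {k : ℂ → X → ℂ} {ν₀ I : ℂ} (h : HasContinuedIntegral m S k ν₀ I) (hS : S' ⊆ S) :
    HasContinuedIntegral m S' k ν₀ I := by
  obtain ⟨M, hM, hMS, hMa, hI⟩ := h
  exact ⟨M, hM, fun ν hν => hMS ν (hS hν), hMa, hI⟩

/-! ## Coordinates on the de Sitter space -/

/-- The quadratic form `v ↦ (v₁ ∧ v) (v₂ ∧ v)` of a point `p = (v₁, v₂)` of the de Sitter space. -/
noncomputable def pointForm (p : ℝ × ℝ × ℝ) (v : ℝ × ℝ) : ℝ :=
  p.1 * (v.1 * v.2) + p.2.1 / 2 * (v.2 ^ 2 - v.1 ^ 2) + p.2.2 / 2 * (v.1 ^ 2 + v.2 ^ 2)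

theorem represents_rep (p : deSitter) : Represents (rep p) p := (exists_represents p).choose_spec

theorem wedge_lineP_lineWP (g : SL(2, ℝ)) : wedge (lineP g) (lineWP g) = 1 := by
  have dg : g 0 0 * g 1 1 - g 0 1 * g 1 0 = 1 := by rw [← Matrix.det_fin_two]; exact g.2
  simp only [wedge, lineP, lineWP]
  linarith

/-- The two columns of `g` enter only through products of an entry of one with an entry of the
other, and these are determined by `Ad(g) E` and the determinant. The choice of `rep` thus drops out
of the kernel. -/
theorem wedge_mul_wedge_eq_pointForm {g : SL(2, ℝ)} {p : deSitter} (h : Represents g p)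
    (v : ℝ × ℝ) : wedge (lineP g) v * wedge (lineWP g) v = pointForm p v := by
  obtain ⟨h1, h2, h3⟩ := (represents_iff _ _).1 h
  simp only [wedge, lineP, lineWP, pointForm]
  linear_combination (-v.1 * v.2) * h1 - v.2 ^ 2 / 2 * h2 + v.1 ^ 2 / 2 * h3

theorem pulledKernel_eq (ε : ℤˣ) (μ : ℂ) (p : deSitter) (v : ℝ × ℝ) :
    pulledKernel ε μ p v = signedPow ε μ (pointForm p v) := by
  rw [pulledKernel, kernelK, wedge_lineP_lineWP, div_one,
    wedge_mul_wedge_eq_pointForm (represents_rep p)]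

/-- The value of `pointForm` at `(cosh t cos φ, cosh t sin φ, sinh t)` and `(0, 1)`. -/
noncomputable def kap (t φ : ℝ) : ℝ := (Real.sinh t + Real.cosh t * Real.sin φ) / 2

theorem pointForm_smul (p : ℝ × ℝ × ℝ) (r : ℝ) (v : ℝ × ℝ) :
    pointForm p (r • v) = r ^ 2 * pointForm p v := by
  simp only [pointForm, Prod.smul_fst, Prod.smul_snd, smul_eq_mul]
  ring

/-- The unit vector with Bruhat coordinate `tan α`. -/
noncomputable def unitVec (α : ℝ) : ℝ × ℝ := (Real.sin α, Real.cos α)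

theorem unitVec_ne_zero (α : ℝ) : unitVec α ≠ 0 := by
  intro h
  have h1 : Real.sin α = 0 := congrArg Prod.fst h
  have h2 : Real.cos α = 0 := congrArg Prod.snd h
  have := Real.sin_sq_add_cos_sq α
  rw [h1, h2] at this
  norm_num at this

/-- Rotating the line by `α` rotates the de Sitter space by the double angle, so the kernel depends
on `θ` and `α` only through `θ + 2 * α`. -/
theorem pointForm_deSitterParam (s : ℝ × ℝ) (α : ℝ) :
    pointForm (deSitterParam s : ℝ × ℝ × ℝ) (unitVec α) = kap s.1 (s.2 + 2 * α) := by
  simp only [pointForm, unitVec, kap, deSitterParam]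
  rw [Real.sin_add, Real.sin_two_mul, Real.cos_two_mul, add_comm (Real.sin α ^ 2),
    Real.cos_sq_add_sin_sq, Real.sin_sq]
  ring

/-- The coordinates `(t, θ)` of a point of the de Sitter space. -/
noncomputable def deSitterCoord (p : deSitter) : ℝ × ℝ :=
  (Real.arsinh p.1.2.2, Complex.arg (p.1.1 + p.1.2.1 * Complex.I))

theorem deSitterParam_deSitterCoord (p : deSitter) : deSitterParam (deSitterCoord p) = p := by
  obtain ⟨⟨x, y, z⟩, hp⟩ := p
  have hp' : x ^ 2 + y ^ 2 - z ^ 2 = 1 := hp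
  have hn : Real.cosh (Real.arsinh z) = ‖(x + y * Complex.I : ℂ)‖ := by
    rw [Real.cosh_arsinh, Complex.norm_add_mul_I]
    congr 1
    linarith
  apply Subtype.ext
  simp only [deSitterParam, deSitterCoord]
  rw [hn, Complex.norm_mul_cos_arg, Complex.norm_mul_sin_arg, Real.sinh_arsinh]
  simp

theorem deSitterCoord_deSitterParam {s : ℝ × ℝ} (hs : s.2 ∈ Set.Ioc (-Real.pi) Real.pi) :
    deSitterCoord (deSitterParam s) = s := by
  obtain ⟨t, θ⟩ := s
  simp only [deSitterParam, deSitterCoord, Real.arsinh_sinh, Prod.mk.injEq, true_and]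
  refine Eq.trans ?_ (Complex.arg_mul_cos_add_sin_mul_I (Real.cosh_pos t) hs)
  congr 1
  push_cast
  ring

theorem measurable_deSitterParam : Measurable deSitterParam := by
  refine Measurable.subtype_mk ?_
  have : Continuous fun s : ℝ × ℝ => ((Real.cosh s.1 * Real.cos s.2, Real.cosh s.1 * Real.sin s.2,
    Real.sinh s.1) : ℝ × ℝ × ℝ) := by fun_prop
  exact this.measurable

theorem measurable_deSitterCoord : Measurable deSitterCoord := by
  refine Measurable.prodMk ?_ ?_
  · exact Real.continuous_arsinh.measurable.comp
      (measurable_snd.comp (measurable_snd.comp measurable_subtype_coe))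
  · refine Complex.measurable_arg.comp ?_
    have : Continuous fun p : deSitter => ((p.1.1 : ℂ) + p.1.2.1 * Complex.I) := by fun_prop
    exact this.measurable

/-- The coordinate domain of the de Sitter space with the Lebesgue measure. -/
noncomputable def chartMeasure : Measure (ℝ × ℝ) :=
  (volume : Measure (ℝ × ℝ)).restrict (Set.univ ×ˢ Set.Ioc (-Real.pi) Real.pi)

theorem chartMeasure_eq_prod : chartMeasure =
    (volume : Measure ℝ).prod (volume.restrict (Set.Ioc (-Real.pi) Real.pi)) := by
  rw [chartMeasure, Measure.volume_eq_prod, ← Measure.prod_restrict, Measure.restrict_univ]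

theorem ae_chartMeasure : ∀ᵐ s ∂chartMeasure, s.2 ∈ Set.Ioc (-Real.pi) Real.pi := by
  filter_upwards [ae_restrict_mem (MeasurableSet.univ.prod measurableSet_Ioc)] with s hs
  exact hs.2

theorem deSitterMeasure_eq : deSitterMeasure =
    (chartMeasure.withDensity fun s => ENNReal.ofReal (Real.cosh s.1)).map deSitterParam := rfl

theorem measurable_coshDensity :
    Measurable fun s : ℝ × ℝ => ENNReal.ofReal (Real.cosh s.1) := by
  have : Continuous fun s : ℝ × ℝ => Real.cosh s.1 := by fun_prop
  exact this.measurable.ennreal_ofReal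

/-- `deSitterCoord` is a measurable inverse of `deSitterParam` off a null set, so measurability can
be pulled back as well as pushed forward. -/
theorem aestronglyMeasurable_deSitter_iff {G : deSitter → ℂ} :
    AEStronglyMeasurable G deSitterMeasure ↔ AEStronglyMeasurable (fun s => G (deSitterParam s))
      (chartMeasure.withDensity fun s => ENNReal.ofReal (Real.cosh s.1)) := by
  rw [deSitterMeasure_eq]
  refine ⟨fun h => h.comp_measurable measurable_deSitterParam, fun h => ?_⟩
  have hm : ((chartMeasure.withDensity fun s => ENNReal.ofReal (Real.cosh s.1)).map
      deSitterParam).map deSitterCoord =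
      chartMeasure.withDensity fun s => ENNReal.ofReal (Real.cosh s.1) := by
    rw [Measure.map_map measurable_deSitterCoord measurable_deSitterParam]
    conv_rhs => rw [← Measure.map_id (μ := chartMeasure.withDensity _)]
    refine Measure.map_congr ?_
    filter_upwards [(withDensity_absolutelyContinuous _ _).ae_le ae_chartMeasure] with s hs
    exact deSitterCoord_deSitterParam hs
  have h2 : G = (fun s => G (deSitterParam s)) ∘ deSitterCoord := by
    funext p
    rw [Function.comp_apply, deSitterParam_deSitterCoord]
  rw [h2]
  refine AEStronglyMeasurable.comp_measurable ?_ measurable_deSitterCoord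
  rw [hm]
  exact h

theorem integrable_deSitter_iff {G : deSitter → ℂ} : Integrable G deSitterMeasure ↔
    Integrable (fun s => ((Real.cosh s.1 : ℝ) : ℂ) * G (deSitterParam s)) chartMeasure := by
  have h1 : Integrable G deSitterMeasure ↔ Integrable (fun s => G (deSitterParam s))
      (chartMeasure.withDensity fun s => ENNReal.ofReal (Real.cosh s.1)) := by
    refine ⟨fun h => ?_, fun h => ?_⟩
    · exact (integrable_map_measure h.1 measurable_deSitterParam.aemeasurable).1 h
    · exact (integrable_map_measure (aestronglyMeasurable_deSitter_iff.2 h.1)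
        measurable_deSitterParam.aemeasurable).2 h
  rw [h1, integrable_withDensity_iff_integrable_smul' measurable_coshDensity
    (Eventually.of_forall fun _ => ENNReal.ofReal_lt_top)]
  simp only [ENNReal.toReal_ofReal (Real.cosh_pos _).le, Complex.real_smul]

theorem integral_deSitter (G : deSitter → ℂ) : ∫ p, G p ∂deSitterMeasure =
    ∫ s, ((Real.cosh s.1 : ℝ) : ℂ) * G (deSitterParam s) ∂chartMeasure := by
  by_cases h : Integrable G deSitterMeasure
  · have h1 := h.1
    rw [deSitterMeasure_eq] at h1 ⊢
    rw [integral_map measurable_deSitterParam.aemeasurable h1,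
      integral_withDensity_eq_integral_toReal_smul measurable_coshDensity
      (Eventually.of_forall fun _ => ENNReal.ofReal_lt_top)]
    simp only [ENNReal.toReal_ofReal (Real.cosh_pos _).le, Complex.real_smul]
  -- Without integrability both integrals take the default value `0`.
  · rw [integral_undef h, integral_undef (fun h' => h (integrable_deSitter_iff.2 h'))]

/-! ## Explicit representatives -/

/-- The line `g P` of the point with coordinates `(t, θ)`. -/
noncomputable def paramLineP (s : ℝ × ℝ) : ℝ × ℝ :=
  (-(Real.cos (s.2 / 2) * Real.sinh (s.1 / 2)) - Real.sin (s.2 / 2) * Real.cosh (s.1 / 2),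
    -(Real.sin (s.2 / 2) * Real.sinh (s.1 / 2)) + Real.cos (s.2 / 2) * Real.cosh (s.1 / 2))

/-- The line `g w P` of the point with coordinates `(t, θ)`. -/
noncomputable def paramLineWP (s : ℝ × ℝ) : ℝ × ℝ :=
  (-(Real.cos (s.2 / 2) * Real.cosh (s.1 / 2) + Real.sin (s.2 / 2) * Real.sinh (s.1 / 2)),
    -(Real.sin (s.2 / 2) * Real.cosh (s.1 / 2) - Real.cos (s.2 / 2) * Real.sinh (s.1 / 2)))

/-- The representative is the rotation by `θ / 2` times the hyperbolic element with diagonal entries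
`cosh (t / 2)` and off-diagonal entries `-sinh (t / 2)`. -/
theorem exists_represents_param (s : ℝ × ℝ) : ∃ g : SL(2, ℝ),
    Represents g (deSitterParam s) ∧ lineP g = paramLineP s ∧ lineWP g = paramLineWP s := by
  obtain ⟨t, θ⟩ := s
  have hc := Real.sin_sq_add_cos_sq (θ / 2)
  have hh := Real.cosh_sq (t / 2)
  have e1 : Real.cosh t = Real.cosh (t / 2) ^ 2 + Real.sinh (t / 2) ^ 2 := by
    rw [← Real.cosh_two_mul]; ring_nf
  have e2 : Real.sinh t = 2 * Real.sinh (t / 2) * Real.cosh (t / 2) := by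
    rw [← Real.sinh_two_mul]; ring_nf
  have e3 : Real.cos θ = Real.cos (θ / 2) ^ 2 - Real.sin (θ / 2) ^ 2 := by
    rw [← Real.cos_two_mul']; ring_nf
  have e4 : Real.sin θ = 2 * Real.sin (θ / 2) * Real.cos (θ / 2) := by
    rw [← Real.sin_two_mul]; ring_nf
  have hdet : (Real.cos (θ / 2) * Real.cosh (t / 2) + Real.sin (θ / 2) * Real.sinh (t / 2)) *
      (-(Real.sin (θ / 2) * Real.sinh (t / 2)) + Real.cos (θ / 2) * Real.cosh (t / 2)) -
      (-(Real.cos (θ / 2) * Real.sinh (t / 2)) - Real.sin (θ / 2) * Real.cosh (t / 2)) *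
      (Real.sin (θ / 2) * Real.cosh (t / 2) - Real.cos (θ / 2) * Real.sinh (t / 2)) = 1 := by
    generalize Real.cos (θ / 2) = c at *
    generalize Real.sin (θ / 2) = d at *
    generalize Real.cosh (t / 2) = a at *
    generalize Real.sinh (t / 2) = b at *
    linear_combination (a ^ 2 - b ^ 2) * hc + hh
  obtain ⟨g, h1, h2, h3, h4⟩ := exists_entries _ _ _ _ hdet
  refine ⟨g, (represents_iff _ _).2 ?_, ?_, ?_⟩
  · rw [h1, h2, h3, h4]
    simp only [deSitterParam]
    rw [e1, e2, e3, e4]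
    generalize Real.cos (θ / 2) = c at *
    generalize Real.sin (θ / 2) = d at *
    generalize Real.cosh (t / 2) = a at *
    generalize Real.sinh (t / 2) = b at *
    refine ⟨by ring, ?_, ?_⟩
    · linear_combination (-2 * b * a) * hc
    · linear_combination (2 * b * a) * hc
  · simp only [lineP, paramLineP, h2, h4]
  · simp only [lineWP, paramLineWP, h1, h3]

theorem pullback_eq_of_represents {Ψ : ℝ × ℝ → ℝ × ℝ → ℂ}
    (hΨ : ∀ (t : ℝ) (v w : ℝ × ℝ), t ≠ 0 → v ≠ 0 → w ≠ 0 → Ψ (t⁻¹ • v) (t • w) = Ψ v w)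
    {g : SL(2, ℝ)} {p : deSitter} (h : Represents g p) :
    pullback Ψ p = Ψ (lineP g) (lineWP g) := by
  obtain ⟨t, ht, h1, h2⟩ := represents_unique h (represents_rep p)
  have hw := wedge_lineP_lineWP g
  rw [pullback, h1, h2, hΨ t _ _ ht]
  · intro h0; rw [h0] at hw; simp [wedge] at hw
  · intro h0; rw [h0] at hw; simp [wedge] at hw

theorem IsBiSection.smul_inv {f : ℝ × ℝ → ℝ × ℝ → ℂ} (hf : IsBiSection f) (t : ℝ) (v w : ℝ × ℝ)
    (ht : t ≠ 0) (hv : v ≠ 0) (hw : w ≠ 0) : f (t⁻¹ • v) (t • w) = f v w := by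
  rw [hf.homogeneous _ _ _ _ (inv_ne_zero ht) ht hv hw]
  have : (t : ℂ) ≠ 0 := by exact_mod_cast ht
  push_cast
  field_simp

theorem IsBiSection.pullback_deSitterParam {f : ℝ × ℝ → ℝ × ℝ → ℂ} (hf : IsBiSection f)
    (s : ℝ × ℝ) : pullback f (deSitterParam s) = f (paramLineP s) (paramLineWP s) := by
  obtain ⟨g, hg, h1, h2⟩ := exists_represents_param s
  rw [pullback_eq_of_represents hf.smul_inv hg, h1, h2]

/-! ## Integrability of powers of the kernel -/

/-- The larger of `a` and `b` is at least `s / 2`. The fraction `τ` of its power is bounded by `s /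
2`, and the rest by the power of the smaller one. The parameter `τ` balances the singularity in `a`,
`b` against the growth in `s`. -/
theorem mul_rpow_le_of_add_ge {a b s σ τ : ℝ} (ha : 0 ≤ a) (hb : 0 ≤ b) (hs : 0 < s)
    (hab : s ≤ a + b) (hσ : σ < 0) (hτ : 0 ≤ τ) (hτ1 : τ ≤ 1) :
    (a * b) ^ σ ≤ (s / 2) ^ (σ * τ) * (a ^ (σ * (2 - τ)) + b ^ (σ * (2 - τ))) := by
  wlog h : a ≤ b generalizing a b
  · rw [mul_comm a, add_comm (a ^ _)]
    exact this hb ha (by linarith) (le_of_not_ge h)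
  -- At `a = 0` the real power `0 ^ σ` is `0` since `σ ≠ 0`, so the singular point causes no
  -- trouble.
  rcases ha.eq_or_lt with rfl | ha
  · rw [zero_mul, Real.zero_rpow hσ.ne]
    positivity
  have hb0 : 0 < b := lt_of_lt_of_le ha h
  have h1 : b ^ (σ * τ) ≤ (s / 2) ^ (σ * τ) :=
    Real.rpow_le_rpow_of_nonpos (by positivity) (by linarith)
      (mul_nonpos_of_nonpos_of_nonneg hσ.le hτ)
  have h2 : b ^ (σ * (1 - τ)) ≤ a ^ (σ * (1 - τ)) :=
    Real.rpow_le_rpow_of_nonpos ha h (mul_nonpos_of_nonpos_of_nonneg hσ.le (by linarith))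
  calc (a * b) ^ σ = a ^ σ * (b ^ (σ * τ) * b ^ (σ * (1 - τ))) := by
        rw [Real.mul_rpow ha.le hb, ← Real.rpow_add hb0]; ring_nf
    _ ≤ a ^ σ * ((s / 2) ^ (σ * τ) * a ^ (σ * (1 - τ))) := by gcongr
    _ = (s / 2) ^ (σ * τ) * a ^ (σ * (2 - τ)) := by
        rw [mul_left_comm, ← Real.rpow_add ha]; ring_nf
    _ ≤ _ := by
        refine mul_le_mul_of_nonneg_left (le_add_of_nonneg_right (by positivity)) (by positivity)

/-- With `tanh t = sin β`, `kap` is a multiple of the sum of the sines of `φ` and `β`, which factors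
into terms with simple zeros. -/
theorem kap_eq_mul (t φ : ℝ) : kap t φ = Real.cosh t *
    (Real.sin ((φ + Real.arcsin (Real.tanh t)) / 2) *
      Real.cos ((φ - Real.arcsin (Real.tanh t)) / 2)) := by
  have h1 : Real.sin (Real.arcsin (Real.tanh t)) = Real.tanh t :=
    Real.sin_arcsin (Real.neg_one_lt_tanh t).le (Real.tanh_lt_one t).le
  have h2 := Real.sin_sub_sin φ (-Real.arcsin (Real.tanh t))
  rw [Real.sin_neg, h1, sub_neg_eq_add, sub_neg_eq_add, ← sub_eq_add_neg] at h2
  have h3 : Real.cosh t * Real.tanh t = Real.sinh t := by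
    rw [Real.tanh_eq_sinh_div_cosh]
    field_simp [(Real.cosh_pos t).ne']
  have : Real.cosh t * (Real.sin φ + Real.tanh t) = Real.sinh t + Real.cosh t * Real.sin φ := by
    rw [mul_add, h3]; ring
  rw [kap, ← this, h2]
  ring

/-- Since `cos β = 1 / cosh t` is the cosine of the difference of the two arguments, the two factors
of `kap` cannot both be small. This measures how fast their zeros merge as `t` tends to infinity. -/
theorem inv_cosh_le_add (t φ : ℝ) : (Real.cosh t)⁻¹ ≤
    |Real.sin ((φ + Real.arcsin (Real.tanh t)) / 2)| +
      |Real.cos ((φ - Real.arcsin (Real.tanh t)) / 2)| := by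
  have h1 : Real.cos (Real.arcsin (Real.tanh t)) = (Real.cosh t)⁻¹ := by
    rw [Real.cos_arcsin, Real.tanh_eq_sinh_div_cosh]
    have hc := Real.cosh_pos t
    have : 1 - (Real.sinh t / Real.cosh t) ^ 2 = ((Real.cosh t)⁻¹) ^ 2 := by
      have := Real.cosh_sq t
      field_simp
      linarith
    rw [this, Real.sqrt_sq (inv_pos.2 hc).le]
  have h2 : Real.arcsin (Real.tanh t) = (φ + Real.arcsin (Real.tanh t)) / 2 -
      (φ - Real.arcsin (Real.tanh t)) / 2 := by ring
  rw [← h1]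
  nth_rewrite 1 [h2]
  rw [Real.cos_sub]
  refine (le_abs_self _).trans ((abs_add_le _ _).trans ?_)
  rw [abs_mul, abs_mul, add_comm]
  refine add_le_add ?_ ?_
  · exact mul_le_of_le_one_right (abs_nonneg _) (Real.abs_sin_le_one _)
  · exact mul_le_of_le_one_left (abs_nonneg _) (Real.abs_cos_le_one _)

theorem intervalIntegrable_abs_rpow {σ : ℝ} (h : -1 < σ) (a b : ℝ) :
    IntervalIntegrable (fun x : ℝ => |x| ^ σ) volume a b := by
  have h1 : ∀ c : ℝ, 0 ≤ c → IntervalIntegrable (fun x : ℝ => |x| ^ σ) volume 0 c := by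
    intro c hc
    refine (intervalIntegral.intervalIntegrable_rpow' h (a := 0) (b := c)).congr ?_
    intro x hx
    rw [Set.uIoc_of_le hc] at hx
    simp only [abs_of_pos hx.1]
  have h2 : ∀ c : ℝ, IntervalIntegrable (fun x : ℝ => |x| ^ σ) volume 0 c := by
    intro c
    rcases le_total 0 c with hc | hc
    · exact h1 c hc
    · have := (IntervalIntegrable.iff_comp_neg).1 (h1 (-c) (by linarith))
      simpa using this
  exact (h2 a).symm.trans (h2 b)

/-- By periodicity only the zero at the origin matters, and there Jordan's inequality compares the
sine with `|x| / π`. -/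
theorem intervalIntegrable_abs_sin_half_rpow {σ : ℝ} (h : -1 < σ) (h0 : σ < 0) (a b : ℝ) :
    IntervalIntegrable (fun x : ℝ => |Real.sin (x / 2)| ^ σ) volume a b := by
  have hp : Function.Periodic (fun x : ℝ => |Real.sin (x / 2)| ^ σ) (2 * Real.pi) := by
    intro x
    simp only
    rw [show (x + 2 * Real.pi) / 2 = x / 2 + Real.pi by ring, Real.sin_add_pi, abs_neg]
  refine hp.intervalIntegrable (t := -Real.pi) (by positivity) ?_ a b
  rw [show -Real.pi + 2 * Real.pi = Real.pi by ring]
  have hm : Measurable fun x : ℝ => |Real.sin (x / 2)| ^ σ :=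
    ((Real.continuous_sin.comp (continuous_id.div_const 2)).abs.measurable).pow_const σ
  refine ((intervalIntegrable_abs_rpow h (-Real.pi) Real.pi).const_mul
    ((1 / Real.pi) ^ σ)).mono_fun hm.aestronglyMeasurable ?_
  filter_upwards [ae_restrict_mem measurableSet_uIoc] with x hx
  rw [Set.uIoc_of_le (by linarith [Real.pi_pos])] at hx
  have hx' : |x / 2| ≤ Real.pi / 2 := by
    rw [abs_div, abs_two]
    have : |x| ≤ Real.pi := abs_le.2 ⟨hx.1.le, hx.2⟩
    linarith
  rw [Real.norm_of_nonneg (by positivity), Real.norm_of_nonneg (by positivity)]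
  rcases eq_or_ne x 0 with rfl | hne
  · simp only [zero_div, Real.sin_zero, abs_zero, Real.zero_rpow h0.ne, mul_zero, le_refl]
  have h1 := Real.mul_abs_le_abs_sin hx'
  rw [abs_div, abs_two] at h1
  rw [← Real.mul_rpow (by positivity) (abs_nonneg _)]
  refine Real.rpow_le_rpow_of_nonpos (by have := abs_pos.2 hne; positivity) ?_ h0.le
  calc 1 / Real.pi * |x| = 2 / Real.pi * (|x| / 2) := by ring
    _ ≤ _ := h1

theorem integral_abs_sin_half_shift (σ c : ℝ) :
    ∫ x in (-Real.pi)..Real.pi, |Real.sin ((x + c) / 2)| ^ σ =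
      ∫ x in (-Real.pi)..Real.pi, |Real.sin (x / 2)| ^ σ := by
  have hp : Function.Periodic (fun x : ℝ => |Real.sin (x / 2)| ^ σ) (2 * Real.pi) := by
    intro x
    simp only
    rw [show (x + 2 * Real.pi) / 2 = x / 2 + Real.pi by ring, Real.sin_add_pi, abs_neg]
  rw [intervalIntegral.integral_comp_add_right (fun x => |Real.sin (x / 2)| ^ σ) c]
  have := hp.intervalIntegral_add_eq (-Real.pi + c) (-Real.pi)
  convert this using 2 <;> ring

theorem kap_periodic (t : ℝ) : Function.Periodic (kap t) (2 * Real.pi) := by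
  intro φ
  simp only [kap, Real.sin_add_two_pi]

theorem continuous_kap : Continuous fun s : ℝ × ℝ => kap s.1 s.2 := by
  unfold kap; fun_prop

theorem measurable_abs_kap_rpow (σ : ℝ) : Measurable fun s : ℝ × ℝ => |kap s.1 s.2| ^ σ :=
  continuous_kap.abs.measurable.pow_const σ

theorem measurable_abs_kap_line (σ t : ℝ) : Measurable fun φ => |kap t φ| ^ σ := by
  have h : Continuous (kap t) := by unfold kap; fun_prop
  exact h.abs.measurable.pow_const σ

theorem abs_kap_le (t φ : ℝ) : |kap t φ| ≤ Real.cosh t := by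
  have h1 : |Real.sinh t| ≤ Real.cosh t :=
    abs_le.2 ⟨by linarith [Real.exp_pos t, Real.cosh_add_sinh t], (Real.sinh_lt_cosh t).le⟩
  have h2 : |Real.cosh t * Real.sin φ| ≤ Real.cosh t := by
    rw [abs_mul, abs_of_pos (Real.cosh_pos t)]
    exact mul_le_of_le_one_right (Real.cosh_pos t).le (Real.abs_sin_le_one φ)
  rw [kap, abs_div, abs_two, div_le_iff₀ two_pos]
  linarith [abs_add_le (Real.sinh t) (Real.cosh t * Real.sin φ)]

/-- The factorization and `mul_rpow_le_of_add_ge` with `s = 1 / cosh t` reduce the circle integral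
to that of a power of `|sin (x / 2)|`, with `cosh t` to the power `σ - σ * τ` in front. Translation
invariance makes the constant independent of `t`. -/
theorem exists_integral_abs_kap_rpow_le {σ : ℝ} (h : -1 < σ) (h0 : σ < 0) :
    ∃ C η : ℝ, 0 < η ∧ 0 ≤ C ∧ ∀ t : ℝ,
      IntervalIntegrable (fun φ => |kap t φ| ^ σ) volume (-Real.pi) Real.pi ∧
      ∫ φ in (-Real.pi)..Real.pi, |kap t φ| ^ σ ≤ C * (Real.cosh t) ^ (-η) := by
  -- Decay in `t` requires `τ < 1`, and integrability on the circle requires `-1 < σ * (2 - τ)`. For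
  -- this `τ` the latter is `0 < (σ + 1) * (σ + 2)`.
  obtain ⟨τ, hτ⟩ : ∃ τ : ℝ, τ = (1 - σ) / 2 := ⟨_, rfl⟩
  have hσ' : -1 < σ * (2 - τ) := by rw [hτ]; nlinarith
  have hσ'0 : σ * (2 - τ) < 0 := mul_neg_of_neg_of_pos h0 (by linarith)
  have hb : ∀ t φ : ℝ, |kap t φ| ^ σ ≤ ((1 / 2) ^ (σ * τ) * (Real.cosh t) ^ (σ * (1 - τ))) *
      (|Real.sin ((φ + Real.arcsin (Real.tanh t)) / 2)| ^ (σ * (2 - τ)) +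
        |Real.sin ((φ + (Real.pi - Real.arcsin (Real.tanh t))) / 2)| ^ (σ * (2 - τ))) := by
    intro t φ
    have hc := Real.cosh_pos t
    have e : Real.sin ((φ + (Real.pi - Real.arcsin (Real.tanh t))) / 2) =
        Real.cos ((φ - Real.arcsin (Real.tanh t)) / 2) := by
      rw [← Real.sin_add_pi_div_two]; ring_nf
    have := mul_rpow_le_of_add_ge (abs_nonneg _) (abs_nonneg _) (inv_pos.2 hc)
      (inv_cosh_le_add t φ) h0 (τ := τ) (by linarith) (by linarith)
    rw [e, kap_eq_mul, abs_mul, abs_of_pos hc, abs_mul, Real.mul_rpow hc.le (by positivity)]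
    refine (mul_le_mul_of_nonneg_left this (by positivity)).trans (le_of_eq ?_)
    rw [div_eq_mul_inv, Real.mul_rpow (by positivity) (by norm_num), Real.inv_rpow hc.le,
      ← Real.rpow_neg hc.le, one_div, ← mul_assoc, ← mul_assoc, ← Real.rpow_add hc]
    ring_nf
  have hs : ∀ c : ℝ, IntervalIntegrable (fun x : ℝ => |Real.sin ((x + c) / 2)| ^ (σ * (2 - τ)))
      volume (-Real.pi) Real.pi := by
    intro c
    have := (intervalIntegrable_abs_sin_half_rpow hσ' hσ'0 (-Real.pi + c) (Real.pi + c)).comp_add_right c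
    simpa using this
  have hpi : -Real.pi ≤ Real.pi := by linarith [Real.pi_pos]
  refine ⟨(1 / 2) ^ (σ * τ) * (2 * ∫ x in (-Real.pi)..Real.pi,
      |Real.sin (x / 2)| ^ (σ * (2 - τ))), -(σ * (1 - τ)), ?_, ?_, fun t => ?_⟩
  · have : 0 < 1 - τ := by linarith
    nlinarith
  · refine mul_nonneg (by positivity) (mul_nonneg two_pos.le ?_)
    exact intervalIntegral.integral_nonneg hpi fun x _ => by positivity
  · have hi : IntervalIntegrable (fun φ => |kap t φ| ^ σ) volume (-Real.pi) Real.pi := by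
      refine (((hs (Real.arcsin (Real.tanh t))).add
        (hs (Real.pi - Real.arcsin (Real.tanh t)))).const_mul
        ((1 / 2) ^ (σ * τ) * (Real.cosh t) ^ (σ * (1 - τ)))).mono_fun ?_ ?_
      · exact (measurable_abs_kap_line σ t).aestronglyMeasurable
      · refine Eventually.of_forall fun φ => ?_
        have hc := Real.cosh_pos t
        beta_reduce
        rw [Real.norm_of_nonneg (by positivity), Real.norm_of_nonneg (by positivity)]
        exact hb t φ
    refine ⟨hi, ?_⟩
    have hi2 := (((hs (Real.arcsin (Real.tanh t))).add
        (hs (Real.pi - Real.arcsin (Real.tanh t)))).const_mul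
        ((1 / 2 : ℝ) ^ (σ * τ) * (Real.cosh t) ^ (σ * (1 - τ))))
    refine (intervalIntegral.integral_mono_on hpi hi hi2 fun φ _ => hb t φ).trans (le_of_eq ?_)
    rw [intervalIntegral.integral_const_mul, intervalIntegral.integral_add (hs _) (hs _),
      integral_abs_sin_half_shift, integral_abs_sin_half_shift, neg_neg]
    ring

theorem intervalIntegrable_abs_kap_rpow {σ : ℝ} (h : -1 < σ) (t a b : ℝ) :
    IntervalIntegrable (fun φ => |kap t φ| ^ σ) volume a b := by
  rcases lt_or_ge σ 0 with h0 | h0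
  · obtain ⟨C, η, -, -, hC⟩ := exists_integral_abs_kap_rpow_le h h0
    have hp : Function.Periodic (fun φ => |kap t φ| ^ σ) (2 * Real.pi) := by
      intro φ
      simp only [kap_periodic t φ]
    refine hp.intervalIntegrable (t := -Real.pi) (by positivity) ?_ a b
    rw [show -Real.pi + 2 * Real.pi = Real.pi by ring]
    exact (hC t).1
  · refine Continuous.intervalIntegrable ?_ a b
    have : Continuous fun φ => |kap t φ| :=
      (continuous_kap.comp (continuous_const.prodMk continuous_id)).abs
    exact this.rpow_const fun x => Or.inr h0

theorem integrable_cosh_rpow_neg {η : ℝ} (hη : 0 < η) :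
    Integrable (fun t : ℝ => (Real.cosh t) ^ (-η)) := by
  have hm : AEStronglyMeasurable (fun t : ℝ => (Real.cosh t) ^ (-η)) volume :=
    (Real.continuous_cosh.measurable.pow_const _).aestronglyMeasurable
  refine Integrable.mono' (g := fun t => (1 / 2 : ℝ) ^ (-η) * Real.exp (-η * |t|)) ?_ hm ?_
  · refine Integrable.const_mul ?_ _
    rw [← integrableOn_univ, ← Set.Iic_union_Ioi (a := (0 : ℝ)), integrableOn_union]
    constructor
    · refine (integrableOn_exp_mul_Iic hη 0).congr_fun (fun x hx => ?_) measurableSet_Iic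
      rw [abs_of_nonpos hx, neg_mul_neg]
    · refine (integrableOn_exp_mul_Ioi (neg_neg_of_pos hη) 0).congr_fun (fun x hx => ?_)
        measurableSet_Ioi
      rw [abs_of_pos hx]
  · refine Eventually.of_forall fun t => ?_
    have hc := Real.cosh_pos t
    rw [Real.norm_of_nonneg (by positivity)]
    have h1 : 1 / 2 * Real.exp |t| ≤ Real.cosh t := by
      rw [← Real.cosh_abs, Real.cosh_eq]
      linarith [Real.exp_pos (-|t|)]
    refine (Real.rpow_le_rpow_of_nonpos (by positivity) h1 (by linarith)).trans (le_of_eq ?_)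
    rw [Real.mul_rpow (by norm_num) (Real.exp_pos _).le, ← Real.exp_mul]
    ring_nf

/-- The circle integrals decay like a negative power of `cosh t`, so no cutoff in `t` is needed.
This carries the case of sections without compact support. -/
theorem integrable_abs_kap_rpow {σ : ℝ} (h : -1 < σ) (h0 : σ < 0) :
    Integrable (fun s : ℝ × ℝ => |kap s.1 s.2| ^ σ) chartMeasure := by
  obtain ⟨C, η, hη, hC0, hC⟩ := exists_integral_abs_kap_rpow_le h h0
  have hpi : -Real.pi ≤ Real.pi := by linarith [Real.pi_pos]
  rw [chartMeasure_eq_prod, integrable_prod_iff (measurable_abs_kap_rpow σ).aestronglyMeasurable]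
  refine ⟨Eventually.of_forall fun t =>
    (intervalIntegrable_iff_integrableOn_Ioc_of_le hpi).1 (hC t).1, ?_⟩
  refine ((integrable_cosh_rpow_neg hη).const_mul C).mono'
    ((measurable_abs_kap_rpow σ).norm.stronglyMeasurable.integral_prod_right'
      ).aestronglyMeasurable (Eventually.of_forall fun t => ?_)
  rw [Real.norm_of_nonneg (integral_nonneg fun _ => norm_nonneg _)]
  refine le_trans (le_of_eq ?_) (hC t).2
  rw [intervalIntegral.integral_of_le hpi]
  refine integral_congr_ae (Eventually.of_forall fun φ => ?_)
  exact Real.norm_of_nonneg (by positivity)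

/-- The part `|t| ≤ T` of the coordinate domain. -/
noncomputable def boxMeasure (T : ℝ) : Measure (ℝ × ℝ) :=
  (volume.restrict (Set.Icc (-T) T)).prod (volume.restrict (Set.Ioc (-Real.pi) Real.pi))

instance (T : ℝ) : IsFiniteMeasure (boxMeasure T) := by rw [boxMeasure]; infer_instance

theorem boxMeasure_eq_restrict (T : ℝ) :
    boxMeasure T = chartMeasure.restrict (Set.Icc (-T) T ×ˢ Set.univ) := by
  rw [boxMeasure, chartMeasure_eq_prod, ← Measure.prod_restrict, Measure.restrict_univ]

theorem ae_boxMeasure (T : ℝ) : ∀ᵐ s ∂boxMeasure T, |s.1| ≤ T := by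
  rw [boxMeasure_eq_restrict]
  filter_upwards [ae_restrict_mem (measurableSet_Icc.prod MeasurableSet.univ)] with s hs
  exact abs_le.2 hs.1

theorem integrable_abs_kap_rpow_box {σ : ℝ} (h : -1 < σ) (T : ℝ) :
    Integrable (fun s : ℝ × ℝ => |kap s.1 s.2| ^ σ) (boxMeasure T) := by
  rcases lt_or_ge σ 0 with h0 | h0
  · rw [boxMeasure_eq_restrict]
    exact (integrable_abs_kap_rpow h h0).restrict
  · refine Integrable.of_bound (measurable_abs_kap_rpow σ).aestronglyMeasurable
      ((Real.cosh T) ^ σ) ?_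
    filter_upwards [ae_boxMeasure T] with s hs
    rw [Real.norm_of_nonneg (by positivity)]
    refine Real.rpow_le_rpow (abs_nonneg _) ((abs_kap_le _ _).trans ?_) h0
    exact Real.cosh_le_cosh.2 (hs.trans (le_abs_self T))

/-- The circle `G/P` in the coordinate `α` with `ζ = tan α`. -/
noncomputable def circleMeasure : Measure ℝ :=
  volume.restrict (Set.Ioc (-(Real.pi / 2)) (Real.pi / 2))

instance : IsFiniteMeasure circleMeasure := by rw [circleMeasure]; infer_instance

theorem integrable_abs_kap_rpow_circle {σ : ℝ} (h : -1 < σ) (t θ : ℝ) :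
    Integrable (fun α : ℝ => |kap t (θ + 2 * α)| ^ σ) circleMeasure := by
  have hpi : -(Real.pi / 2) ≤ Real.pi / 2 := by linarith [Real.pi_pos]
  rw [circleMeasure]
  refine (intervalIntegrable_iff_integrableOn_Ioc_of_le hpi).1 ?_
  have h1 := (intervalIntegrable_abs_kap_rpow h t (-Real.pi + θ) (Real.pi + θ)).comp_add_right θ
  have h2 := h1.comp_mul_left (c := 2)
  convert h2 using 1
  · funext α; rw [add_comm]
  · ring
  · ring

theorem integral_abs_kap_rpow_circle (σ t θ : ℝ) :
    ∫ α, |kap t (θ + 2 * α)| ^ σ ∂circleMeasure =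
      2⁻¹ * ∫ φ in (-Real.pi)..Real.pi, |kap t φ| ^ σ := by
  have hpi : -(Real.pi / 2) ≤ Real.pi / 2 := by linarith [Real.pi_pos]
  have hp : Function.Periodic (fun φ => |kap t φ| ^ σ) (2 * Real.pi) := by
    intro φ
    simp only [kap_periodic t φ]
  rw [circleMeasure, ← intervalIntegral.integral_of_le hpi,
    intervalIntegral.integral_comp_add_mul (fun φ => |kap t φ| ^ σ) two_ne_zero, smul_eq_mul]
  congr 1
  have := hp.intervalIntegral_add_eq (θ + 2 * -(Real.pi / 2)) (-Real.pi)
  convert this using 2 <;> ring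

/-- For negative `σ` the integral over the circle is bounded uniformly in `(t, θ)`, and the box has
finite measure. This justifies Fubini in the duality. -/
theorem integrable_abs_kap_rpow_box_prod_circle {σ : ℝ} (h : -1 < σ) (T : ℝ) :
    Integrable (fun y : (ℝ × ℝ) × ℝ => |kap y.1.1 (y.1.2 + 2 * y.2)| ^ σ)
      ((boxMeasure T).prod circleMeasure) := by
  have hc : Continuous fun y : (ℝ × ℝ) × ℝ => kap y.1.1 (y.1.2 + 2 * y.2) :=
    continuous_kap.comp (by fun_prop : Continuous fun y : (ℝ × ℝ) × ℝ =>
      ((y.1.1, y.1.2 + 2 * y.2) : ℝ × ℝ))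
  have hm : Measurable fun y : (ℝ × ℝ) × ℝ => |kap y.1.1 (y.1.2 + 2 * y.2)| ^ σ :=
    hc.abs.measurable.pow_const σ
  rcases lt_or_ge σ 0 with h0 | h0
  · obtain ⟨C, η, hη, hC0, hC⟩ := exists_integral_abs_kap_rpow_le h h0
    rw [integrable_prod_iff hm.aestronglyMeasurable]
    refine ⟨Eventually.of_forall fun s => integrable_abs_kap_rpow_circle h s.1 s.2, ?_⟩
    refine Integrable.of_bound (hm.norm.stronglyMeasurable.integral_prod_right'
      ).aestronglyMeasurable C (Eventually.of_forall fun s => ?_)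
    rw [Real.norm_of_nonneg (integral_nonneg fun _ => norm_nonneg _)]
    have e : ∫ α, ‖|kap s.1 (s.2 + 2 * α)| ^ σ‖ ∂circleMeasure =
        ∫ α, |kap s.1 (s.2 + 2 * α)| ^ σ ∂circleMeasure :=
      integral_congr_ae (Eventually.of_forall fun α => Real.norm_of_nonneg (by positivity))
    rw [e, integral_abs_kap_rpow_circle]
    have h1 : (Real.cosh s.1) ^ (-η) ≤ 1 :=
      Real.rpow_le_one_of_one_le_of_nonpos (Real.one_le_cosh _) (by linarith)
    have h2 := (hC s.1).2
    have h3 : C * (Real.cosh s.1) ^ (-η) ≤ C := mul_le_of_le_one_right hC0 h1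
    linarith
  · refine Integrable.of_bound hm.aestronglyMeasurable ((Real.cosh T) ^ σ) ?_
    filter_upwards [Measure.quasiMeasurePreserving_fst.ae (ae_boxMeasure T)] with y hs
    rw [Real.norm_of_nonneg (by positivity)]
    refine Real.rpow_le_rpow (abs_nonneg _) ((abs_kap_le _ _).trans ?_) h0
    exact Real.cosh_le_cosh.2 (hs.trans (le_abs_self T))

/-! ## Rotation of the coordinate `θ` -/

theorem integral_Ioc_shift {E : Type*} [NormedAddCommGroup E] [NormedSpace ℝ E] {F : ℝ → E}
    (hp : Function.Periodic F (2 * Real.pi)) (a : ℝ) :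
    ∫ θ in Set.Ioc (-Real.pi) Real.pi, F (θ + a) = ∫ θ in Set.Ioc (-Real.pi) Real.pi, F θ := by
  have hpi : -Real.pi ≤ Real.pi := by linarith [Real.pi_pos]
  rw [← intervalIntegral.integral_of_le hpi, ← intervalIntegral.integral_of_le hpi,
    intervalIntegral.integral_comp_add_right F a]
  have := hp.intervalIntegral_add_eq (-Real.pi + a) (-Real.pi)
  convert this using 2 <;> ring

theorem integrableOn_Ioc_shift {F : ℝ → ℂ} (hp : Function.Periodic F (2 * Real.pi)) (a : ℝ)
    (h : IntegrableOn F (Set.Ioc (-Real.pi) Real.pi)) :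
    IntegrableOn (fun θ => F (θ + a)) (Set.Ioc (-Real.pi) Real.pi) := by
  have hpi : -Real.pi ≤ Real.pi := by linarith [Real.pi_pos]
  rw [← intervalIntegrable_iff_integrableOn_Ioc_of_le hpi] at h ⊢
  have h1 : IntervalIntegrable F volume (-Real.pi + a) (Real.pi + a) := by
    refine hp.intervalIntegrable (t := -Real.pi) (by positivity) ?_ _ _
    rwa [show -Real.pi + 2 * Real.pi = Real.pi by ring]
  simpa using h1.comp_add_right a

theorem integrable_prod_shift {m : Measure ℝ} [SFinite m] {F : ℝ × ℝ → ℂ} (hm : Measurable F)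
    (hp : ∀ t, Function.Periodic (fun θ => F (t, θ)) (2 * Real.pi)) (a : ℝ)
    (h : Integrable F (m.prod (volume.restrict (Set.Ioc (-Real.pi) Real.pi)))) :
    Integrable (fun s => F (s.1, s.2 + a))
      (m.prod (volume.restrict (Set.Ioc (-Real.pi) Real.pi))) := by
  have hm' : Measurable fun s : ℝ × ℝ => F (s.1, s.2 + a) :=
    hm.comp (measurable_fst.prodMk (measurable_snd.add_const a))
  rw [integrable_prod_iff hm.aestronglyMeasurable] at h
  rw [integrable_prod_iff hm'.aestronglyMeasurable]
  refine ⟨h.1.mono fun t ht => integrableOn_Ioc_shift (hp t) a ht, ?_⟩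
  convert h.2 using 1
  funext t
  refine integral_Ioc_shift (F := fun θ => ‖F (t, θ)‖) ?_ a
  intro θ
  have := hp t θ
  simp only at this
  simp only [this]

theorem integral_prod_shift {m : Measure ℝ} [SFinite m] {F : ℝ × ℝ → ℂ} (hm : Measurable F)
    (hp : ∀ t, Function.Periodic (fun θ => F (t, θ)) (2 * Real.pi)) (a : ℝ)
    (h : Integrable F (m.prod (volume.restrict (Set.Ioc (-Real.pi) Real.pi)))) :
    ∫ s, F (s.1, s.2 + a) ∂(m.prod (volume.restrict (Set.Ioc (-Real.pi) Real.pi))) =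
      ∫ s, F s ∂(m.prod (volume.restrict (Set.Ioc (-Real.pi) Real.pi))) := by
  rw [integral_prod _ h, integral_prod _ (integrable_prod_shift hm hp a h)]
  congr 1
  funext t
  exact integral_Ioc_shift (F := fun θ => F (t, θ)) (hp t) a

/-! ## Families of integrals with a parameter -/

theorem integrable_norm_mul_rpow {X : Type*} [MeasurableSpace X] {m : Measure X} {g : X → ℂ}
    {κ : X → ℝ} {σ C : ℝ} (hg : AEStronglyMeasurable g m) (hC : ∀ᵐ x ∂m, ‖g x‖ ≤ C)
    (hκ : Integrable (fun x => |κ x| ^ σ) m) :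
    Integrable (fun x => ‖g x‖ * |κ x| ^ σ) m := by
  refine (hκ.const_mul C).mono' (hg.norm.mul hκ.1) ?_
  filter_upwards [hC] with x hx
  rw [Real.norm_of_nonneg (by positivity)]
  gcongr

section
variable {𝒢 W X : Type*} [MeasurableSpace W] [MeasurableSpace X] {n : Measure W} {m : Measure X}
  [SFinite n] [SFinite m] {c : W → ℂ} {κ : W × X → ℝ} {ev : 𝒢 → W × X → ℂ} {ε : ℤˣ}
  {A B : 𝒢 → 𝒢} {Adm : 𝒢 → Prop}

theorem integral_param_eq (hκ : Measurable κ) {g : 𝒢}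
    (hm : AEStronglyMeasurable (fun y => c y.1 * ev g y) (n.prod m)) {μ : ℂ}
    (hi : Integrable (fun y => ‖c y.1 * ev g y‖ * |κ y| ^ μ.re) (n.prod m)) :
    Integrable (fun w => c w * ∫ x, ev g (w, x) * signedPow ε μ (κ (w, x)) ∂m) n ∧
      ∫ w, c w * ∫ x, ev g (w, x) * signedPow ε μ (κ (w, x)) ∂m ∂n =
        ∫ y, c y.1 * ev g y * signedPow ε μ (κ y) ∂(n.prod m) := by
  have h := integrable_mul_signedPow hm hκ ε hi
  have e : (fun w => c w * ∫ x, ev g (w, x) * signedPow ε μ (κ (w, x)) ∂m) =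
      fun w => ∫ x, c w * ev g (w, x) * signedPow ε μ (κ (w, x)) ∂m := by
    funext w
    simp only [← integral_const_mul, mul_assoc]
  rw [e]
  exact ⟨h.integral_prod_left, (integral_prod _ h).symm⟩

/-- Holomorphy comes from the integral over the product space; the functional equation is linear in
`J` and integrates over `w`. -/
theorem ShiftFamily.integral_param (hκ : Measurable κ)
    (hA : ∀ g, Adm g → Adm (A g)) (hB : ∀ g, Adm g → Adm (B g))
    (hm : ∀ g, Adm g → AEStronglyMeasurable (fun y => c y.1 * ev g y) (n.prod m))
    (hi : ∀ g, Adm g → ∀ σ : ℝ, -1 < σ →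
      Integrable (fun y => ‖c y.1 * ev g y‖ * |κ y| ^ σ) (n.prod m))
    (J : W → 𝒢 → ℂ → ℂ)
    (hJ : ∀ w g μ, J w g μ = ∫ x, ev g (w, x) * signedPow ε μ (κ (w, x)) ∂m)
    (he : ∀ g, Adm g → ∀ μ : ℂ, -1 < μ.re → ∀ᵐ w ∂n,
      J w g μ = ((ε : ℤ) : ℂ) * ((μ + 1)⁻¹ * J w (A g) (μ + 1) + J w (B g) (μ + 1))) :
    ShiftFamily ε A B (fun g μ => ∫ w, c w * J w g μ ∂n) Adm := by
  have hJ' : J = fun w g μ => ∫ x, ev g (w, x) * signedPow ε μ (κ (w, x)) ∂m := by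
    funext w g μ; exact hJ w g μ
  have hI : ∀ g, Adm g → ∀ μ : ℂ, -1 < μ.re → Integrable (fun w => c w * J w g μ) n := by
    intro g hg μ hμ
    rw [hJ']
    exact (integral_param_eq hκ (hm g hg) (hi g hg _ hμ)).1
  refine ⟨hA, hB, fun g hg => ?_, fun g hg μ hμ => ?_⟩
  · refine (differentiableOn_integral_mul_signedPow (hm g hg) hκ ε (hi g hg)).congr ?_
    intro μ hμ
    rw [hJ']
    exact (integral_param_eq hκ (hm g hg) (hi g hg _ hμ)).2
  · have hμ1 : -1 < (μ + 1).re := by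
      simp only [Complex.add_re, Complex.one_re]; linarith
    have i1 := hI _ (hA g hg) _ hμ1
    have i2 := hI _ (hB g hg) _ hμ1
    rw [← integral_const_mul, ← integral_add (i1.const_mul _) i2, ← integral_const_mul]
    refine integral_congr_ae ?_
    filter_upwards [he g hg μ hμ] with w hw
    rw [hw]
    ring

end

/-! ## The Fourier side: integration by parts in `t` -/

/-- The derivative of `kap` in the first variable. -/
noncomputable def kapT (t φ : ℝ) : ℝ := (Real.cosh t + Real.sinh t * Real.sin φ) / 2

/-- `|sinh t| < cosh t` prevents critical points in `t`. Division by `kapT` is therefore smooth, and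
no zeroth-order term occurs on the Fourier side. -/
theorem kapT_pos (t φ : ℝ) : 0 < kapT t φ := by
  have h1 : |Real.sinh t * Real.sin φ| ≤ |Real.sinh t| := by
    rw [abs_mul]
    exact mul_le_of_le_one_right (abs_nonneg _) (Real.abs_sin_le_one φ)
  have h2 : |Real.sinh t| < Real.cosh t :=
    abs_lt.2 ⟨by linarith [Real.exp_pos t, Real.cosh_add_sinh t], Real.sinh_lt_cosh t⟩
  have := (abs_le.1 h1).1
  rw [kapT]
  linarith

theorem hasDerivAt_kap (t φ : ℝ) : HasDerivAt (fun t => kap t φ) (kapT t φ) t := by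
  unfold kap kapT
  exact ((Real.hasDerivAt_sinh t).add ((Real.hasDerivAt_cosh t).mul_const _)).div_const 2

/-- Amplitudes `g(v; t, φ)` on the Fourier side. -/
structure IsFourierAmplitude (T : ℝ) (g : (ℝ × ℝ) × ℝ × ℝ → ℂ) : Prop where
  smooth : ContDiffOn ℝ ∞ g ({v | v ≠ 0} ×ˢ Set.univ)
  support : ∀ v s : ℝ × ℝ, v ≠ 0 → T < |s.1| → g (v, s) = 0

/-- The operator `g ↦ -∂_t (g / ∂_t kap)`. -/
noncomputable def opF (g : (ℝ × ℝ) × ℝ × ℝ → ℂ) (y : (ℝ × ℝ) × ℝ × ℝ) : ℂ :=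
  -fderiv ℝ (fun y : (ℝ × ℝ) × ℝ × ℝ => (kapT y.2.1 y.2.2)⁻¹ • g y) y (0, (1, 0))

theorem isOpen_ne_zero_prod_univ :
    IsOpen (({v | v ≠ 0} : Set (ℝ × ℝ)) ×ˢ (Set.univ : Set (ℝ × ℝ))) :=
  isOpen_ne.prod isOpen_univ

namespace IsFourierAmplitude

variable {T : ℝ} {g : (ℝ × ℝ) × ℝ × ℝ → ℂ}

theorem smooth_div (hg : IsFourierAmplitude T g) :
    ContDiffOn ℝ ∞ (fun y : (ℝ × ℝ) × ℝ × ℝ => (kapT y.2.1 y.2.2)⁻¹ • g y)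
      ({v | v ≠ 0} ×ˢ Set.univ) := by
  have h : ContDiff ℝ ∞ fun y : (ℝ × ℝ) × ℝ × ℝ => kapT y.2.1 y.2.2 := by
    unfold kapT
    fun_prop
  exact (h.inv fun y => (kapT_pos _ _).ne').contDiffOn.smul hg.smooth

theorem op (hg : IsFourierAmplitude T g) : IsFourierAmplitude T (opF g) := by
  refine ⟨?_, fun v s hv hs => ?_⟩
  · have h := hg.smooth_div.fderiv_of_isOpen (m := ∞) isOpen_ne_zero_prod_univ (by simp)
    have h0 : ContDiffOn ℝ ∞ (fun _ : (ℝ × ℝ) × ℝ × ℝ => ((0, (1, 0)) : (ℝ × ℝ) × ℝ × ℝ))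
        (({v | v ≠ 0} : Set (ℝ × ℝ)) ×ˢ Set.univ) := contDiffOn_const
    exact (h.clm_apply h0).neg
  · have : (fun y : (ℝ × ℝ) × ℝ × ℝ => (kapT y.2.1 y.2.2)⁻¹ • g y) =ᶠ[𝓝 (v, s)] fun _ => 0 := by
      have ho : IsOpen {y : (ℝ × ℝ) × ℝ × ℝ | y.1 ≠ 0 ∧ T < |y.2.1|} :=
        (isOpen_ne.preimage continuous_fst).inter (isOpen_lt continuous_const
          (continuous_abs.comp (continuous_fst.comp continuous_snd)))
      filter_upwards [ho.mem_nhds ⟨hv, hs⟩] with y hy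
      rw [hg.support y.1 y.2 hy.1 hy.2, smul_zero]
    rw [opF, this.fderiv_eq]
    simp

theorem zero (T : ℝ) : IsFourierAmplitude T 0 :=
  ⟨contDiffOn_const, fun _ _ _ _ => rfl⟩

theorem hasDerivAt (hg : IsFourierAmplitude T g) {v : ℝ × ℝ} (hv : v ≠ 0) (t φ : ℝ) :
    HasDerivAt (fun t => (kapT t φ)⁻¹ • g (v, (t, φ))) (-opF g (v, (t, φ))) t := by
  have h1 : HasFDerivAt (fun y : (ℝ × ℝ) × ℝ × ℝ => (kapT y.2.1 y.2.2)⁻¹ • g y) _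
      (v, (t, φ)) :=
    ((hg.smooth_div.differentiableOn (by simp)).differentiableAt
      (isOpen_ne_zero_prod_univ.mem_nhds (show (v, ((t, φ) : ℝ × ℝ)) ∈ _ from
        ⟨hv, Set.mem_univ _⟩))).hasFDerivAt
  have h2 : HasDerivAt (fun t : ℝ => ((v, (t, φ)) : (ℝ × ℝ) × ℝ × ℝ)) (0, (1, 0)) t :=
    (hasDerivAt_const t v).prodMk ((hasDerivAt_id t).prodMk (hasDerivAt_const t φ))
  have := HasFDerivAt.comp_hasDerivAt t (f := fun t : ℝ => ((v, (t, φ)) : (ℝ × ℝ) × ℝ × ℝ)) h1 h2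
  rw [opF, neg_neg]
  exact this

theorem continuous_slice (hg : IsFourierAmplitude T g) {v : ℝ × ℝ} (hv : v ≠ 0) :
    Continuous fun s => g (v, s) :=
  hg.smooth.continuousOn.comp_continuous (by fun_prop) fun s => ⟨hv, Set.mem_univ _⟩

theorem continuous_circle (hg : IsFourierAmplitude T g) :
    Continuous fun y : ℝ × ℝ × ℝ => g (unitVec y.1, y.2) := by
  refine hg.smooth.continuousOn.comp_continuous ?_ fun s => ⟨unitVec_ne_zero _, Set.mem_univ _⟩
  unfold unitVec
  fun_prop

/-- `g * kap ^ μ` is `g / kapT` times `ε * (μ + 1)⁻¹` times the `t`-derivative of `kap ^ (μ + 1)`.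
-/
theorem integral_parts (hg : IsFourierAmplitude T g) {v : ℝ × ℝ} (hv : v ≠ 0) (ε : ℤˣ) {μ : ℂ}
    (hμ : 0 < μ.re) (φ : ℝ) :
    ∫ t in Set.Icc (-(T + 1)) (T + 1), g (v, (t, φ)) * signedPow ε μ (kap t φ) =
      ((ε : ℤ) : ℂ) * ((μ + 1)⁻¹ * ∫ t in Set.Icc (-(T + 1)) (T + 1),
        opF g (v, (t, φ)) * signedPow ε (μ + 1) (kap t φ)) := by
  rcases lt_or_ge (T + 1) 0 with hT | hT
  · rw [Set.Icc_eq_empty (by linarith)]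
    simp
  have hle : -(T + 1) ≤ T + 1 := by linarith
  have hμ1 : μ + 1 ≠ 0 := nonPole_add_one_ne (mem_nonPole_of_re (by linarith))
  have hk : Continuous fun t => kap t φ := by unfold kap; fun_prop
  have hkT : Continuous fun t => kapT t φ := by unfold kapT; fun_prop
  have hd : ∀ t : ℝ, HasDerivAt (fun t => signedPow ε (μ + 1) (kap t φ))
      (kapT t φ • (((ε : ℤ) : ℂ) * (μ + 1) * signedPow ε μ (kap t φ))) t := fun t =>
    HasDerivAt.scomp (g₁ := signedPow ε (μ + 1)) t (hasDerivAt_signedPow ε hμ (kap t φ))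
      (hasDerivAt_kap t φ)
  have hslice : Continuous fun t => opF g (v, (t, φ)) :=
    (hg.op.continuous_slice hv).comp (by fun_prop : Continuous fun t : ℝ => ((t, φ) : ℝ × ℝ))
  have key := intervalIntegral.integral_mul_deriv_eq_deriv_mul (a := -(T + 1)) (b := T + 1)
    (fun t _ => hg.hasDerivAt hv t φ) (fun t _ => hd t)
    (hslice.neg.intervalIntegrable _ _)
    (Continuous.intervalIntegrable (hkT.smul (continuous_const.mul
      ((continuous_signedPow ε hμ).comp hk))) _ _)
  -- The interval is one unit longer than the support bound on each side, so the boundary terms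
  -- vanish.
  have hlt : T < |T + 1| := by rw [abs_of_nonneg hT]; linarith
  rw [hg.support v (T + 1, φ) hv hlt, hg.support v (-(T + 1), φ) hv (by rwa [abs_neg])] at key
  simp only [smul_zero, zero_mul, sub_zero, zero_sub, neg_mul, intervalIntegral.integral_neg,
    neg_neg] at key
  rw [intervalIntegral.integral_of_le hle, intervalIntegral.integral_of_le hle,
    ← integral_Icc_eq_integral_Ioc, ← integral_Icc_eq_integral_Ioc] at key
  rw [← key, ← mul_assoc, ← integral_const_mul]
  refine integral_congr_ae (Eventually.of_forall fun t => ?_)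
  have h3 := units_int_cast_mul_self_complex ε
  have h4 : ((kapT t φ : ℝ) : ℂ) ≠ 0 := by exact_mod_cast (kapT_pos t φ).ne'
  simp only [Complex.real_smul, Complex.ofReal_inv]
  field_simp
  linear_combination (-g (v, t, φ) * signedPow ε μ (kap t φ)) * h3

end IsFourierAmplitude

/-- The integral whose continuation is the Fourier transform. -/
noncomputable def intF (ε : ℤˣ) (T : ℝ) (v : ℝ × ℝ) (g : (ℝ × ℝ) × ℝ × ℝ → ℂ) (μ : ℂ) : ℂ :=
  ∫ s, g (v, s) * signedPow ε μ (kap s.1 s.2) ∂boxMeasure (T + 1)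

theorem ae_boxMeasure_mem (T : ℝ) :
    ∀ᵐ s ∂boxMeasure T, s ∈ Set.Icc (-T) T ×ˢ Set.Icc (-Real.pi) Real.pi := by
  have : ∀ᵐ s ∂boxMeasure T, s.2 ∈ Set.Ioc (-Real.pi) Real.pi := by
    rw [boxMeasure_eq_restrict]
    exact ae_restrict_of_ae ae_chartMeasure
  filter_upwards [ae_boxMeasure T, this] with s h1 h2
  exact ⟨abs_le.1 h1, Set.Ioc_subset_Icc_self h2⟩

theorem Continuous.exists_bound_box {g : ℝ × ℝ → ℂ} (hg : Continuous g) (T : ℝ) :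
    ∃ C, ∀ᵐ s ∂boxMeasure T, ‖g s‖ ≤ C := by
  obtain ⟨C, hC⟩ := (isCompact_Icc.prod isCompact_Icc :
    IsCompact (Set.Icc (-T) T ×ˢ Set.Icc (-Real.pi) Real.pi)).exists_bound_of_continuousOn
      hg.continuousOn
  exact ⟨C, by filter_upwards [ae_boxMeasure_mem T] with s hs using hC s hs⟩

theorem ae_circleMeasure : ∀ᵐ α ∂circleMeasure, α ∈ Set.Icc (-(Real.pi / 2)) (Real.pi / 2) := by
  filter_upwards [ae_restrict_mem measurableSet_Ioc] with α hα using Set.Ioc_subset_Icc_self hα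

theorem measurable_kap : Measurable fun s : ℝ × ℝ => kap s.1 s.2 := continuous_kap.measurable

theorem IsFourierAmplitude.integrable {T : ℝ} {g : (ℝ × ℝ) × ℝ × ℝ → ℂ}
    (hg : IsFourierAmplitude T g) {v : ℝ × ℝ} (hv : v ≠ 0) {σ : ℝ} (hσ : -1 < σ) :
    Integrable (fun s => ‖g (v, s)‖ * |kap s.1 s.2| ^ σ) (boxMeasure (T + 1)) := by
  obtain ⟨C, hC⟩ := (hg.continuous_slice hv).exists_bound_box (T + 1)
  exact integrable_norm_mul_rpow (hg.continuous_slice hv).aestronglyMeasurable hC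
    (integrable_abs_kap_rpow_box hσ _)

theorem shiftFamily_intF (ε : ℤˣ) (T : ℝ) {v : ℝ × ℝ} (hv : v ≠ 0) :
    ShiftFamily ε opF (fun _ => 0) (intF ε T v) (IsFourierAmplitude T) := by
  refine ShiftFamily.of_eqn_re_pos (fun g hg => hg.op) (fun g _ => IsFourierAmplitude.zero T)
    (fun g hg => differentiableOn_integral_mul_signedPow
      (hg.continuous_slice hv).aestronglyMeasurable measurable_kap ε
      fun σ hσ => hg.integrable hv hσ) (fun g hg μ hμ => ?_)
  have hμ1 : -1 < (μ + 1).re := by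
      simp only [Complex.add_re, Complex.one_re]; linarith
  have i1 := integrable_mul_signedPow (hg.continuous_slice hv).aestronglyMeasurable measurable_kap ε
    (hg.integrable hv (by linarith : -1 < μ.re))
  have i2 := integrable_mul_signedPow (hg.op.continuous_slice hv).aestronglyMeasurable
    measurable_kap ε (hg.op.integrable hv hμ1)
  simp only [intF, Pi.zero_apply, zero_mul, integral_zero, add_zero]
  rw [boxMeasure] at i1 i2 ⊢
  rw [integral_prod_symm _ i1, integral_prod_symm _ i2, ← integral_const_mul, ← integral_const_mul]
  exact integral_congr_ae (Eventually.of_forall fun φ => hg.integral_parts hv ε hμ φ)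

/-- The kernel does not depend on `v`. The integral is the value at `0` of the convolution of a
fixed integrable function, the kernel cut off to the box, with a smooth family of compactly
supported functions, so all derivatives in `v` fall on the family. -/
theorem contDiffOn_intF (ε : ℤˣ) {T : ℝ} {g : (ℝ × ℝ) × ℝ × ℝ → ℂ} (hg : IsFourierAmplitude T g)
    {μ : ℂ} (hμ : -1 < μ.re) : ContDiffOn ℝ ∞ (fun v => intF ε T v g μ) {v | v ≠ 0} := by
  obtain ⟨R, hR0, hR1, hR2⟩ : ∃ R : ℝ, 0 < R ∧ T + 1 ≤ R ∧ Real.pi ≤ R :=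
    ⟨max (T + 1) Real.pi, lt_of_lt_of_le Real.pi_pos (le_max_right _ _), le_max_left _ _,
      le_max_right _ _⟩
  -- The bump provides the compact support and equals `1` on the box, which lies in the ball of
  -- radius `R` for the maximum norm.
  let b : ContDiffBump (0 : ℝ × ℝ) := ⟨R, R + 1, hR0, by linarith⟩
  let S : Set (ℝ × ℝ) := Set.Icc (-(T + 1)) (T + 1) ×ˢ Set.Ioc (-Real.pi) Real.pi
  have hS : MeasurableSet S := measurableSet_Icc.prod measurableSet_Ioc
  have hbox : boxMeasure (T + 1) = (volume : Measure (ℝ × ℝ)).restrict S := by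
    rw [boxMeasure, Measure.prod_restrict, Measure.volume_eq_prod]
  let f : ℝ × ℝ → ℂ := S.indicator fun s => signedPow ε μ (kap s.1 s.2)
  have hf : Integrable f := by
    rw [integrable_indicator_iff hS, IntegrableOn, ← hbox]
    have := integrable_mul_signedPow (g := fun _ => (1 : ℂ)) (m := boxMeasure (T + 1))
      aestronglyMeasurable_const measurable_kap ε (μ := μ)
      (by simpa using integrable_abs_kap_rpow_box hμ (T + 1))
    simpa using this
  let G : ℝ × ℝ → ℝ × ℝ → ℂ := fun v x => b x • g (v, -x)
  have hG : ContDiffOn ℝ ∞ (Function.uncurry G) ({v | v ≠ 0} ×ˢ Set.univ) := by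
    refine ContDiffOn.smul (b.contDiff.comp contDiff_snd).contDiffOn ?_
    refine hg.smooth.comp (t := {v | v ≠ 0} ×ˢ Set.univ)
      (f := fun y : (ℝ × ℝ) × ℝ × ℝ => (y.1, -y.2)) ?_ ?_
    · exact (contDiff_fst.prodMk contDiff_snd.neg).contDiffOn
    · intro y hy
      exact ⟨hy.1, Set.mem_univ _⟩
  have key := contDiffOn_convolution_right_with_param (𝕜 := ℝ) (n := (⊤ : ℕ∞))
    (ContinuousLinearMap.mul ℝ ℂ)
    (f := f) (g := G) (s := {v | v ≠ 0}) (k := Metric.closedBall 0 (R + 1)) (μ := volume)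
    isOpen_ne (isCompact_closedBall _ _)
    (fun v x _ hx => by
      have : b x = 0 := b.zero_of_le_dist (by
        rw [Metric.mem_closedBall, not_le] at hx; exact hx.le)
      simp only [G, this, zero_smul]) hf.locallyIntegrable hG
  have h2 : ContDiffOn ℝ ∞ (fun v : ℝ × ℝ => (v, (0 : ℝ × ℝ))) {v | v ≠ 0} :=
    (contDiff_id.prodMk contDiff_const).contDiffOn
  refine (key.comp h2 fun v hv => ⟨hv, Set.mem_univ _⟩).congr ?_
  intro v hv
  simp only [Function.comp_apply, convolution, ContinuousLinearMap.mul_apply', zero_sub]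
  rw [intF, hbox, ← integral_indicator hS]
  refine integral_congr_ae (Eventually.of_forall fun s => ?_)
  by_cases hs : s ∈ S
  · have hb : b (-s) = 1 := by
      refine b.one_of_mem_closedBall ?_
      rw [mem_closedBall_zero_iff, norm_neg, Prod.norm_def]
      refine max_le ?_ ?_
      · exact (abs_le.2 ⟨by linarith [hs.1.1], by linarith [hs.1.2]⟩)
      · exact (abs_le.2 ⟨by linarith [hs.2.1], by linarith [hs.2.2]⟩)
    simp only [f, G, Set.indicator_of_mem hs, hb, neg_neg, one_smul]
    ring
  · simp only [f, Set.indicator_of_notMem hs, zero_mul]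

theorem contDiffOn_shiftedIterate_intF (ε : ℤˣ) {T : ℝ} (k : ℕ) :
    ∀ g : (ℝ × ℝ) × ℝ × ℝ → ℂ, IsFourierAmplitude T g → ∀ μ : ℂ, -1 - (k : ℝ) < μ.re →
      ContDiffOn ℝ ∞ (fun v => shiftedIterate ε opF (fun _ => 0) (intF ε T v) k g μ)
        {v | v ≠ 0} := by
  induction k with
  | zero =>
    intro g hg μ hμ
    exact contDiffOn_intF ε hg (by simpa using hμ)
  | succ k ih =>
    intro g hg μ hμ
    have h : -1 - (k : ℝ) < (μ + 1).re := by
      push_cast at hμ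
      simp only [Complex.add_re, Complex.one_re]
      linarith
    exact contDiffOn_const.mul ((contDiffOn_const.mul (ih _ hg.op _ h)).add
      (ih _ (IsFourierAmplitude.zero T) _ h))

theorem contDiffOn_continuation_intF (ε : ℤˣ) {T : ℝ} {g : (ℝ × ℝ) × ℝ × ℝ → ℂ}
    (hg : IsFourierAmplitude T g) (μ : ℂ) :
    ContDiffOn ℝ ∞ (fun v => continuation ε opF (fun _ => 0) (intF ε T v) g μ) {v | v ≠ 0} := by
  refine contDiffOn_shiftedIterate_intF ε _ g hg μ ?_
  have := Nat.le_ceil (-μ.re)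
  linarith

/-! ## The Fourier transform as a section -/

theorem exists_eq_smul_unitVec {v : ℝ × ℝ} (hv : v ≠ 0) : ∃ r α : ℝ, 0 < r ∧
    α ∈ Set.Ioc (-Real.pi) Real.pi ∧ v = r • unitVec α := by
  obtain ⟨a, b⟩ := v
  have hz : (b + a * Complex.I : ℂ) ≠ 0 := by
    intro h
    apply hv
    have h1 := congrArg Complex.re h
    have h2 := congrArg Complex.im h
    simp at h1 h2
    rw [h1, h2]
    rfl
  refine ⟨‖(b + a * Complex.I : ℂ)‖, Complex.arg (b + a * Complex.I), norm_pos_iff.2 hz,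
    Complex.arg_mem_Ioc _, ?_⟩
  simp only [unitVec, Prod.smul_mk, smul_eq_mul, Complex.norm_mul_cos_arg,
    Complex.norm_mul_sin_arg]
  simp

/-- `|v|²`. -/
noncomputable def normSq (v : ℝ × ℝ) : ℝ := v.1 ^ 2 + v.2 ^ 2

theorem normSq_pos {v : ℝ × ℝ} (hv : v ≠ 0) : 0 < normSq v := by
  rcases eq_or_ne v.1 0 with h1 | h1
  · have h2 : v.2 ≠ 0 := fun h2 => hv (Prod.ext h1 h2)
    unfold normSq; positivity
  · unfold normSq; positivity

theorem normSq_smul (r : ℝ) (v : ℝ × ℝ) : normSq (r • v) = r ^ 2 * normSq v := by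
  simp only [normSq, Prod.smul_fst, Prod.smul_snd, smul_eq_mul]
  ring

theorem normSq_unitVec (α : ℝ) : normSq (unitVec α) = 1 := Real.sin_sq_add_cos_sq α

theorem contDiff_normSq : ContDiff ℝ ∞ normSq := by unfold normSq; fun_prop

theorem contDiffAt_normSq_cpow (z : ℂ) {v : ℝ × ℝ} (hv : v ≠ 0) :
    ContDiffAt ℝ ∞ (fun v : ℝ × ℝ => (normSq v : ℂ) ^ z) v := by
  have hs : ((normSq v : ℝ) : ℂ) ∈ Complex.slitPlane := Or.inl (by simpa using normSq_pos hv)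
  have h2 : ContDiffAt ℂ ∞ (fun w : ℂ => w ^ z) (normSq v : ℂ) := by
    have : AnalyticAt ℂ (fun w : ℂ => w ^ z) (normSq v : ℂ) :=
      analyticAt_id.cpow analyticAt_const hs
    exact this.contDiffAt
  exact (h2.restrict_scalars ℝ).comp v
    (Complex.ofRealCLM.contDiff.comp contDiff_normSq).contDiffAt

/-- The amplitude of the Fourier transform of the restriction of `H`: the function `H` rotated so
that the kernel does not depend on `v`, times the density. -/
noncomputable def testAmplitude (H : ℝ × ℝ × ℝ → ℂ) (y : (ℝ × ℝ) × ℝ × ℝ) : ℂ :=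
  ((Real.cosh y.2.1 : ℝ) : ℂ) * H
    (Real.cosh y.2.1 * (Real.cos y.2.2 * ((y.1.2 ^ 2 - y.1.1 ^ 2) / normSq y.1) +
        Real.sin y.2.2 * (2 * y.1.1 * y.1.2 / normSq y.1)),
      Real.cosh y.2.1 * (Real.sin y.2.2 * ((y.1.2 ^ 2 - y.1.1 ^ 2) / normSq y.1) -
        Real.cos y.2.2 * (2 * y.1.1 * y.1.2 / normSq y.1)), Real.sinh y.2.1)

theorem abs_le_abs_sinh (t : ℝ) : |t| ≤ |Real.sinh t| := by
  rw [Real.abs_sinh]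
  exact Real.self_le_sinh_iff.2 (abs_nonneg t)

theorem isFourierAmplitude_testAmplitude {H : ℝ × ℝ × ℝ → ℂ} (hH : ContDiff ℝ ∞ H) {T : ℝ}
    (hT : ∀ p, T < |p.2.2| → H p = 0) : IsFourierAmplitude T (testAmplitude H) := by
  refine ⟨?_, fun v s _ hs => ?_⟩
  · have hn : ContDiffOn ℝ ∞ (fun y : (ℝ × ℝ) × ℝ × ℝ => (normSq y.1)⁻¹)
        (({v | v ≠ 0} : Set (ℝ × ℝ)) ×ˢ Set.univ) :=
      (contDiff_normSq.comp contDiff_fst).contDiffOn.inv fun y hy => (normSq_pos hy.1).ne'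
    have hc : ContDiff ℝ ∞ fun y : (ℝ × ℝ) × ℝ × ℝ => Real.cosh y.2.1 := by fun_prop
    have hsh : ContDiff ℝ ∞ fun y : (ℝ × ℝ) × ℝ × ℝ => Real.sinh y.2.1 := by fun_prop
    have hco : ContDiff ℝ ∞ fun y : (ℝ × ℝ) × ℝ × ℝ => Real.cos y.2.2 := by fun_prop
    have hsi : ContDiff ℝ ∞ fun y : (ℝ × ℝ) × ℝ × ℝ => Real.sin y.2.2 := by fun_prop
    have h1 : ContDiffOn ℝ ∞ (fun y : (ℝ × ℝ) × ℝ × ℝ => (y.1.2 ^ 2 - y.1.1 ^ 2) / normSq y.1)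
        (({v | v ≠ 0} : Set (ℝ × ℝ)) ×ˢ Set.univ) := by
      have : ContDiff ℝ ∞ fun y : (ℝ × ℝ) × ℝ × ℝ => y.1.2 ^ 2 - y.1.1 ^ 2 := by fun_prop
      exact this.contDiffOn.mul hn
    have h2 : ContDiffOn ℝ ∞ (fun y : (ℝ × ℝ) × ℝ × ℝ => 2 * y.1.1 * y.1.2 / normSq y.1)
        (({v | v ≠ 0} : Set (ℝ × ℝ)) ×ˢ Set.univ) := by
      have : ContDiff ℝ ∞ fun y : (ℝ × ℝ) × ℝ × ℝ => 2 * y.1.1 * y.1.2 := by fun_prop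
      exact this.contDiffOn.mul hn
    refine ContDiffOn.mul (Complex.ofRealCLM.contDiff.comp hc).contDiffOn ?_
    refine hH.comp_contDiffOn ?_
    exact (hc.contDiffOn.mul ((hco.contDiffOn.mul h1).add (hsi.contDiffOn.mul h2))).prodMk
      ((hc.contDiffOn.mul ((hsi.contDiffOn.mul h1).sub (hco.contDiffOn.mul h2))).prodMk
        hsh.contDiffOn)
  -- The bound on the support is given for the coordinate `z = sinh t`, and `|t| ≤ |sinh t|` makes
  -- the same `T` work for `t`.
  · rw [testAmplitude, hT _ (lt_of_lt_of_le hs (abs_le_abs_sinh _)), mul_zero]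

/-- The rational expressions in the amplitude are `cos (2 * α)` and `sin (2 * α)`. They are smooth
and homogeneous of degree zero in `v ≠ 0`, whereas the angle itself is not globally smooth. -/
theorem testAmplitude_smul_unitVec (H : ℝ × ℝ × ℝ → ℂ) {r : ℝ} (hr : 0 < r) (α : ℝ) (s : ℝ × ℝ) :
    testAmplitude H (r • unitVec α, s) = ((Real.cosh s.1 : ℝ) : ℂ) *
      H (deSitterParam (s.1, s.2 - 2 * α)) := by
  have h1 : ((r • unitVec α).2 ^ 2 - (r • unitVec α).1 ^ 2) / normSq (r • unitVec α) =
      Real.cos (2 * α) := by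
    rw [normSq_smul, normSq_unitVec, Real.cos_two_mul']
    simp only [unitVec, Prod.smul_mk, smul_eq_mul]
    field_simp
  have h2 : 2 * (r • unitVec α).1 * (r • unitVec α).2 / normSq (r • unitVec α) =
      Real.sin (2 * α) := by
    rw [normSq_smul, normSq_unitVec, Real.sin_two_mul]
    simp only [unitVec, Prod.smul_mk, smul_eq_mul]
    field_simp
  simp only [testAmplitude, h1, h2, deSitterParam, Real.cos_sub, Real.sin_sub]

theorem testAmplitude_unitVec (H : ℝ × ℝ × ℝ → ℂ) (α : ℝ) (s : ℝ × ℝ) :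
    testAmplitude H (unitVec α, s) = ((Real.cosh s.1 : ℝ) : ℂ) *
      H (deSitterParam (s.1, s.2 - 2 * α)) := by
  rw [← testAmplitude_smul_unitVec H one_pos, one_smul]

theorem deSitterParam_periodic (t θ : ℝ) :
    (deSitterParam (t, θ + 2 * Real.pi) : ℝ × ℝ × ℝ) = deSitterParam (t, θ) := by
  simp only [deSitterParam, Real.cos_add_two_pi, Real.sin_add_two_pi]

/-- The translation `θ ↦ θ + 2 * α` moves the dependence on the line from the singular kernel to the
smooth amplitude. -/
theorem intF_testAmplitude (ε : ℤˣ) {H : ℝ × ℝ × ℝ → ℂ} (hH : ContDiff ℝ ∞ H) {T : ℝ}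
    (hT : ∀ p, T < |p.2.2| → H p = 0) (α : ℝ) {μ : ℂ} (hμ : -1 < μ.re) :
    Integrable (fun s => ((Real.cosh s.1 : ℝ) : ℂ) * H (deSitterParam s) *
      signedPow ε μ (kap s.1 (s.2 + 2 * α))) (boxMeasure (T + 1)) ∧
    ∫ s, ((Real.cosh s.1 : ℝ) : ℂ) * H (deSitterParam s) *
      signedPow ε μ (kap s.1 (s.2 + 2 * α)) ∂boxMeasure (T + 1) =
        intF ε T (unitVec α) (testAmplitude H) μ := by
  have hg := isFourierAmplitude_testAmplitude hH hT
  have hc := hg.continuous_slice (unitVec_ne_zero α)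
  have hi := integrable_mul_signedPow hc.aestronglyMeasurable measurable_kap ε
    (hg.integrable (unitVec_ne_zero α) hμ)
  have hm : Measurable fun s => testAmplitude H (unitVec α, s) * signedPow ε μ (kap s.1 s.2) :=
    hc.measurable.mul ((measurable_signedPow ε μ).comp measurable_kap)
  have hp : ∀ t, Function.Periodic (fun θ => testAmplitude H (unitVec α, (t, θ)) *
      signedPow ε μ (kap t θ)) (2 * Real.pi) := by
    intro t θ
    simp only [testAmplitude_unitVec, kap_periodic t θ]
    rw [show θ + 2 * Real.pi - 2 * α = θ - 2 * α + 2 * Real.pi by ring, deSitterParam_periodic]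
  have e : (fun s : ℝ × ℝ => ((Real.cosh s.1 : ℝ) : ℂ) * H (deSitterParam s) *
      signedPow ε μ (kap s.1 (s.2 + 2 * α))) = fun s => testAmplitude H (unitVec α,
        (s.1, s.2 + 2 * α)) * signedPow ε μ (kap s.1 (s.2 + 2 * α)) := by
    funext s
    simp only [testAmplitude_unitVec, add_sub_cancel_right]
  rw [e]
  exact ⟨integrable_prod_shift hm hp _ hi, integral_prod_shift hm hp _ hi⟩

/-- Restriction to the support of a test function. -/
theorem integrable_chart_iff_box {F : ℝ × ℝ → ℂ} {T : ℝ} (h : ∀ s : ℝ × ℝ, T < |s.1| → F s = 0) :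
    Integrable F chartMeasure ↔ Integrable F (boxMeasure T) := by
  rw [boxMeasure_eq_restrict]
  refine (integrableOn_iff_integrable_of_support_subset ?_).symm
  intro s hs
  refine ⟨?_, Set.mem_univ _⟩
  by_contra h'
  refine hs (h s ?_)
  rwa [Set.mem_Icc, ← abs_le, not_le] at h'

theorem integral_chart_eq_box {F : ℝ × ℝ → ℂ} {T : ℝ} (h : ∀ s : ℝ × ℝ, T < |s.1| → F s = 0) :
    ∫ s, F s ∂chartMeasure = ∫ s, F s ∂boxMeasure T := by
  rw [boxMeasure_eq_restrict]
  refine (setIntegral_eq_integral_of_forall_compl_eq_zero fun s hs => h s ?_).symm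
  by_contra h'
  exact hs ⟨abs_le.1 (not_lt.1 h'), Set.mem_univ _⟩

theorem test_eq_zero {H : ℝ × ℝ × ℝ → ℂ} {T : ℝ} (hT : ∀ p, T < |p.2.2| → H p = 0) {s : ℝ × ℝ}
    (hs : T + 1 < |s.1|) : H (deSitterParam s) = 0 :=
  hT _ (lt_of_lt_of_le (by linarith) (abs_le_abs_sinh s.1))

theorem integral_pulledKernel (ε : ℤˣ) {H : ℝ × ℝ × ℝ → ℂ} (hH : ContDiff ℝ ∞ H) {T : ℝ}
    (hT : ∀ p, T < |p.2.2| → H p = 0) {v : ℝ × ℝ} (hv : v ≠ 0) {μ : ℂ} (hμ : -1 < μ.re) :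
    Integrable (fun p : deSitter => pulledKernel ε μ p v * H p) deSitterMeasure ∧
      ∫ p : deSitter, pulledKernel ε μ p v * H p ∂deSitterMeasure =
        (normSq v : ℂ) ^ μ * intF ε T v (testAmplitude H) μ := by
  obtain ⟨r, α, hr, -, rfl⟩ := exists_eq_smul_unitVec hv
  obtain ⟨hi, he⟩ := intF_testAmplitude ε hH hT α hμ
  have e1 : intF ε T (r • unitVec α) (testAmplitude H) μ =
      intF ε T (unitVec α) (testAmplitude H) μ := by
    simp only [intF, testAmplitude_smul_unitVec H hr, testAmplitude_unitVec]
  have e2 : (fun s : ℝ × ℝ => ((Real.cosh s.1 : ℝ) : ℂ) *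
      (pulledKernel ε μ (deSitterParam s) (r • unitVec α) * H (deSitterParam s))) = fun s =>
      (normSq (r • unitVec α) : ℂ) ^ μ * (((Real.cosh s.1 : ℝ) : ℂ) * H (deSitterParam s) *
        signedPow ε μ (kap s.1 (s.2 + 2 * α))) := by
    funext s
    rw [pulledKernel_eq, pointForm_smul, pointForm_deSitterParam,
      signedPow_mul_of_pos _ _ (by positivity), normSq_smul, normSq_unitVec, mul_one]
    ring
  have hz : ∀ s : ℝ × ℝ, T + 1 < |s.1| → (normSq (r • unitVec α) : ℂ) ^ μ *
      (((Real.cosh s.1 : ℝ) : ℂ) * H (deSitterParam s) *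
        signedPow ε μ (kap s.1 (s.2 + 2 * α))) = 0 := by
    intro s hs
    rw [test_eq_zero hT hs]
    ring
  rw [integrable_deSitter_iff, integral_deSitter, e2, integrable_chart_iff_box hz,
    integral_chart_eq_box hz, e1]
  exact ⟨hi.const_mul _, by rw [integral_const_mul, he]⟩

/-- The Fourier transform of the restriction of `H`, with `μ = -lam / 2`. -/
noncomputable def fourierSection (ε : ℤˣ) (T : ℝ) (H : ℝ × ℝ × ℝ → ℂ) (μ : ℂ) (v : ℝ × ℝ) : ℂ :=
  (normSq v : ℂ) ^ μ * continuation ε opF (fun _ => 0) (intF ε T v) (testAmplitude H) μ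

theorem neg_half_mem_nonPole {lam : ℂ} (h : ∀ n : ℕ, lam ≠ 2 * ((n : ℂ) + 1)) :
    -lam / 2 ∈ nonPole := by
  intro n hn
  refine h n ?_
  linear_combination (-2) * hn

theorem hasContinuedIntegral_fourierSection (ε : ℤˣ) {H : ℝ × ℝ × ℝ → ℂ} (hH : ContDiff ℝ ∞ H)
    {T : ℝ} (hT : ∀ p, T < |p.2.2| → H p = 0) {v : ℝ × ℝ} (hv : v ≠ 0) {lam : ℂ}
    (hlam : -lam / 2 ∈ nonPole) :
    HasContinuedIntegral deSitterMeasure {ν | ν.re < 2}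
      (fun ν p => pulledKernel ε (-ν / 2) p v * H p) lam (fourierSection ε T H (-lam / 2) v) := by
  have S := shiftFamily_intF ε T hv
  have hg := isFourierAmplitude_testAmplitude hH hT
  have hn : ((normSq v : ℝ) : ℂ) ≠ 0 := by exact_mod_cast (normSq_pos hv).ne'
  have ha : ∀ ν : ℂ, AnalyticAt ℂ (fun ν : ℂ => -ν / 2) ν := fun ν => by fun_prop
  have hpow : ∀ ν : ℂ, AnalyticAt ℂ (fun ν : ℂ => (normSq v : ℂ) ^ (-ν / 2)) ν := by
    intro ν
    have : Differentiable ℂ fun ν : ℂ => (normSq v : ℂ) ^ (-ν / 2) := fun z =>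
      ((ha z).differentiableAt).const_cpow (Or.inl hn)
    exact this.analyticAt ν
  refine ⟨fun ν => fourierSection ε T H (-ν / 2) v, fun ν _ => ?_, fun ν hν => ?_, ?_, rfl⟩
  · exact (hpow ν).meromorphicAt.mul (MeromorphicAt.comp_analyticAt (g := fun ν : ℂ => -ν / 2)
      (S.meromorphic_continuation hg _) (ha ν))
  · have hre : -1 < (-ν / 2).re := by
      have h2 : ν.re < 2 := hν
      simp
      linarith
    obtain ⟨h1, h2⟩ := integral_pulledKernel ε hH hT hv hre
    refine ⟨h1, ?_⟩
    rw [h2, ← S.continuation_of_re hg hre]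
    rfl
  · exact (hpow lam).mul (AnalyticAt.comp (f := fun ν : ℂ => -ν / 2)
      (S.analyticOnNhd_continuation hg _ hlam) (ha lam))

/-- Homogeneity holds for the kernel, hence for the convergent integrals, and passes to the
continuation by uniqueness. Smoothness comes from the explicit iterated form. -/
theorem isSection_fourierSection (ε : ℤˣ) {H : ℝ × ℝ × ℝ → ℂ} (hH : ContDiff ℝ ∞ H) {T : ℝ}
    (hT : ∀ p, T < |p.2.2| → H p = 0) {lam : ℂ} (hlam : -lam / 2 ∈ nonPole) :
    IsSection lam (fourierSection ε T H (-lam / 2)) := by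
  refine ⟨?_, fun t v ht hv => ?_⟩
  · refine ContDiffOn.mul ?_ (contDiffOn_continuation_intF ε
      (isFourierAmplitude_testAmplitude hH hT) _)
    exact fun v hv => (contDiffAt_normSq_cpow _ hv).contDiffWithinAt
  · have htv : t • v ≠ 0 := smul_ne_zero ht hv
    obtain ⟨M, hM, hMS, hMa, hI⟩ := hasContinuedIntegral_fourierSection ε hH hT hv hlam
    have hn : ((|t| : ℝ) : ℂ) ≠ 0 := by exact_mod_cast (abs_pos.2 ht).ne'
    have hpow : ∀ ν : ℂ, AnalyticAt ℂ (fun ν : ℂ => ((|t| : ℝ) : ℂ) ^ (-ν)) ν := by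
      intro ν
      have : Differentiable ℂ fun ν : ℂ => ((|t| : ℝ) : ℂ) ^ (-ν) := fun z =>
        (differentiableAt_id.neg).const_cpow (Or.inl hn)
      exact this.analyticAt ν
    refine HasContinuedIntegral.unique (isOpen_lt Complex.continuous_re continuous_const)
      ⟨0, by simp⟩ (hasContinuedIntegral_fourierSection ε hH hT htv hlam)
      ⟨fun ν => ((|t| : ℝ) : ℂ) ^ (-ν) * M ν, fun ν hν => (hpow ν).meromorphicAt.mul (hM ν hν),
        fun ν hν => ?_, (hpow lam).mul hMa, by beta_reduce; rw [hI]⟩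
    have e : (fun p : deSitter => pulledKernel ε (-ν / 2) p (t • v) * H p) = fun p =>
        ((|t| : ℝ) : ℂ) ^ (-ν) * (pulledKernel ε (-ν / 2) p v * H p) := by
      funext p
      have h2 : ((t ^ 2 : ℝ) : ℂ) ^ (-ν / 2) = ((|t| : ℝ) : ℂ) ^ (-ν) := by
        rw [← sq_abs, sq, Complex.ofReal_mul, Complex.mul_cpow_ofReal_nonneg (abs_nonneg _)
          (abs_nonneg _), ← Complex.cpow_add _ _ hn]
        ring_nf
      rw [pulledKernel_eq, pulledKernel_eq, pointForm_smul, signedPow_mul_of_pos _ _ (by positivity),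
        h2, mul_assoc]
    obtain ⟨h3, h4⟩ := hMS ν hν
    refine ⟨?_, ?_⟩
    · simp only [e]
      exact h3.const_mul _
    · simp only [e, h4]
      exact (integral_const_mul _ _).symm

theorem IsTestFunction.exists_support {h : deSitter → ℂ} (hh : IsTestFunction h) :
    ∃ (H : ℝ × ℝ × ℝ → ℂ) (T : ℝ), ContDiff ℝ ∞ H ∧ (∀ p, T < |p.2.2| → H p = 0) ∧
      h = fun p : deSitter => H p := by
  obtain ⟨H, hH, hc, he⟩ := hh
  obtain ⟨R, hR⟩ := hc.isCompact.isBounded.exists_norm_le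
  refine ⟨H, R, hH, fun p hp => ?_, funext he⟩
  by_contra h0
  have h1 := hR p (subset_tsupport _ h0)
  have h2 : |p.2.2| ≤ ‖p‖ := (norm_snd_le p.2).trans (norm_snd_le p)
  linarith

/-! ## The Bruhat coordinate and the circle -/

theorem circleMeasure_eq_Ioo :
    circleMeasure = volume.restrict (Set.Ioo (-(Real.pi / 2)) (Real.pi / 2)) :=
  Measure.restrict_congr_set Ioo_ae_eq_Ioc.symm

theorem ae_circleMeasure_cos_pos : ∀ᵐ α ∂circleMeasure, 0 < Real.cos α := by
  rw [circleMeasure_eq_Ioo]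
  filter_upwards [ae_restrict_mem measurableSet_Ioo] with α hα using Real.cos_pos_of_mem_Ioo hα

theorem hasDerivWithinAt_tan {α : ℝ} (hα : α ∈ Set.Ioo (-(Real.pi / 2)) (Real.pi / 2)) :
    HasDerivWithinAt Real.tan (1 / Real.cos α ^ 2) (Set.Ioo (-(Real.pi / 2)) (Real.pi / 2)) α :=
  (Real.hasDerivAt_tan (Real.cos_pos_of_mem_Ioo hα).ne').hasDerivWithinAt

theorem integrable_comp_tan_iff {G : ℝ → ℂ} : Integrable G ↔
    Integrable (fun α => ((1 / Real.cos α ^ 2 : ℝ) : ℂ) * G (Real.tan α)) circleMeasure := by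
  have := integrableOn_image_iff_integrableOn_abs_deriv_smul (g := G) measurableSet_Ioo
    (fun α hα => hasDerivWithinAt_tan hα) Real.injOn_tan
  rw [Real.image_tan_Ioo, integrableOn_univ] at this
  rw [this, circleMeasure_eq_Ioo, IntegrableOn]
  simp only [Complex.real_smul, abs_of_nonneg (show (0 : ℝ) ≤ 1 / Real.cos _ ^ 2 by positivity)]

theorem integral_comp_tan (G : ℝ → ℂ) : ∫ ζ, G ζ =
    ∫ α, ((1 / Real.cos α ^ 2 : ℝ) : ℂ) * G (Real.tan α) ∂circleMeasure := by
  have := integral_image_eq_integral_abs_deriv_smul measurableSet_Ioo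
    (fun α hα => hasDerivWithinAt_tan hα) Real.injOn_tan G
  rw [Real.image_tan_Ioo, Measure.restrict_univ] at this
  rw [this, circleMeasure_eq_Ioo]
  simp only [Complex.real_smul, abs_of_nonneg (show (0 : ℝ) ≤ 1 / Real.cos _ ^ 2 by positivity)]

theorem tan_one_eq_smul {α : ℝ} (h : 0 < Real.cos α) :
    ((Real.tan α, 1) : ℝ × ℝ) = (Real.cos α)⁻¹ • unitVec α := by
  simp only [unitVec, Prod.smul_mk, smul_eq_mul, Real.tan_eq_sin_div_cos, inv_mul_cancel₀ h.ne']
  rw [div_eq_inv_mul]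

theorem ofReal_cpow_exp {c : ℝ} (hc : 0 < c) (z : ℂ) :
    (c : ℂ) ^ z = Complex.exp (((Real.log c : ℝ) : ℂ) * z) := by
  rw [Complex.cpow_def_of_ne_zero (by exact_mod_cast hc.ne'), ← Complex.ofReal_log hc.le]

theorem IsSection.tan_one {lam : ℂ} {φ : ℝ × ℝ → ℂ} (hφ : IsSection lam φ) {α : ℝ}
    (h : 0 < Real.cos α) :
    φ (Real.tan α, 1) = ((Real.cos α : ℝ) : ℂ) ^ lam * φ (unitVec α) := by
  rw [tan_one_eq_smul h, hφ.homogeneous _ _ (inv_ne_zero h.ne') (unitVec_ne_zero α),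
    abs_of_pos (inv_pos.2 h), ofReal_cpow_exp (inv_pos.2 h), ofReal_cpow_exp h, Real.log_inv]
  push_cast
  ring_nf

theorem IsSection.neg {lam : ℂ} {φ : ℝ × ℝ → ℂ} (hφ : IsSection lam φ) {v : ℝ × ℝ} (hv : v ≠ 0) :
    φ (-v) = φ v := by
  have := hφ.homogeneous (-1) v (by norm_num) hv
  simpa using this

theorem unitVec_add_pi (α : ℝ) : unitVec (α + Real.pi) = -unitVec α := by
  simp only [unitVec, Real.sin_add_pi, Real.cos_add_pi, Prod.neg_mk]

theorem contDiff_unitVec : ContDiff ℝ ∞ unitVec := by unfold unitVec; fun_prop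

theorem IsSection.contDiff_unitVec {lam : ℂ} {φ : ℝ × ℝ → ℂ} (hφ : IsSection lam φ) :
    ContDiff ℝ ∞ fun α => φ (unitVec α) := by
  rw [← contDiffOn_univ]
  exact hφ.smooth.comp _root_.contDiff_unitVec.contDiffOn fun α _ => unitVec_ne_zero α

theorem Continuous.integrable_circle {G : ℝ → ℂ} (hG : Continuous G) :
    Integrable G circleMeasure :=
  (hG.integrableOn_Icc (a := -(Real.pi / 2)) (b := Real.pi / 2)).mono_set Set.Ioc_subset_Icc_self

/-- The factors `cos ^ lam` and `cos ^ (2 - lam)` of the two sections cancel the Jacobian `cos ^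
(-2)` of `ζ = tan α`. -/
theorem pairing_eq_circle {lam : ℂ} {F φ : ℝ × ℝ → ℂ} (hF : IsSection lam F)
    (hφ : IsSection (2 - lam) φ) : Integrable (fun ζ : ℝ => F (ζ, 1) * φ (ζ, 1)) ∧
      ∫ ζ : ℝ, F (ζ, 1) * φ (ζ, 1) = ∫ α, φ (unitVec α) * F (unitVec α) ∂circleMeasure := by
  have e : (fun α => ((1 / Real.cos α ^ 2 : ℝ) : ℂ) * (F (Real.tan α, 1) * φ (Real.tan α, 1)))
      =ᵐ[circleMeasure] fun α => φ (unitVec α) * F (unitVec α) := by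
    filter_upwards [ae_circleMeasure_cos_pos] with α hα
    have hc : ((Real.cos α : ℝ) : ℂ) ≠ 0 := by exact_mod_cast hα.ne'
    have h1 : ((Real.cos α : ℝ) : ℂ) ^ lam * ((Real.cos α : ℝ) : ℂ) ^ (2 - lam) =
        ((Real.cos α : ℝ) : ℂ) ^ 2 := by
      rw [← Complex.cpow_add _ _ hc, add_sub_cancel]
      norm_cast
    rw [hF.tan_one hα, hφ.tan_one hα]
    calc _ = ((1 / Real.cos α ^ 2 : ℝ) : ℂ) * (((Real.cos α : ℝ) : ℂ) ^ lam *
          ((Real.cos α : ℝ) : ℂ) ^ (2 - lam)) * (φ (unitVec α) * F (unitVec α)) := by ring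
      _ = _ := by
        rw [h1]
        push_cast at hc ⊢
        field_simp
  rw [integrable_comp_tan_iff, integral_comp_tan, integral_congr_ae e, integrable_congr e]
  exact ⟨Continuous.integrable_circle
    (hφ.contDiff_unitVec.continuous.mul hF.contDiff_unitVec.continuous), rfl⟩

/-! ## The Poisson side: integration by parts on the circle -/

/-- Amplitudes `g(t, θ; α)` on the Poisson side. -/
structure IsPoissonAmplitude (g : (ℝ × ℝ) × ℝ → ℂ) : Prop where
  smooth : ContDiff ℝ ∞ g
  periodic : ∀ (s : ℝ × ℝ) (α : ℝ), g (s, α + Real.pi) = g (s, α)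

/-- The kernel as a function on the product of the de Sitter space and the circle. -/
noncomputable def kapCircle (y : (ℝ × ℝ) × ℝ) : ℝ := kap y.1.1 (y.1.2 + 2 * y.2)

/-- The derivative of `kapCircle` in the last variable. -/
noncomputable def kapA (y : (ℝ × ℝ) × ℝ) : ℝ := Real.cosh y.1.1 * Real.cos (y.1.2 + 2 * y.2)

theorem contDiff_kapCircle : ContDiff ℝ ∞ kapCircle := by
  unfold kapCircle kap; fun_prop

theorem contDiff_kapA : ContDiff ℝ ∞ kapA := by
  unfold kapA; fun_prop

/-- At a zero of `kapCircle` the derivative is `±1`. The identity writes `1` as `kapA ^ 2` plus a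
multiple of `kapCircle`, which replaces a division by `kapA`. -/
theorem kapA_sq (y : (ℝ × ℝ) × ℝ) :
    kapA y ^ 2 = 1 + 4 * kapCircle y * (Real.sinh y.1.1 - kapCircle y) := by
  have h1 := Real.cosh_sq y.1.1
  have h2 := Real.sin_sq_add_cos_sq (y.1.2 + 2 * y.2)
  simp only [kapA, kapCircle, kap]
  linear_combination (Real.cosh y.1.1) ^ 2 * h2 + h1

theorem hasDerivAt_kapCircle (s : ℝ × ℝ) (α : ℝ) :
    HasDerivAt (fun α => kapCircle (s, α)) (kapA (s, α)) α := by
  have h1 : HasDerivAt (fun α : ℝ => s.2 + 2 * α) 2 α := by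
    simpa using ((hasDerivAt_id α).const_mul 2).const_add s.2
  have h2 := ((((Real.hasDerivAt_sin _).comp α h1).const_mul (Real.cosh s.1)).const_add
    (Real.sinh s.1)).div_const 2
  exact h2.congr_deriv (by simp only [kapA]; ring)

theorem kapCircle_add_pi (s : ℝ × ℝ) (α : ℝ) : kapCircle (s, α + Real.pi) = kapCircle (s, α) := by
  simp only [kapCircle]
  rw [show s.2 + 2 * (α + Real.pi) = s.2 + 2 * α + 2 * Real.pi by ring, kap_periodic]

theorem kapA_add_pi (s : ℝ × ℝ) (α : ℝ) : kapA (s, α + Real.pi) = kapA (s, α) := by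
  simp only [kapA]
  rw [show s.2 + 2 * (α + Real.pi) = s.2 + 2 * α + 2 * Real.pi by ring, Real.cos_add_two_pi]

/-- The operator `g ↦ -∂_α (g ∂_α kapCircle)`. -/
noncomputable def opA (g : (ℝ × ℝ) × ℝ → ℂ) (y : (ℝ × ℝ) × ℝ) : ℂ :=
  -fderiv ℝ (fun y => kapA y • g y) y (0, 1)

/-- The zeroth order term of the functional equation of `kapCircle`. -/
noncomputable def opB (g : (ℝ × ℝ) × ℝ → ℂ) (y : (ℝ × ℝ) × ℝ) : ℂ :=
  (-4 * (Real.sinh y.1.1 - kapCircle y)) • g y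

namespace IsPoissonAmplitude

variable {g : (ℝ × ℝ) × ℝ → ℂ}

theorem smooth_mul (hg : IsPoissonAmplitude g) : ContDiff ℝ ∞ fun y => kapA y • g y :=
  contDiff_kapA.smul hg.smooth

theorem hasDerivAt (hg : IsPoissonAmplitude g) (s : ℝ × ℝ) (α : ℝ) :
    HasDerivAt (fun α => kapA (s, α) • g (s, α)) (-opA g (s, α)) α := by
  have h1 : HasFDerivAt (fun y => kapA y • g y) _ (s, α) :=
    ((hg.smooth_mul.differentiable (by simp)).differentiableAt).hasFDerivAt
  have h2 : HasDerivAt (fun α : ℝ => ((s, α) : (ℝ × ℝ) × ℝ)) (0, 1) α :=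
    (hasDerivAt_const α s).prodMk (hasDerivAt_id α)
  have := HasFDerivAt.comp_hasDerivAt α (f := fun α : ℝ => ((s, α) : (ℝ × ℝ) × ℝ)) h1 h2
  rw [opA, neg_neg]
  exact this

theorem op_A (hg : IsPoissonAmplitude g) : IsPoissonAmplitude (opA g) := by
  refine ⟨?_, fun s α => ?_⟩
  · have h := hg.smooth_mul.fderiv_right (m := ∞) (by simp)
    have h0 : ContDiff ℝ ∞ (fun _ : (ℝ × ℝ) × ℝ => ((0, 1) : (ℝ × ℝ) × ℝ)) := contDiff_const
    exact (h.clm_apply h0).neg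
  · have h1 := hg.hasDerivAt s (α + Real.pi)
    have h2 := (HasDerivAt.comp_add_const α Real.pi h1)
    have e : (fun α => kapA (s, α + Real.pi) • g (s, α + Real.pi)) =
        fun α => kapA (s, α) • g (s, α) := by
      funext α
      rw [kapA_add_pi, hg.periodic]
    rw [e] at h2
    exact neg_injective (h2.unique (hg.hasDerivAt s α))

theorem op_B (hg : IsPoissonAmplitude g) : IsPoissonAmplitude (opB g) := by
  refine ⟨?_, fun s α => ?_⟩
  · have : ContDiff ℝ ∞ fun y : (ℝ × ℝ) × ℝ => -4 * (Real.sinh y.1.1 - kapCircle y) := by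
      have := contDiff_kapCircle
      fun_prop
    exact this.smul hg.smooth
  · simp only [opB, kapCircle_add_pi, hg.periodic]

theorem continuous_slice (hg : IsPoissonAmplitude g) (s : ℝ × ℝ) : Continuous fun α => g (s, α) :=
  hg.smooth.continuous.comp (by fun_prop)

theorem integrable (hg : IsPoissonAmplitude g) (s : ℝ × ℝ) {σ : ℝ} (hσ : -1 < σ) :
    Integrable (fun α => ‖g (s, α)‖ * |kapCircle (s, α)| ^ σ) circleMeasure := by
  obtain ⟨C, hC⟩ := (isCompact_Icc (a := -(Real.pi / 2))
    (b := Real.pi / 2)).exists_bound_of_continuousOn (hg.continuous_slice s).continuousOn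
  exact integrable_norm_mul_rpow (hg.continuous_slice s).aestronglyMeasurable
    (by filter_upwards [ae_circleMeasure] with α hα using hC α hα)
    (integrable_abs_kap_rpow_circle hσ s.1 s.2)

end IsPoissonAmplitude

/-- The integral whose continuation is the Poisson transform. -/
noncomputable def intP (ε : ℤˣ) (s : ℝ × ℝ) (g : (ℝ × ℝ) × ℝ → ℂ) (μ : ℂ) : ℂ :=
  ∫ α, g (s, α) * signedPow ε μ (kapCircle (s, α)) ∂circleMeasure

theorem continuous_kapCircle_slice (s : ℝ × ℝ) : Continuous fun α => kapCircle (s, α) :=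
  contDiff_kapCircle.continuous.comp (by fun_prop)

/-- Split the amplitude by `kapA_sq`. The part with `kapA ^ 2` is integrated by parts and gives
`opA`; the part with a factor `kapCircle` is absorbed by `signedPow_add_one` and gives `opB`. -/
theorem shiftFamily_intP (ε : ℤˣ) (s : ℝ × ℝ) :
    ShiftFamily ε opA opB (intP ε s) IsPoissonAmplitude := by
  have hkc := continuous_kapCircle_slice s
  refine ShiftFamily.of_eqn_re_pos (fun g hg => hg.op_A) (fun g hg => hg.op_B)
    (fun g hg => differentiableOn_integral_mul_signedPow
      (hg.continuous_slice s).aestronglyMeasurable hkc.measurable ε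
      fun σ hσ => hg.integrable s hσ) (fun g hg μ hμ => ?_)
  have hpi : -(Real.pi / 2) ≤ Real.pi / 2 := by linarith [Real.pi_pos]
  have hμ0 : 0 < (μ + 1).re := by
      simp only [Complex.add_re, Complex.one_re]; linarith
  have hμ1 : μ + 1 ≠ 0 := nonPole_add_one_ne (mem_nonPole_of_re (by linarith))
  have hkA : Continuous fun α => kapA (s, α) := contDiff_kapA.continuous.comp (by fun_prop)
  have hsp := (continuous_signedPow ε hμ).comp hkc
  have hsp1 := (continuous_signedPow ε hμ0).comp hkc
  have hd : ∀ α : ℝ, HasDerivAt (fun α => signedPow ε (μ + 1) (kapCircle (s, α)))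
      (kapA (s, α) • (((ε : ℤ) : ℂ) * (μ + 1) * signedPow ε μ (kapCircle (s, α)))) α := fun α =>
    HasDerivAt.scomp (g₁ := signedPow ε (μ + 1)) α (hasDerivAt_signedPow ε hμ _)
      (hasDerivAt_kapCircle s α)
  have key := intervalIntegral.integral_mul_deriv_eq_deriv_mul
    (a := -(Real.pi / 2)) (b := Real.pi / 2)
    (fun α _ => hg.hasDerivAt s α) (fun α _ => hd α)
    ((hg.op_A.continuous_slice s).neg.intervalIntegrable _ _)
    (Continuous.intervalIntegrable (hkA.smul (continuous_const.mul hsp)) _ _)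
  have hq : Real.pi / 2 = -(Real.pi / 2) + Real.pi := by ring
  -- All factors have period `π`, so the two boundary terms cancel.
  have e1 : kapA (s, Real.pi / 2) = kapA (s, -(Real.pi / 2)) := by
    conv_lhs => rw [hq, kapA_add_pi]
  have e2 : kapCircle (s, Real.pi / 2) = kapCircle (s, -(Real.pi / 2)) := by
    conv_lhs => rw [hq, kapCircle_add_pi]
  have e3 : g (s, Real.pi / 2) = g (s, -(Real.pi / 2)) := by
    conv_lhs => rw [hq, hg.periodic]
  rw [e1, e2, e3, sub_self, zero_sub] at key
  simp only [neg_mul, intervalIntegral.integral_neg, neg_neg] at key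
  rw [intervalIntegral.integral_of_le hpi, intervalIntegral.integral_of_le hpi] at key
  change ∫ α, _ ∂circleMeasure = ∫ α, opA g (s, α) * _ ∂circleMeasure at key
  have i1 : Integrable (fun α => kapA (s, α) • g (s, α) * (kapA (s, α) • (((ε : ℤ) : ℂ) * (μ + 1) *
      signedPow ε μ (kapCircle (s, α))))) circleMeasure :=
    Continuous.integrable_circle ((hkA.smul (hg.continuous_slice s)).mul
      (hkA.smul (continuous_const.mul hsp)))
  have i2 : Integrable (fun α => opB g (s, α) * signedPow ε (μ + 1) (kapCircle (s, α)))
      circleMeasure := Continuous.integrable_circle ((hg.op_B.continuous_slice s).mul hsp1)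
  simp only [intP]
  rw [← key, ← integral_const_mul, ← integral_add (i1.const_mul _) i2, ← integral_const_mul]
  refine integral_congr_ae (Eventually.of_forall fun α => ?_)
  have h3 := units_int_cast_mul_self_complex ε
  have h4 : ((kapA (s, α) : ℝ) : ℂ) ^ 2 = 1 + 4 * kapCircle (s, α) *
      (((Real.sinh s.1 : ℝ) : ℂ) - kapCircle (s, α)) := by
    have := kapA_sq (s, α)
    exact_mod_cast this
  simp only [opB, signedPow_add_one, Complex.real_smul, Complex.ofReal_mul, Complex.ofReal_sub,
    Complex.ofReal_neg, Complex.ofReal_ofNat]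
  generalize ((kapA (s, α) : ℝ) : ℂ) = a at *
  generalize ((kapCircle (s, α) : ℝ) : ℂ) = k at *
  generalize ((Real.sinh s.1 : ℝ) : ℂ) = b at *
  generalize signedPow ε μ (kapCircle (s, α)) = P at *
  generalize g (s, α) = G at *
  field_simp
  linear_combination (-P * G * (1 + 4 * k * (b - k)) + 4 * k * (b - k) * P * G) * h3
    - ((ε : ℤ) : ℂ) ^ 2 * P * G * h4

/-! ## The Poisson transform -/

/-- The point of the de Sitter space given by two distinct lines. -/
noncomputable def pointOfLines (v w : ℝ × ℝ) : ℝ × ℝ × ℝ :=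
  (-(w.1 * v.2 + v.1 * w.2) / wedge v w, (w.1 * v.1 - w.2 * v.2) / wedge v w,
    (w.1 * v.1 + w.2 * v.2) / wedge v w)

theorem pointOfLines_mem {v w : ℝ × ℝ} (h : wedge v w ≠ 0) : pointOfLines v w ∈ deSitter := by
  simp only [deSitter, Set.mem_ofPred_eq, pointOfLines]
  rw [div_pow, div_pow, div_pow]
  field_simp
  simp only [wedge]
  ring

theorem wedge_mul_wedge_div {v w : ℝ × ℝ} (h : wedge v w ≠ 0) (u : ℝ × ℝ) :
    wedge v u * wedge w u / wedge v w = pointForm (pointOfLines v w) u := by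
  simp only [pointForm, pointOfLines]
  field_simp
  simp only [wedge]
  ring

theorem pointOfLines_of_represents {g : SL(2, ℝ)} {p : deSitter} (h : Represents g p) :
    pointOfLines (lineP g) (lineWP g) = p := by
  obtain ⟨h1, h2, h3⟩ := (represents_iff _ _).1 h
  rw [pointOfLines, wedge_lineP_lineWP]
  simp only [lineP, lineWP, div_one]
  refine Prod.ext ?_ (Prod.ext ?_ ?_)
  · simp only; linarith
  · simp only; linarith
  · simp only; linarith

/-- The coordinates of the point given by two lines. -/
noncomputable def coordOfLines (v w : ℝ × ℝ) : ℝ × ℝ :=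
  open Classical in
  if h : wedge v w ≠ 0 then deSitterCoord ⟨pointOfLines v w, pointOfLines_mem h⟩ else 0

theorem deSitterParam_coordOfLines {v w : ℝ × ℝ} (h : wedge v w ≠ 0) :
    (deSitterParam (coordOfLines v w) : ℝ × ℝ × ℝ) = pointOfLines v w := by
  rw [coordOfLines, dif_pos h, deSitterParam_deSitterCoord]

theorem coordOfLines_rep (p : deSitter) :
    coordOfLines (lineP (rep p)) (lineWP (rep p)) = deSitterCoord p := by
  have h : wedge (lineP (rep p)) (lineWP (rep p)) ≠ 0 := by
    rw [wedge_lineP_lineWP]; exact one_ne_zero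
  rw [coordOfLines, dif_pos h]
  congr 1
  exact Subtype.ext (pointOfLines_of_represents (represents_rep p))

/-- The amplitude of the Poisson transform of a section. -/
noncomputable def sectionAmplitude (φ : ℝ × ℝ → ℂ) (y : (ℝ × ℝ) × ℝ) : ℂ := φ (unitVec y.2)

theorem IsSection.isPoissonAmplitude {lam : ℂ} {φ : ℝ × ℝ → ℂ} (hφ : IsSection lam φ) :
    IsPoissonAmplitude (sectionAmplitude φ) :=
  ⟨hφ.contDiff_unitVec.comp contDiff_snd, fun s α => by
    simp only [sectionAmplitude, unitVec_add_pi, hφ.neg (unitVec_ne_zero α)]⟩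

/-- The image of a section under the continuation of `H_μ^ε` with `δ = -ε`. -/
noncomputable def holographic (δ : ℤˣ) (φ : ℝ × ℝ → ℂ) (μ : ℂ) (v w : ℝ × ℝ) : ℂ :=
  ((wedge v w : ℝ) : ℂ)⁻¹ * continuation δ opA opB (intP δ (coordOfLines v w))
    (sectionAmplitude φ) μ

/-- On the circle the factor `(1 + ζ ^ 2) ^ ((lam - ν) / 2)` keeps the amplitude equal to `φ` on
unit vectors for every `ν`, so that only the exponent of the kernel varies. -/
theorem integral_kernelK (δ : ℤˣ) {lam : ℂ} {φ : ℝ × ℝ → ℂ} (hφ : IsSection lam φ) {v w : ℝ × ℝ}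
    (h : wedge v w ≠ 0) {ν : ℂ} (hν : 0 < ν.re) :
    Integrable (fun ζ : ℝ => φ (ζ, 1) * ((1 + ζ ^ 2 : ℝ) : ℂ) ^ ((lam - ν) / 2) *
      kernelK δ (ν / 2 - 1) v w (ζ, 1)) ∧
    ∫ ζ : ℝ, φ (ζ, 1) * ((1 + ζ ^ 2 : ℝ) : ℂ) ^ ((lam - ν) / 2) *
      kernelK δ (ν / 2 - 1) v w (ζ, 1) =
        intP δ (coordOfLines v w) (sectionAmplitude φ) (ν / 2 - 1) := by
  have hre : -1 < (ν / 2 - 1).re := by simp; linarith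
  have hg := hφ.isPoissonAmplitude
  have e : (fun α => ((1 / Real.cos α ^ 2 : ℝ) : ℂ) * (φ (Real.tan α, 1) *
      ((1 + Real.tan α ^ 2 : ℝ) : ℂ) ^ ((lam - ν) / 2) *
      kernelK δ (ν / 2 - 1) v w (Real.tan α, 1))) =ᵐ[circleMeasure] fun α =>
      sectionAmplitude φ (coordOfLines v w, α) *
        signedPow δ (ν / 2 - 1) (kapCircle (coordOfLines v w, α)) := by
    filter_upwards [ae_circleMeasure_cos_pos] with α hα
    have hc : ((Real.cos α : ℝ) : ℂ) ≠ 0 := by exact_mod_cast hα.ne'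
    have h1 : kernelK δ (ν / 2 - 1) v w (Real.tan α, 1) = (((Real.cos α)⁻¹ ^ 2 : ℝ) : ℂ) ^
        (ν / 2 - 1) * signedPow δ (ν / 2 - 1) (kapCircle (coordOfLines v w, α)) := by
      rw [kernelK, wedge_mul_wedge_div h, tan_one_eq_smul hα, pointForm_smul,
        ← deSitterParam_coordOfLines h, pointForm_deSitterParam,
        signedPow_mul_of_pos _ _ (by positivity)]
      rfl
    have h2 : (1 + Real.tan α ^ 2 : ℝ) = (Real.cos α)⁻¹ ^ 2 := by
      rw [inv_pow, ← Real.inv_one_add_tan_sq hα.ne', inv_inv]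
    have h3 : (1 / Real.cos α ^ 2 : ℝ) = (Real.cos α)⁻¹ ^ 2 := by rw [inv_pow, one_div]
    rw [h1, h2, h3, hφ.tan_one hα, ofReal_cpow_exp hα,
      ofReal_cpow_exp (c := (Real.cos α)⁻¹ ^ 2) (by positivity),
      ofReal_cpow_exp (c := (Real.cos α)⁻¹ ^ 2) (by positivity)]
    have h4 : (((Real.cos α)⁻¹ ^ 2 : ℝ) : ℂ) = Complex.exp ((Real.log ((Real.cos α)⁻¹ ^ 2) : ℝ)) := by
      rw [← Complex.ofReal_exp, Real.exp_log (by positivity)]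
    have h5 : Real.log ((Real.cos α)⁻¹ ^ 2) = -2 * Real.log (Real.cos α) := by
      rw [Real.log_pow, Real.log_inv]; push_cast; ring
    rw [h4, h5]
    -- The exponents of `cos α` from the Jacobian, the section, the interpolating factor and the
    -- kernel, `-2`, `lam`, `ν - lam` and `2 - ν`, add up to zero.
    have h6 : Complex.exp (((-2 * Real.log (Real.cos α) : ℝ) : ℂ)) *
        (Complex.exp (((Real.log (Real.cos α) : ℝ) : ℂ) * lam) *
        Complex.exp (((-2 * Real.log (Real.cos α) : ℝ) : ℂ) * ((lam - ν) / 2)) *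
        Complex.exp (((-2 * Real.log (Real.cos α) : ℝ) : ℂ) * (ν / 2 - 1))) = 1 := by
      rw [← Complex.exp_add, ← Complex.exp_add, ← Complex.exp_add]
      convert Complex.exp_zero using 2
      push_cast
      ring
    simp only [sectionAmplitude]
    linear_combination (φ (unitVec α) *
      signedPow δ (ν / 2 - 1) (kapCircle (coordOfLines v w, α))) * h6
  rw [integrable_comp_tan_iff, integral_comp_tan, integrable_congr e, integral_congr_ae e]
  exact ⟨integrable_mul_signedPow (hg.continuous_slice _).aestronglyMeasurable
    (continuous_kapCircle_slice _).measurable δ (hg.integrable _ hre), rfl⟩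

theorem isHolographic_holographic (ε : ℤˣ) {lam : ℂ} {φ : ℝ × ℝ → ℂ} (hφ : IsSection lam φ)
    (hlam : lam / 2 - 1 ∈ nonPole) :
    IsHolographic ε lam φ (holographic (-ε) φ (lam / 2 - 1)) := by
  intro v w h
  have S := shiftFamily_intP (-ε) (coordOfLines v w)
  have hg := hφ.isPoissonAmplitude
  have ha : ∀ ν : ℂ, AnalyticAt ℂ (fun ν : ℂ => ν / 2 - 1) ν := fun ν => by fun_prop
  refine ⟨fun ν => holographic (-ε) φ (ν / 2 - 1) v w, fun ν _ => ?_, fun ν hν => ?_, ?_, rfl⟩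
  · exact (MeromorphicAt.const _ _).mul (MeromorphicAt.comp_analyticAt
      (g := fun ν : ℂ => ν / 2 - 1) (S.meromorphic_continuation hg _) (ha ν))
  · have hν' : 0 < ν.re := hν
    have hre : -1 < (ν / 2 - 1).re := by simp; linarith
    obtain ⟨h1, h2⟩ := integral_kernelK (-ε) hφ h hν'
    refine ⟨h1.const_mul _, ?_⟩
    rw [integral_const_mul, h2, ← S.continuation_of_re hg hre]
    rfl
  · exact analyticAt_const.mul (AnalyticAt.comp (f := fun ν : ℂ => ν / 2 - 1)
      (S.analyticOnNhd_continuation hg _ hlam) (ha lam))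

theorem pullback_holographic (δ : ℤˣ) (φ : ℝ × ℝ → ℂ) (μ : ℂ) (p : deSitter) :
    pullback (holographic δ φ μ) p =
      continuation δ opA opB (intP δ (deSitterCoord p)) (sectionAmplitude φ) μ := by
  rw [pullback, holographic, wedge_lineP_lineWP, coordOfLines_rep]
  simp

theorem IsPoissonTransform.unique {ε : ℤˣ} {lam : ℂ} {φ : ℝ × ℝ → ℂ} {u u' : deSitter → ℂ}
    (h : IsPoissonTransform ε lam φ u) (h' : IsPoissonTransform ε lam φ u') : u = u' := by
  obtain ⟨Ψ, hΨ, rfl⟩ := h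
  obtain ⟨Ψ', hΨ', rfl⟩ := h'
  funext p
  have hw : wedge (lineP (rep p)) (lineWP (rep p)) ≠ 0 := by
    rw [wedge_lineP_lineWP]; exact one_ne_zero
  exact HasContinuedIntegral.unique (isOpen_halfPlane 0) ⟨1, by simp⟩
    (hΨ _ _ hw) (hΨ' _ _ hw)

/-! ## The duality of the Fourier and Poisson transforms -/

theorem exists_bound_box_prod {g : (ℝ × ℝ) × ℝ → ℂ} (hg : Continuous g) (T : ℝ) :
    ∃ C, ∀ᵐ y ∂((boxMeasure T).prod circleMeasure), ‖g y‖ ≤ C := by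
  obtain ⟨C, hC⟩ := ((isCompact_Icc.prod isCompact_Icc).prod isCompact_Icc :
    IsCompact ((Set.Icc (-T) T ×ˢ Set.Icc (-Real.pi) Real.pi) ×ˢ
      Set.Icc (-(Real.pi / 2)) (Real.pi / 2))).exists_bound_of_continuousOn hg.continuousOn
  refine ⟨C, ?_⟩
  filter_upwards [Measure.quasiMeasurePreserving_fst.ae (ae_boxMeasure_mem T),
    Measure.quasiMeasurePreserving_snd.ae ae_circleMeasure] with y h1 h2
  exact hC y ⟨h1, h2⟩

theorem exists_bound_prod_box {g : ℝ × ℝ × ℝ → ℂ} (hg : Continuous g) (T : ℝ) :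
    ∃ C, ∀ᵐ y ∂(circleMeasure.prod (boxMeasure T)), ‖g y‖ ≤ C := by
  obtain ⟨C, hC⟩ := (isCompact_Icc.prod (isCompact_Icc.prod isCompact_Icc) :
    IsCompact (Set.Icc (-(Real.pi / 2)) (Real.pi / 2) ×ˢ
      (Set.Icc (-T) T ×ˢ Set.Icc (-Real.pi) Real.pi))).exists_bound_of_continuousOn hg.continuousOn
  refine ⟨C, ?_⟩
  filter_upwards [Measure.quasiMeasurePreserving_snd.ae (ae_boxMeasure_mem T),
    Measure.quasiMeasurePreserving_fst.ae ae_circleMeasure] with y h1 h2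
  exact hC y ⟨h2, h1⟩

section
variable {lam : ℂ} {φ : ℝ × ℝ → ℂ} {T : ℝ}

theorem aestronglyMeasurable_jointF (hφ : IsSection lam φ) {g : (ℝ × ℝ) × ℝ × ℝ → ℂ}
    (hg : IsFourierAmplitude T g) :
    Continuous (fun y : ℝ × ℝ × ℝ => φ (unitVec y.1) * g (unitVec y.1, y.2)) :=
  (hφ.contDiff_unitVec.continuous.comp continuous_fst).mul hg.continuous_circle

theorem integrable_jointF (hφ : IsSection lam φ) {g : (ℝ × ℝ) × ℝ × ℝ → ℂ}
    (hg : IsFourierAmplitude T g) {σ : ℝ} (hσ : -1 < σ) :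
    Integrable (fun y : ℝ × ℝ × ℝ => ‖φ (unitVec y.1) * g (unitVec y.1, y.2)‖ *
      |kap y.2.1 y.2.2| ^ σ) (circleMeasure.prod (boxMeasure (T + 1))) := by
  have hc := aestronglyMeasurable_jointF hφ hg
  obtain ⟨C, hC⟩ := exists_bound_prod_box hc (T + 1)
  exact integrable_norm_mul_rpow hc.aestronglyMeasurable hC
    ((integrable_abs_kap_rpow_box hσ (T + 1)).comp_snd circleMeasure)

theorem integrable_mul_intF (δ : ℤˣ) (hφ : IsSection lam φ) {g : (ℝ × ℝ) × ℝ × ℝ → ℂ}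
    (hg : IsFourierAmplitude T g) {μ : ℂ} (hμ : -1 < μ.re) :
    Integrable (fun α => φ (unitVec α) * intF δ T (unitVec α) g μ) circleMeasure :=
  (integral_param_eq (n := circleMeasure) (m := boxMeasure (T + 1))
    (c := fun α => φ (unitVec α)) (κ := fun y : ℝ × ℝ × ℝ => kap y.2.1 y.2.2)
    (ev := fun (g : (ℝ × ℝ) × ℝ × ℝ → ℂ) (y : ℝ × ℝ × ℝ) => g (unitVec y.1, y.2))
    (measurable_kap.comp measurable_snd)
    (aestronglyMeasurable_jointF hφ hg).aestronglyMeasurable (integrable_jointF hφ hg hμ)).1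

theorem shiftFamily_jointF (δ : ℤˣ) (hφ : IsSection lam φ) :
    ShiftFamily δ opF (fun _ => 0)
      (fun g μ => ∫ α, φ (unitVec α) * intF δ T (unitVec α) g μ ∂circleMeasure)
      (IsFourierAmplitude T) :=
  ShiftFamily.integral_param (n := circleMeasure) (m := boxMeasure (T + 1))
    (c := fun α => φ (unitVec α)) (κ := fun y : ℝ × ℝ × ℝ => kap y.2.1 y.2.2)
    (ev := fun (g : (ℝ × ℝ) × ℝ × ℝ → ℂ) (y : ℝ × ℝ × ℝ) => g (unitVec y.1, y.2))
    (measurable_kap.comp measurable_snd) (fun _ hg => hg.op)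
    (fun _ _ => IsFourierAmplitude.zero T)
    (fun _ hg => (aestronglyMeasurable_jointF hφ hg).aestronglyMeasurable)
    (fun _ hg _ hσ => integrable_jointF hφ hg hσ) _ (fun _ _ _ => rfl)
    (fun g hg μ hμ => Eventually.of_forall fun α =>
      (shiftFamily_intF δ T (unitVec_ne_zero α)).eqn g hg μ hμ)

variable {H : ℝ × ℝ × ℝ → ℂ}

theorem continuous_density (hH : ContDiff ℝ ∞ H) :
    Continuous fun s : ℝ × ℝ => ((Real.cosh s.1 : ℝ) : ℂ) * H (deSitterParam s) := by
  have : Continuous fun s : ℝ × ℝ => ((Real.cosh s.1 * Real.cos s.2,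
    Real.cosh s.1 * Real.sin s.2, Real.sinh s.1) : ℝ × ℝ × ℝ) := by fun_prop
  exact (Complex.continuous_ofReal.comp (by fun_prop)).mul (hH.continuous.comp this)

theorem continuous_jointP (hH : ContDiff ℝ ∞ H) {g : (ℝ × ℝ) × ℝ → ℂ}
    (hg : IsPoissonAmplitude g) : Continuous (fun y : (ℝ × ℝ) × ℝ =>
      ((Real.cosh y.1.1 : ℝ) : ℂ) * H (deSitterParam y.1) * g y) :=
  ((continuous_density hH).comp continuous_fst).mul hg.smooth.continuous

theorem integrable_jointP (hH : ContDiff ℝ ∞ H) {g : (ℝ × ℝ) × ℝ → ℂ}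
    (hg : IsPoissonAmplitude g) {σ : ℝ} (hσ : -1 < σ) :
    Integrable (fun y : (ℝ × ℝ) × ℝ =>
      ‖((Real.cosh y.1.1 : ℝ) : ℂ) * H (deSitterParam y.1) * g y‖ * |kapCircle y| ^ σ)
      ((boxMeasure T).prod circleMeasure) := by
  have hc := continuous_jointP hH hg
  obtain ⟨C, hC⟩ := exists_bound_box_prod hc T
  exact integrable_norm_mul_rpow hc.aestronglyMeasurable hC
    (integrable_abs_kap_rpow_box_prod_circle hσ T)

theorem integral_mul_intP (δ : ℤˣ) (hH : ContDiff ℝ ∞ H) {g : (ℝ × ℝ) × ℝ → ℂ}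
    (hg : IsPoissonAmplitude g) {μ : ℂ} (hμ : -1 < μ.re) :
    Integrable (fun s => ((Real.cosh s.1 : ℝ) : ℂ) * H (deSitterParam s) * intP δ s g μ)
      (boxMeasure T) ∧
    ∫ s, ((Real.cosh s.1 : ℝ) : ℂ) * H (deSitterParam s) * intP δ s g μ ∂boxMeasure T =
      ∫ y, ((Real.cosh y.1.1 : ℝ) : ℂ) * H (deSitterParam y.1) * g y *
        signedPow δ μ (kapCircle y) ∂((boxMeasure T).prod circleMeasure) :=
  integral_param_eq (n := boxMeasure T) (m := circleMeasure)
    (c := fun s => ((Real.cosh s.1 : ℝ) : ℂ) * H (deSitterParam s)) (κ := kapCircle)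
    (ev := fun (g : (ℝ × ℝ) × ℝ → ℂ) (y : (ℝ × ℝ) × ℝ) => g y)
    contDiff_kapCircle.continuous.measurable
    (continuous_jointP hH hg).aestronglyMeasurable (integrable_jointP hH hg hμ)

theorem shiftFamily_jointP (δ : ℤˣ) (hH : ContDiff ℝ ∞ H) :
    ShiftFamily δ opA opB (fun g μ => ∫ s, ((Real.cosh s.1 : ℝ) : ℂ) * H (deSitterParam s) *
      intP δ s g μ ∂boxMeasure T) IsPoissonAmplitude :=
  ShiftFamily.integral_param (n := boxMeasure T) (m := circleMeasure)
    (c := fun s => ((Real.cosh s.1 : ℝ) : ℂ) * H (deSitterParam s)) (κ := kapCircle)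
    (ev := fun (g : (ℝ × ℝ) × ℝ → ℂ) (y : (ℝ × ℝ) × ℝ) => g y)
    contDiff_kapCircle.continuous.measurable (fun _ hg => hg.op_A) (fun _ hg => hg.op_B)
    (fun _ hg => (continuous_jointP hH hg).aestronglyMeasurable)
    (fun _ hg _ hσ => integrable_jointP hH hg hσ) _ (fun _ _ _ => rfl)
    (fun g hg μ hμ => Eventually.of_forall fun s => (shiftFamily_intP δ s).eqn g hg μ hμ)

/-- Both sides are the same absolutely convergent integral over the product of the box and the
circle, taken in the two orders. -/
theorem jointF_eq_jointP (δ : ℤˣ) (hH : ContDiff ℝ ∞ H) (hT : ∀ p, T < |p.2.2| → H p = 0)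
    (hφ : IsSection lam φ) {μ : ℂ} (hμ : -1 < μ.re) :
    ∫ α, φ (unitVec α) * intF δ T (unitVec α) (testAmplitude H) μ ∂circleMeasure =
      ∫ s, ((Real.cosh s.1 : ℝ) : ℂ) * H (deSitterParam s) *
        intP δ s (sectionAmplitude φ) μ ∂boxMeasure (T + 1) := by
  have hg := hφ.isPoissonAmplitude
  rw [(integral_mul_intP δ hH hg hμ).2, integral_prod_symm _
    (integrable_mul_signedPow (continuous_jointP hH hg).aestronglyMeasurable
      contDiff_kapCircle.continuous.measurable δ (integrable_jointP hH hg hμ))]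
  refine integral_congr_ae (Eventually.of_forall fun α => ?_)
  simp only
  rw [← (intF_testAmplitude δ hH hT α hμ).2, ← integral_const_mul]
  refine integral_congr_ae (Eventually.of_forall fun s => ?_)
  simp only [sectionAmplitude, kapCircle]
  ring

/-- The duality of the two transforms. -/
theorem integral_fourierSection_mul (δ : ℤˣ) (hH : ContDiff ℝ ∞ H)
    (hT : ∀ p, T < |p.2.2| → H p = 0) (hφ : IsSection (2 - lam) φ) (hlam : -lam / 2 ∈ nonPole) :
    Integrable (fun p : deSitter => H p * pullback (holographic δ φ (-lam / 2)) p)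
      deSitterMeasure ∧
    ∫ ζ : ℝ, fourierSection δ T H (-lam / 2) (ζ, 1) * φ (ζ, 1) =
      ∫ p : deSitter, H p * pullback (holographic δ φ (-lam / 2)) p ∂deSitterMeasure := by
  have hgF := isFourierAmplitude_testAmplitude hH hT
  have hgP := hφ.isPoissonAmplitude
  have e : (fun s : ℝ × ℝ => ((Real.cosh s.1 : ℝ) : ℂ) * (H (deSitterParam s) *
      pullback (holographic δ φ (-lam / 2)) (deSitterParam s))) =ᵐ[chartMeasure] fun s =>
      ((Real.cosh s.1 : ℝ) : ℂ) * H (deSitterParam s) *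
        continuation δ opA opB (intP δ s) (sectionAmplitude φ) (-lam / 2) := by
    filter_upwards [ae_chartMeasure] with s hs
    rw [pullback_holographic, deSitterCoord_deSitterParam hs, mul_assoc]
  have hz : ∀ s : ℝ × ℝ, T + 1 < |s.1| → ((Real.cosh s.1 : ℝ) : ℂ) * H (deSitterParam s) *
        continuation δ opA opB (intP δ s) (sectionAmplitude φ) (-lam / 2) = 0 := by
    intro s hs
    rw [test_eq_zero hT hs]
    ring
  -- The pairing with the continued Poisson transform is the continuation of the pairing, and
  -- likewise for the Fourier transform.
  obtain ⟨iP, eP⟩ := ShiftFamily.integral_continuation (n := boxMeasure (T + 1)) (ε := δ)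
    (c := fun s => ((Real.cosh s.1 : ℝ) : ℂ) * H (deSitterParam s)) (J := fun s => intP δ s)
    (fun _ hg => hg.op_A) (fun _ hg => hg.op_B)
    (fun _ hg _ hμ => (integral_mul_intP δ hH hg hμ).1) hgP (-lam / 2)
  obtain ⟨-, eF⟩ := ShiftFamily.integral_continuation (n := circleMeasure) (ε := δ)
    (B := fun _ => 0)
    (c := fun α => φ (unitVec α)) (J := fun α => intF δ T (unitVec α))
    (fun _ hg => hg.op) (fun _ _ => IsFourierAmplitude.zero T)
    (fun _ hg _ hμ => integrable_mul_intF δ hφ hg hμ) hgF (-lam / 2)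
  constructor
  · rw [integrable_deSitter_iff, integrable_congr e, integrable_chart_iff_box hz]
    exact iP
  · rw [integral_deSitter, integral_congr_ae e, integral_chart_eq_box hz, eP,
      (pairing_eq_circle (isSection_fourierSection δ hH hT hlam) hφ).2]
    simp only [fourierSection, normSq_unitVec, Complex.ofReal_one, Complex.one_cpow, one_mul]
    rw [eF]
    -- The two continuations come from different operators, but the integrals agree for `-1 < Re μ`,
    -- hence everywhere off the poles.
    exact (shiftFamily_jointF δ hφ).continuation_unique (shiftFamily_jointP δ hH) hgF hgP
      (fun μ hμ => jointF_eq_jointP δ hH hT hφ hμ) hlam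

end

theorem isFourierTransform_fourierSection (ε : ℤˣ) {H : ℝ × ℝ × ℝ → ℂ} {T : ℝ}
    (hH : ContDiff ℝ ∞ H) (hT : ∀ p, T < |p.2.2| → H p = 0) {lam : ℂ}
    (hlam : -lam / 2 ∈ nonPole) :
    IsFourierTransform ε lam (fun p : deSitter => H p)
      (fourierSection (-ε) T H (-lam / 2)) := by
  refine ⟨isSection_fourierSection (-ε) hH hT hlam, fun φ hφ => ?_⟩
  obtain ⟨h1, h2⟩ := integral_fourierSection_mul (-ε) hH hT hφ hlam
  -- The Poisson transform at `2 - lam` has kernel exponent `-lam / 2`, and `H_μ^ε` uses the kernel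
  -- of sign `-ε`.
  have e : (2 - lam) / 2 - 1 = -lam / 2 := by ring
  refine ⟨_, ⟨holographic (-ε) φ (-lam / 2), ?_, rfl⟩, h1, h2⟩
  have := isHolographic_holographic ε hφ (by rwa [e])
  rwa [e] at this

/-! ## Uniqueness of the Fourier transform -/

theorem IsSection.sub {lam : ℂ} {F G : ℝ × ℝ → ℂ} (hF : IsSection lam F) (hG : IsSection lam G) :
    IsSection lam (F - G) :=
  ⟨hF.smooth.sub hG.smooth, fun t v ht hv => by
    rw [Pi.sub_apply, Pi.sub_apply, hF.homogeneous t v ht hv, hG.homogeneous t v ht hv, mul_sub]⟩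

/-- The section of the dual bundle that pairs with `G` to the squared norm of `G`. -/
theorem IsSection.conj_dual {lam : ℂ} {G : ℝ × ℝ → ℂ} (hG : IsSection lam G) :
    IsSection (2 - lam) fun v => (normSq v : ℂ) ^ ((lam + starRingEnd ℂ lam) / 2 - 1) *
      starRingEnd ℂ (G v) := by
  refine ⟨?_, fun t v ht hv => ?_⟩
  · refine ContDiffOn.mul (fun v hv => (contDiffAt_normSq_cpow _ hv).contDiffWithinAt) ?_
    exact Complex.conjCLE.contDiff.comp_contDiffOn hG.smooth
  · have hn := normSq_pos hv
    have ht' : 0 < |t| := abs_pos.2 ht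
    have hn' : normSq (t • v) = |t| * |t| * normSq v := by
      rw [normSq_smul, ← sq_abs, sq]
    have hconj : starRingEnd ℂ (((|t| : ℝ) : ℂ) ^ (-lam)) =
        ((|t| : ℝ) : ℂ) ^ (-starRingEnd ℂ lam) := by
      rw [ofReal_cpow_exp ht', ofReal_cpow_exp ht', ← Complex.exp_conj, map_mul,
        Complex.conj_ofReal, map_neg]
    rw [hG.homogeneous t v ht hv, map_mul, hconj, hn', Complex.ofReal_mul,
      Complex.mul_cpow_ofReal_nonneg (by positivity) hn.le, Complex.ofReal_mul,
      Complex.mul_cpow_ofReal_nonneg (abs_nonneg _) (abs_nonneg _)]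
    have h0 : ((|t| : ℝ) : ℂ) ≠ 0 := by exact_mod_cast ht'.ne'
    have h1 : ((|t| : ℝ) : ℂ) ^ ((lam + starRingEnd ℂ lam) / 2 - 1) *
        ((|t| : ℝ) : ℂ) ^ ((lam + starRingEnd ℂ lam) / 2 - 1) *
        ((|t| : ℝ) : ℂ) ^ (-starRingEnd ℂ lam) = ((|t| : ℝ) : ℂ) ^ (-(2 - lam)) := by
      rw [← Complex.cpow_add _ _ h0, ← Complex.cpow_add _ _ h0]
      congr 1
      ring
    linear_combination ((normSq v : ℂ) ^ ((lam + starRingEnd ℂ lam) / 2 - 1) *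
      starRingEnd ℂ (G v)) * h1

theorem IsSection.eq_zero_of_circle {lam : ℂ} {G : ℝ × ℝ → ℂ} (hG : IsSection lam G)
    (h : ∀ α ∈ Set.Ioc (-(Real.pi / 2)) (Real.pi / 2), G (unitVec α) = 0) {v : ℝ × ℝ}
    (hv : v ≠ 0) : G v = 0 := by
  obtain ⟨r, α, hr, hα, rfl⟩ := exists_eq_smul_unitVec hv
  rw [hG.homogeneous r _ hr.ne' (unitVec_ne_zero α)]
  suffices hs : G (unitVec α) = 0 by rw [hs, mul_zero]
  rcases le_or_gt α (-(Real.pi / 2)) with h1 | h1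
  · have := h (α + Real.pi) ⟨by linarith [hα.1], by linarith⟩
    rwa [unitVec_add_pi, hG.neg (unitVec_ne_zero α)] at this
  rcases le_or_gt α (Real.pi / 2) with h2 | h2
  · exact h α ⟨h1, h2⟩
  · have h3 := h (α - Real.pi) ⟨by linarith, by linarith [hα.2]⟩
    have h4 := unitVec_add_pi (α - Real.pi)
    rw [sub_add_cancel] at h4
    rwa [h4, hG.neg (unitVec_ne_zero _)]

/-- Pair the difference `G` with the dual section of `IsSection.conj_dual`: the result is both zero
and the integral of `|G|²` over the circle. Continuity and homogeneity then give `G = 0` off the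
origin. -/
theorem IsFourierTransform.unique {ε : ℤˣ} {lam : ℂ} {h : deSitter → ℂ} {F F' : ℝ × ℝ → ℂ}
    (hF : IsFourierTransform ε lam h F) (hF' : IsFourierTransform ε lam h F') {v : ℝ × ℝ}
    (hv : v ≠ 0) : F v = F' v := by
  have hG := hF.1.sub hF'.1
  have hφ := hG.conj_dual
  obtain ⟨u, hu, -, e⟩ := hF.2 _ hφ
  obtain ⟨u', hu', -, e'⟩ := hF'.2 _ hφ
  rw [hu.unique hu', ← e'] at e
  obtain ⟨i1, c1⟩ := pairing_eq_circle hF.1 hφ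
  obtain ⟨i2, c2⟩ := pairing_eq_circle hF'.1 hφ
  obtain ⟨-, c⟩ := pairing_eq_circle hG hφ
  have h0 : ∫ α, ((‖(F - F') (unitVec α)‖ ^ 2 : ℝ) : ℂ) ∂circleMeasure = 0 := by
    refine Eq.trans ?_ (c.symm.trans ?_)
    · refine integral_congr_ae (Eventually.of_forall fun α => ?_)
      simp only [normSq_unitVec, Complex.ofReal_one, Complex.one_cpow, one_mul]
      rw [mul_comm, Complex.mul_conj, Complex.normSq_eq_norm_sq]
    · simp only [Pi.sub_apply F F', sub_mul] at i1 i2 e ⊢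
      rw [integral_sub i1 i2, e, sub_self]
  rw [integral_complex_ofReal, Complex.ofReal_eq_zero, circleMeasure] at h0
  have hc : Continuous fun α => ‖(F - F') (unitVec α)‖ ^ 2 :=
    (hG.contDiff_unitVec.continuous.norm).pow 2
  rw [integral_eq_zero_iff_of_nonneg (fun α => by positivity)
    (hc.integrableOn_Icc.mono_set Set.Ioc_subset_Icc_self)] at h0
  have hpi : -(Real.pi / 2) ≠ Real.pi / 2 := by
    have := Real.pi_pos
    intro h; linarith
  have hz := Measure.eqOn_Ioc_of_ae_eq volume h0 hc.continuousOn continuousOn_const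
  refine sub_eq_zero.1 (hG.eq_zero_of_circle (fun α hα => ?_) hv)
  have := hz hα
  simpa using this

/-! ## The first part of the proposition -/

theorem exists_isFourierTransform (ε : ℤˣ) {lam : ℂ} (hlam : ∀ n : ℕ, lam ≠ 2 * ((n : ℂ) + 1))
    {h : deSitter → ℂ} (hh : IsTestFunction h) : ∃ F, IsFourierTransform ε lam h F := by
  obtain ⟨H, T, hH, hT, rfl⟩ := hh.exists_support
  exact ⟨_, isFourierTransform_fourierSection ε hH hT (neg_half_mem_nonPole hlam)⟩

theorem IsFourierTransform.hasContinuedIntegral {ε : ℤˣ} {lam : ℂ}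
    (hlam : ∀ n : ℕ, lam ≠ 2 * ((n : ℂ) + 1)) {h : deSitter → ℂ} (hh : IsTestFunction h)
    {F : ℝ × ℝ → ℂ} (hF : IsFourierTransform ε lam h F) {v : ℝ × ℝ} (hv : v ≠ 0) :
    HasContinuedIntegral deSitterMeasure {ν | ν.re < 2}
      (fun ν p => pulledKernel (-ε) (-ν / 2) p v * h p) lam (F v) := by
  obtain ⟨H, T, hH, hT, rfl⟩ := hh.exists_support
  have hl := neg_half_mem_nonPole hlam
  rw [hF.unique (isFourierTransform_fourierSection ε hH hT hl) hv]
  exact hasContinuedIntegral_fourierSection (-ε) hH hT hv hl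

/-! ## The hyperfunction pairing -/

/-- With `u = t - x₀`, the integrand is `π⁻¹` times `δ + (1 - δ²) * δ / (u² + δ²)`, whose last
fraction has primitive `arctan (u / δ)`. -/
theorem integral_peak_eq {x₀ δ : ℝ} (hδ : 0 < δ) :
    ∫ t in Set.Icc (x₀ - 1) (x₀ + 1), Real.pi⁻¹ * (δ * (1 + (t - x₀) ^ 2) / ((t - x₀) ^ 2 + δ ^ 2)) =
      Real.pi⁻¹ * (2 * δ + (1 - δ ^ 2) * (2 * Real.arctan δ⁻¹)) := by
  have hd : ∀ t : ℝ, HasDerivAt (fun t => Real.pi⁻¹ * (δ * (t - x₀) +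
      (1 - δ ^ 2) * Real.arctan ((t - x₀) / δ)))
      (Real.pi⁻¹ * (δ * (1 + (t - x₀) ^ 2) / ((t - x₀) ^ 2 + δ ^ 2))) t := by
    intro t
    have h0 : HasDerivAt (fun t : ℝ => t - x₀) 1 t := (hasDerivAt_id t).sub_const x₀
    have h1 := ((h0.const_mul δ).add (((h0.div_const δ).arctan).const_mul (1 - δ ^ 2))).const_mul
      Real.pi⁻¹
    refine h1.congr_deriv ?_
    field_simp
    ring
  have hc : Continuous fun t : ℝ =>
      Real.pi⁻¹ * (δ * (1 + (t - x₀) ^ 2) / ((t - x₀) ^ 2 + δ ^ 2)) := by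
    refine continuous_const.mul (Continuous.div (by fun_prop) (by fun_prop) fun t => ?_)
    positivity
  rw [integral_Icc_eq_integral_Ioc, ← intervalIntegral.integral_of_le (by linarith),
    intervalIntegral.integral_eq_sub_of_hasDerivAt (fun t _ => hd t) (hc.intervalIntegrable _ _)]
  rw [show x₀ + 1 - x₀ = 1 by ring, show x₀ - 1 - x₀ = -1 by ring, neg_div, Real.arctan_neg,
    one_div]
  ring

/-- The Poisson kernel is an approximate identity. As `g` is only integrable against `1 / (1 + (t -
x₀)²)`, that weight is moved to `g` and the kernel is multiplied by its inverse. -/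
theorem tendsto_integral_poissonKernel {g : ℝ → ℂ} {x₀ : ℝ}
    (hg : Integrable fun t => (1 + (t - x₀) ^ 2)⁻¹ • g t) (hc : ContinuousAt g x₀) :
    Tendsto (fun δ : ℝ => ∫ t, (δ / ((t - x₀) ^ 2 + δ ^ 2)) • g t) (𝓝[>] 0)
      (𝓝 (Real.pi • g x₀)) := by
  have key := tendsto_integral_peak_smul_of_integrable_of_tendsto (μ := volume) (x₀ := x₀)
    (l := 𝓝[>] (0 : ℝ)) (a := g x₀)
    (φ := fun δ t => Real.pi⁻¹ * (δ * (1 + (t - x₀) ^ 2) / ((t - x₀) ^ 2 + δ ^ 2)))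
    (t := Set.Icc (x₀ - 1) (x₀ + 1)) measurableSet_Icc
    (Icc_mem_nhds (by linarith) (by linarith)) (by simp) ?_ ?_ ?_ ?_ hg ?_
  · refine (key.const_smul Real.pi).congr' ?_
    filter_upwards [self_mem_nhdsWithin] with δ hδ
    rw [← integral_smul]
    refine integral_congr_ae (Eventually.of_forall fun t => ?_)
    simp only [smul_smul]
    congr 1
    have h1 : 1 + (t - x₀) ^ 2 ≠ 0 := by positivity
    have := Real.pi_pos.ne'
    field_simp
  · filter_upwards [self_mem_nhdsWithin] with δ hδ t
    have : (0 : ℝ) < δ := hδ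
    have := Real.pi_pos
    positivity
  · intro u hu hx
    obtain ⟨r, hr, hru⟩ := Metric.isOpen_iff.1 hu _ hx
    rw [Metric.tendstoUniformlyOn_iff]
    intro e he
    have hlim : Tendsto (fun δ : ℝ => Real.pi⁻¹ * (δ * (1 + (r ^ 2)⁻¹))) (𝓝[>] 0) (𝓝 0) := by
      have : Continuous fun δ : ℝ => Real.pi⁻¹ * (δ * (1 + (r ^ 2)⁻¹)) := by fun_prop
      have h := this.tendsto 0
      simp only [zero_mul, mul_zero] at h
      exact h.mono_left nhdsWithin_le_nhds
    filter_upwards [hlim.eventually (gt_mem_nhds he), self_mem_nhdsWithin] with δ h1 hδ t ht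
    have hδ' : (0 : ℝ) < δ := hδ
    have hpi := Real.pi_pos
    rw [Pi.zero_apply, dist_zero_left, Real.norm_of_nonneg (by positivity)]
    refine lt_of_le_of_lt ?_ h1
    have h2 : r ≤ |t - x₀| := by
      by_contra h
      exact ht (hru (by rw [Metric.mem_ball, Real.dist_eq]; linarith))
    have h3 : r ^ 2 ≤ (t - x₀) ^ 2 := by
      rw [← sq_abs (t - x₀)]
      exact pow_le_pow_left₀ hr.le h2 2
    have h4 : 0 < (t - x₀) ^ 2 := lt_of_lt_of_le (by positivity) h3
    -- For `|t - x₀| ≥ r` the weighted kernel is at most `π⁻¹ * δ * (1 + r⁻²)`, uniformly in `t`.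
    rw [mul_div_assoc]
    refine mul_le_mul_of_nonneg_left (mul_le_mul_of_nonneg_left ?_ hδ'.le) (by positivity)
    rw [div_le_iff₀ (by positivity)]
    have h5 : 1 ≤ (r ^ 2)⁻¹ * (t - x₀) ^ 2 := by
      rw [inv_mul_eq_div, le_div_iff₀ (by positivity)]
      linarith
    have h6 : 0 ≤ (1 + (r ^ 2)⁻¹) * δ ^ 2 := by positivity
    linarith
  · have h1 : Tendsto (fun δ : ℝ => Real.pi⁻¹ * (2 * δ + (1 - δ ^ 2) * (2 * Real.arctan δ⁻¹)))
        (𝓝[>] 0) (𝓝 (Real.pi⁻¹ * (2 * 0 + (1 - 0 ^ 2) * (2 * (Real.pi / 2))))) := by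
      have h2 : Tendsto (fun δ : ℝ => δ) (𝓝[>] 0) (𝓝 0) := nhdsWithin_le_nhds
      have h3 : Tendsto (fun δ : ℝ => Real.arctan δ⁻¹) (𝓝[>] 0) (𝓝 (Real.pi / 2)) :=
        (tendsto_nhds_of_tendsto_nhdsWithin Real.tendsto_arctan_atTop).comp
          tendsto_inv_nhdsGT_zero
      exact ((h2.const_mul 2).add (((h2.pow 2).const_sub 1).mul (h3.const_mul 2))).const_mul _
    have h4 : Real.pi⁻¹ * (2 * 0 + (1 - 0 ^ 2) * (2 * (Real.pi / 2))) = 1 := by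
      have := Real.pi_pos.ne'
      field_simp
      ring
    rw [h4] at h1
    refine h1.congr' ?_
    filter_upwards [self_mem_nhdsWithin] with δ hδ
    exact (integral_peak_eq hδ).symm
  · refine Eventually.of_forall fun δ => Measurable.aestronglyMeasurable ?_
    fun_prop
  · have h1 : ContinuousAt (fun t : ℝ => (1 + (t - x₀) ^ 2)⁻¹ • g t) x₀ := by
      have h2 : ContinuousAt (fun t : ℝ => 1 + (t - x₀) ^ 2) x₀ := by fun_prop
      exact (h2.inv₀ (by positivity)).smul hc
    simpa [ContinuousAt] using h1

/-- `-1 < σ` gives integrability at the origin and `σ < 0` at infinity; this is the strip `-1 < Re μ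
< 0`. -/
theorem integrable_abs_rpow_div {σ : ℝ} (h : -1 < σ) (h0 : σ < 0) :
    Integrable fun t : ℝ => |t| ^ σ * (1 + |t|)⁻¹ := by
  have hm : AEStronglyMeasurable (fun t : ℝ => |t| ^ σ * (1 + |t|)⁻¹) volume :=
    ((continuous_abs.measurable.pow_const σ).mul
      (by fun_prop : Measurable fun t : ℝ => (1 + |t|)⁻¹)).aestronglyMeasurable
  have h1 : IntegrableOn (fun t : ℝ => |t| ^ σ * (1 + |t|)⁻¹) (Set.Ioi 0) := by
    rw [← Set.Ioc_union_Ioi_eq_Ioi zero_le_one, integrableOn_union]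
    constructor
    · refine Integrable.mono' ((intervalIntegrable_iff_integrableOn_Ioc_of_le zero_le_one).1
        (intervalIntegrable_abs_rpow h 0 1)) hm.restrict (Eventually.of_forall fun t => ?_)
      rw [Real.norm_of_nonneg (by positivity)]
      refine mul_le_of_le_one_right (by positivity) (inv_le_one_of_one_le₀ ?_)
      linarith [abs_nonneg t]
    · refine Integrable.mono' (integrableOn_Ioi_rpow_of_lt (a := σ - 1) (by linarith) one_pos)
        hm.restrict ?_
      filter_upwards [ae_restrict_mem measurableSet_Ioi] with t ht
      have ht0 : (0 : ℝ) < t := lt_trans one_pos ht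
      rw [Real.norm_of_nonneg (by positivity), abs_of_pos ht0, Real.rpow_sub ht0, Real.rpow_one,
        div_eq_mul_inv]
      gcongr
      linarith
  have h2 : IntegrableOn (fun t : ℝ => |t| ^ σ * (1 + |t|)⁻¹) (Set.Iic 0) := by
    have h3 := (integrableOn_Ici_iff_integrableOn_Ioi).2 h1
    have h4 : IntegrableOn (fun t : ℝ => |t| ^ σ * (1 + |t|)⁻¹) (Set.Ici (-0)) := by
      rwa [neg_zero]
    have := h4.comp_neg_Iic
    simpa using this
  rw [← integrableOn_univ, ← Set.Iic_union_Ioi (a := (0 : ℝ))]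
  exact h2.union h1

theorem integrable_signedPow_mul {ε : ℤˣ} {μ : ℂ} (h : -1 < μ.re) (h0 : μ.re < 0) {k : ℝ → ℂ}
    (hk : Measurable k) {C : ℝ} (hC : ∀ t, ‖k t‖ * (1 + |t|) ≤ C) :
    Integrable fun t : ℝ => signedPow ε μ t * k t := by
  refine ((integrable_abs_rpow_div h h0).const_mul C).mono'
    ((measurable_signedPow ε μ).mul hk).aestronglyMeasurable (Eventually.of_forall fun t => ?_)
  have ht : 0 < 1 + |t| := by positivity
  rw [norm_mul]
  calc ‖signedPow ε μ t‖ * ‖k t‖ ≤ |t| ^ μ.re * (C * (1 + |t|)⁻¹) := by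
        refine mul_le_mul (norm_signedPow_le _ _ _) ?_ (norm_nonneg _) (by positivity)
        rw [← div_eq_mul_inv, le_div_iff₀ ht]
        exact hC t
    _ = C * (|t| ^ μ.re * (1 + |t|)⁻¹) := by ring

theorem integrable_signedPow_div {ε : ℤˣ} {μ : ℂ} (h : -1 < μ.re) (h0 : μ.re < 0) {z : ℂ}
    (hz : z.im ≠ 0) : Integrable fun t : ℝ => signedPow ε μ t * ((t : ℂ) + z)⁻¹ := by
  have hm : Measurable fun t : ℝ => ((t : ℂ) + z)⁻¹ := by fun_prop
  refine integrable_signedPow_mul h h0 hm (C := 1 + (1 + ‖z‖) / |z.im|) fun t => ?_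
  have h1 : |z.im| ≤ ‖(t : ℂ) + z‖ := by
    have := Complex.abs_im_le_norm ((t : ℂ) + z)
    simpa using this
  have h2 : |t| ≤ ‖(t : ℂ) + z‖ + ‖z‖ := by
    have := norm_sub_le ((t : ℂ) + z) z
    rw [add_sub_cancel_right, Complex.norm_real] at this
    exact this
  have h3 : 0 < |z.im| := abs_pos.2 hz
  have h4 : 0 < ‖(t : ℂ) + z‖ := lt_of_lt_of_le h3 h1
  have h5 : (1 + ‖z‖) ≤ (1 + ‖z‖) / |z.im| * ‖(t : ℂ) + z‖ := by
    rw [div_mul_eq_mul_div, le_div_iff₀ h3]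
    gcongr
  rw [norm_inv, inv_mul_le_iff₀ h4]
  linarith

/-- With `1 / Q = (ζ₁ - ζ₂)⁻¹ / (t + w)`, the difference of the two shifted fractions is `-2iδ / ((t
+ w)² + δ²)` times `(ζ₁ - ζ₂)⁻¹`, a Poisson kernel at `t = -w`. The value of `t_ε^μ` there is
`w_{-ε}^μ`, whence the change of sign. -/
theorem pairingQ_eq (ε : ℤˣ) {μ : ℂ} (h : -1 < μ.re) (h0 : μ.re < 0) {v₁ v₂ v : ℝ × ℝ}
    (hB : wedge v₁ v₂ ≠ 0) (hA : wedge v₁ v * wedge v₂ v ≠ 0) :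
    pairingQ ε μ v₁ v₂ v = -(2 * (Real.pi : ℂ) * Complex.I) * ((wedge v₁ v₂ : ℝ) : ℂ)⁻¹ *
      kernelK (-ε) μ v₁ v₂ v := by
  obtain ⟨w, hw⟩ : ∃ w : ℝ, w = wedge v₁ v * wedge v₂ v / wedge v₁ v₂ := ⟨_, rfl⟩
  have hw0 : w ≠ 0 := by rw [hw]; exact div_ne_zero hA hB
  have hBc : ((wedge v₁ v₂ : ℝ) : ℂ) ≠ 0 := by exact_mod_cast hB
  have hQ : ∀ z : ℂ, kernelQ v₁ v₂ v z = ((wedge v₁ v₂ : ℝ) : ℂ) * (z + w) := by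
    intro z
    rw [kernelQ, hw]
    push_cast
    field_simp
    ring
  have hint : Integrable fun t : ℝ => (1 + (t - -w) ^ 2)⁻¹ • signedPow ε μ t := by
    have hm : Measurable fun t : ℝ => (((1 + (t - -w) ^ 2)⁻¹ : ℝ) : ℂ) := by fun_prop
    refine (integrable_signedPow_mul (ε := ε) h h0 hm (C := 2 + |w|) fun t => ?_).congr
      (Eventually.of_forall fun t => by simp only [Complex.real_smul]; ring)
    rw [Complex.norm_real, Real.norm_of_nonneg (by positivity), inv_mul_le_iff₀ (by positivity)]
    have h1 : |t| ≤ |t - -w| + |w| := by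
      have := abs_sub_abs_le_abs_sub t (-w)
      rw [abs_neg] at this
      linarith
    have h2 : |t - -w| ≤ 1 + (t - -w) ^ 2 := by
      rw [← sq_abs (t - -w)]
      nlinarith [sq_nonneg (|t - -w| - 1), abs_nonneg (t - -w)]
    have h3 : 0 ≤ |w| * (t - -w) ^ 2 := by positivity
    nlinarith [sq_nonneg (t - -w)]
  -- Continuity of the signed power at `-w` needs `w ≠ 0`, that is, neither line equal to that of
  -- `v`.
  have hlim := (tendsto_integral_poissonKernel hint
    (continuousAt_signedPow ε μ (neg_ne_zero.2 hw0))).const_mul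
      (-(2 * Complex.I) * ((wedge v₁ v₂ : ℝ) : ℂ)⁻¹)
  rw [pairingQ]
  refine Tendsto.limUnder_eq (Tendsto.congr' ?_ (hlim.trans_eq ?_))
  · filter_upwards [self_mem_nhdsWithin] with δ hδ
    have hδ' : (0 : ℝ) < δ := hδ
    have e1 : ∀ z : ℂ, (fun t : ℝ => signedPow ε μ t / kernelQ v₁ v₂ v (t + z)) =
        fun t : ℝ => ((wedge v₁ v₂ : ℝ) : ℂ)⁻¹ * (signedPow ε μ t * ((t : ℂ) + (z + w))⁻¹) := by
      intro z
      funext t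
      rw [hQ, div_eq_mul_inv, mul_inv, add_assoc]
      ring
    have i1 := integrable_signedPow_div (ε := ε) h h0 (z := δ * Complex.I + w)
      (by simpa using hδ'.ne')
    have i2 := integrable_signedPow_div (ε := ε) h h0 (z := -(δ * Complex.I) + w)
      (by simpa using hδ'.ne')
    have e2 : (fun t : ℝ => signedPow ε μ t / kernelQ v₁ v₂ v (t - δ * Complex.I)) =
        fun t : ℝ => signedPow ε μ t / kernelQ v₁ v₂ v (t + -(δ * Complex.I)) := by
      simp only [sub_eq_add_neg]
    rw [e2, e1, e1, ← integral_sub (i1.const_mul _) (i2.const_mul _), ← integral_const_mul]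
    refine integral_congr_ae (Eventually.of_forall fun t => ?_)
    have n1 : (t : ℂ) + (δ * Complex.I + w) ≠ 0 := by
      intro h'
      have := congrArg Complex.im h'
      simp at this
      exact hδ'.ne' this
    have n2 : (t : ℂ) + (-(δ * Complex.I) + w) ≠ 0 := by
      intro h'
      have := congrArg Complex.im h'
      simp at this
      exact hδ'.ne' this
    have n3 : (((t - -w) ^ 2 + δ ^ 2 : ℝ) : ℂ) =
        ((t : ℂ) + (δ * Complex.I + w)) * ((t : ℂ) + (-(δ * Complex.I) + w)) := by
      push_cast
      linear_combination ((δ : ℂ) ^ 2) * Complex.I_sq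
    have n4 : (t : ℂ) + (-(δ * Complex.I) + w) =
        (t : ℂ) + (δ * Complex.I + w) - 2 * (δ * Complex.I) := by ring
    simp only [Complex.real_smul, Complex.ofReal_div, n3]
    rw [n4] at n2 ⊢
    generalize (t : ℂ) + (δ * Complex.I + w) = a at n1 n2 ⊢
    obtain ⟨b, hb⟩ : ∃ b, b = a - 2 * (δ * Complex.I) := ⟨_, rfl⟩
    rw [← hb] at n2 ⊢
    field_simp
    rw [hb]
    ring
  · rw [kernelK, ← hw, signedPow_neg_right]
    simp only [Complex.real_smul]
    congr 1
    ring

/-! ## Bruhat coordinates on the de Sitter space -/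

/-- The coordinate `y - z` in terms of `(t, θ)`; it vanishes where `g P` or `g w P` is the point at
infinity. -/
noncomputable def bruhatDenom (s : ℝ × ℝ) : ℝ :=
  Real.cosh s.1 * Real.sin s.2 - Real.sinh s.1

/-- The pair `(ζ₁, ζ₂)` of Bruhat coordinates of `(g P, g w P)` in terms of `(t, θ)`. -/
noncomputable def bruhat (s : ℝ × ℝ) : ℝ × ℝ :=
  ((Real.cosh s.1 * Real.cos s.2 - 1) / bruhatDenom s,
    (Real.cosh s.1 * Real.cos s.2 + 1) / bruhatDenom s)

/-- The part of the coordinate domain where both Bruhat coordinates are finite. -/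
def bruhatSource : Set (ℝ × ℝ) :=
  {s | s.2 ∈ Set.Ioc (-Real.pi) Real.pi ∧ bruhatDenom s ≠ 0}

theorem continuous_bruhatDenom : Continuous bruhatDenom := by unfold bruhatDenom; fun_prop

theorem measurableSet_bruhatSource : MeasurableSet bruhatSource :=
  (measurable_snd measurableSet_Ioc).inter
    (continuous_bruhatDenom.measurable (measurableSet_singleton 0).compl)

theorem ae_prod_of_forall_ae {q : ℝ × ℝ → Prop} (hq : MeasurableSet {z | q z})
    (h : ∀ x, ∀ᵐ y : ℝ, q (x, y)) : ∀ᵐ z : ℝ × ℝ, q z := by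
  rw [Measure.volume_eq_prod]
  exact (Measure.ae_prod_iff_ae_ae hq).2 (Eventually.of_forall h)

/-- For fixed `θ` the equation `tanh t = sin θ` has at most one solution; the swap puts `t` in the
inner variable of Fubini. -/
theorem ae_bruhatDenom_ne_zero : ∀ᵐ s : ℝ × ℝ, bruhatDenom s ≠ 0 := by
  have h1 : ∀ᵐ s : ℝ × ℝ, bruhatDenom s.swap ≠ 0 := by
    refine ae_prod_of_forall_ae (q := fun s => bruhatDenom s.swap ≠ 0)
      ((continuous_bruhatDenom.measurable.comp measurable_swap)
        (measurableSet_singleton 0).compl) fun θ => ?_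
    have h2 : {t : ℝ | bruhatDenom (t, θ) = 0}.Subsingleton := by
      intro t ht u hu
      rw [Set.mem_ofPred_eq, bruhatDenom, sub_eq_zero] at ht hu
      have h3 : Real.sinh (t - u) = 0 := by
        rw [Real.sinh_sub, ← ht, ← hu]
        ring
      exact sub_eq_zero.1 (Real.sinh_eq_zero.1 h3)
    have h4 := h2.measure_zero (volume : Measure ℝ)
    rw [measure_eq_zero_iff_ae_notMem] at h4
    exact h4
  have h5 : MeasurePreserving (Prod.swap : ℝ × ℝ → ℝ × ℝ) volume volume :=
    Measure.measurePreserving_swap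
  have h6 := h5.quasiMeasurePreserving.ae h1
  simpa using h6

theorem chartMeasure_eq_restrict_bruhatSource :
    chartMeasure = (volume : Measure (ℝ × ℝ)).restrict bruhatSource := by
  refine Measure.restrict_congr_set ?_
  filter_upwards [ae_bruhatDenom_ne_zero] with s hs
  refine propext ⟨fun h => ⟨h.2, hs⟩, fun h => ⟨Set.mem_univ _, h.1⟩⟩

theorem bruhat_sub {s : ℝ × ℝ} (hs : bruhatDenom s ≠ 0) :
    (bruhat s).1 - (bruhat s).2 = -2 / bruhatDenom s := by
  simp only [bruhat]
  field_simp
  ring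

/-- The difference of the two coordinates gives `y - z`, a numerator then gives `x`, and `(y - z) *
(y + z) = 1 - x²` gives `y + z`. -/
theorem injOn_bruhat : Set.InjOn bruhat bruhatSource := by
  intro s hs u hu h
  have hN : bruhatDenom s = bruhatDenom u := by
    have h1 := bruhat_sub hs.2
    rw [h, bruhat_sub hu.2] at h1
    have hs2 := hs.2
    have hu2 := hu.2
    field_simp at h1
    linarith
  have hX : Real.cosh s.1 * Real.cos s.2 = Real.cosh u.1 * Real.cos u.2 := by
    have h1 := congrArg Prod.fst h
    have hu2 := hu.2
    simp only [bruhat, hN] at h1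
    field_simp at h1
    linarith
  have e1 := Real.cosh_sq s.1
  have e2 := Real.cosh_sq u.1
  have e3 := Real.sin_sq_add_cos_sq s.2
  have e4 := Real.sin_sq_add_cos_sq u.2
  have hS : Real.cosh s.1 * Real.sin s.2 + Real.sinh s.1 =
      Real.cosh u.1 * Real.sin u.2 + Real.sinh u.1 := by
    have h1 : bruhatDenom u * (Real.cosh s.1 * Real.sin s.2 + Real.sinh s.1) =
        bruhatDenom u * (Real.cosh u.1 * Real.sin u.2 + Real.sinh u.1) := by
      nth_rewrite 1 [← hN]
      simp only [bruhatDenom]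
      linear_combination e1 - e2 + (Real.cosh s.1) ^ 2 * e3 - (Real.cosh u.1) ^ 2 * e4 -
        (Real.cosh s.1 * Real.cos s.2 + Real.cosh u.1 * Real.cos u.2) * hX
    exact mul_left_cancel₀ hu.2 h1
  simp only [bruhatDenom] at hN
  rw [← deSitterCoord_deSitterParam hs.1, ← deSitterCoord_deSitterParam hu.1]
  congr 1
  apply Subtype.ext
  simp only [deSitterParam, Prod.mk.injEq]
  exact ⟨hX, by linarith, by linarith⟩

theorem image_bruhat : bruhat '' bruhatSource = {z | z.1 ≠ z.2} := by
  ext z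
  constructor
  · rintro ⟨s, hs, rfl⟩ h
    have h1 := bruhat_sub hs.2
    rw [h, sub_self] at h1
    have hs2 := hs.2
    field_simp at h1
    norm_num at h1
  · intro h
    have h' : z.2 - z.1 ≠ 0 := sub_ne_zero.2 fun h0 => h h0.symm
    -- The point solves `y - z = 2 / (ζ₂ - ζ₁)`, `x = 1 + (y - z) * ζ₁` and the equation of the de
    -- Sitter space.
    have hp : ((z.1 + z.2) / (z.2 - z.1), (1 - z.1 * z.2) / (z.2 - z.1),
        -(1 + z.1 * z.2) / (z.2 - z.1)) ∈ deSitter := by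
      rw [deSitter, Set.mem_ofPred_eq]
      field_simp
      ring
    obtain ⟨p, hp'⟩ : ∃ p : deSitter, p.1 = ((z.1 + z.2) / (z.2 - z.1),
      (1 - z.1 * z.2) / (z.2 - z.1), -(1 + z.1 * z.2) / (z.2 - z.1)) := ⟨⟨_, hp⟩, rfl⟩
    have h1 := congrArg Subtype.val (deSitterParam_deSitterCoord p)
    rw [hp'] at h1
    simp only [deSitterParam, Prod.mk.injEq] at h1
    obtain ⟨hx, hy, hz⟩ := h1
    have hN : bruhatDenom (deSitterCoord p) = 2 / (z.2 - z.1) := by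
      rw [bruhatDenom, hy, hz]
      ring
    refine ⟨deSitterCoord p, ⟨Complex.arg_mem_Ioc _, ?_⟩, ?_⟩
    · rw [hN]
      exact div_ne_zero two_ne_zero h'
    · ext
      · simp only [bruhat, hx, hN]
        field_simp
        ring
      · simp only [bruhat, hx, hN]
        field_simp
        ring

/-- The derivative of `bruhat`. -/
noncomputable def fderivBruhat (s : ℝ × ℝ) : ℝ × ℝ →L[ℝ] ℝ × ℝ :=
  (Matrix.toLin (.finTwoProd ℝ) (.finTwoProd ℝ)
    !![(Real.sinh s.1 * Real.cos s.2 * bruhatDenom s - (Real.cosh s.1 * Real.cos s.2 - 1) *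
          (Real.sinh s.1 * Real.sin s.2 - Real.cosh s.1)) / bruhatDenom s ^ 2,
      (-(Real.cosh s.1 * Real.sin s.2) * bruhatDenom s - (Real.cosh s.1 * Real.cos s.2 - 1) *
          (Real.cosh s.1 * Real.cos s.2)) / bruhatDenom s ^ 2;
      (Real.sinh s.1 * Real.cos s.2 * bruhatDenom s - (Real.cosh s.1 * Real.cos s.2 + 1) *
          (Real.sinh s.1 * Real.sin s.2 - Real.cosh s.1)) / bruhatDenom s ^ 2,
      (-(Real.cosh s.1 * Real.sin s.2) * bruhatDenom s - (Real.cosh s.1 * Real.cos s.2 + 1) *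
          (Real.cosh s.1 * Real.cos s.2)) / bruhatDenom s ^ 2]).toContinuousLinearMap

/-- Together with `bruhat_sub` this says that `cosh t dt dθ` is `2 (ζ₁ - ζ₂)⁻² dζ₁ dζ₂`. -/
theorem det_fderivBruhat {s : ℝ × ℝ} (hs : bruhatDenom s ≠ 0) :
    (fderivBruhat s).det = 2 * Real.cosh s.1 / bruhatDenom s ^ 2 := by
  unfold fderivBruhat
  simp only [LinearMap.det_toContinuousLinearMap, LinearMap.det_toLin, Matrix.det_fin_two_of]
  have e3 := Real.sin_sq_add_cos_sq s.2
  obtain ⟨N, hN⟩ : ∃ N, N = bruhatDenom s := ⟨_, rfl⟩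
  rw [← hN] at hs ⊢
  rw [bruhatDenom] at hN
  field_simp
  generalize Real.cosh s.1 = a at *
  generalize Real.sinh s.1 = b at *
  generalize Real.cos s.2 = c at *
  generalize Real.sin s.2 = d at *
  have hN' : N ^ 2 = N * (a * d - b) := by rw [← hN]; ring
  linear_combination (-2 * b * N) * e3 - 2 * hN'

theorem hasFDerivAt_div_of_partial {F G : ℝ × ℝ → ℝ} {a b c d : ℝ} {s : ℝ × ℝ}
    (hF : HasFDerivAt F (a • ContinuousLinearMap.fst ℝ ℝ ℝ + b • ContinuousLinearMap.snd ℝ ℝ ℝ) s)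
    (hG : HasFDerivAt G (c • ContinuousLinearMap.fst ℝ ℝ ℝ + d • ContinuousLinearMap.snd ℝ ℝ ℝ) s)
    (h0 : G s ≠ 0) :
    HasFDerivAt (fun s => F s / G s)
      (((a * G s - F s * c) / G s ^ 2) • ContinuousLinearMap.fst ℝ ℝ ℝ +
        ((b * G s - F s * d) / G s ^ 2) • ContinuousLinearMap.snd ℝ ℝ ℝ) s := by
  have h1 := hF.mul ((hasDerivAt_inv h0).comp_hasFDerivAt s hG)
  simp only [div_eq_mul_inv]
  refine h1.congr_fderiv ?_
  ext <;> simp <;> field_simp <;> ring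

theorem hasFDerivAt_bruhat {s : ℝ × ℝ} (hs : bruhatDenom s ≠ 0) :
    HasFDerivAt bruhat (fderivBruhat s) s := by
  have hch := (Real.hasDerivAt_cosh s.1).comp_hasFDerivAt s (hasFDerivAt_fst (𝕜 := ℝ) (E := ℝ) (F := ℝ))
  have hsh := (Real.hasDerivAt_sinh s.1).comp_hasFDerivAt s (hasFDerivAt_fst (𝕜 := ℝ) (E := ℝ) (F := ℝ))
  have hco := (Real.hasDerivAt_cos s.2).comp_hasFDerivAt s (hasFDerivAt_snd (𝕜 := ℝ) (E := ℝ) (F := ℝ))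
  have hsi := (Real.hasDerivAt_sin s.2).comp_hasFDerivAt s (hasFDerivAt_snd (𝕜 := ℝ) (E := ℝ) (F := ℝ))
  have hX : HasFDerivAt (fun s : ℝ × ℝ => Real.cosh s.1 * Real.cos s.2)
      ((Real.sinh s.1 * Real.cos s.2) • ContinuousLinearMap.fst ℝ ℝ ℝ +
        (-(Real.cosh s.1 * Real.sin s.2)) • ContinuousLinearMap.snd ℝ ℝ ℝ) s := by
    refine (hch.mul hco).congr_fderiv ?_
    ext <;> simp [mul_comm]
  have hN : HasFDerivAt bruhatDenom
      ((Real.sinh s.1 * Real.sin s.2 - Real.cosh s.1) • ContinuousLinearMap.fst ℝ ℝ ℝ +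
        (Real.cosh s.1 * Real.cos s.2) • ContinuousLinearMap.snd ℝ ℝ ℝ) s := by
    refine ((hch.mul hsi).sub hsh).congr_fderiv ?_
    ext <;> simp [mul_comm]
  rw [fderivBruhat, Matrix.toLin_finTwoProd_toContinuousLinearMap]
  exact (hasFDerivAt_div_of_partial (hX.sub_const 1) hN hs).prodMk
    (hasFDerivAt_div_of_partial (hX.add_const 1) hN hs)

theorem ae_ne : ∀ᵐ z : ℝ × ℝ, z.1 ≠ z.2 := by
  refine ae_prod_of_forall_ae (q := fun z : ℝ × ℝ => z.1 ≠ z.2)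
    (measurableSet_eq_fun measurable_fst measurable_snd).compl fun x => ?_
  filter_upwards [Measure.ae_ne volume x] with y hy using hy.symm

theorem integrable_bruhat_iff (g : ℝ × ℝ → ℂ) : Integrable g ↔
    Integrable (fun s => (2 * Real.cosh s.1 / bruhatDenom s ^ 2) • g (bruhat s)) chartMeasure := by
  have h := integrableOn_image_iff_integrableOn_abs_det_fderiv_smul volume
    measurableSet_bruhatSource (fun s hs => (hasFDerivAt_bruhat hs.2).hasFDerivWithinAt)
    injOn_bruhat g
  have h1 : (volume : Measure (ℝ × ℝ)).restrict {z | z.1 ≠ z.2} = volume :=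
    Measure.restrict_eq_self_of_ae_mem ae_ne
  rw [image_bruhat, IntegrableOn, h1] at h
  rw [h, chartMeasure_eq_restrict_bruhatSource]
  refine integrable_congr ?_
  filter_upwards [ae_restrict_mem measurableSet_bruhatSource] with s hs
  have := Real.cosh_pos s.1
  rw [det_fderivBruhat hs.2, abs_of_nonneg (by positivity)]

theorem integral_bruhat (g : ℝ × ℝ → ℂ) : ∫ z, g z =
    ∫ s, (2 * Real.cosh s.1 / bruhatDenom s ^ 2) • g (bruhat s) ∂chartMeasure := by
  have h := integral_image_eq_integral_abs_det_fderiv_smul volume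
    measurableSet_bruhatSource (fun s hs => (hasFDerivAt_bruhat hs.2).hasFDerivWithinAt)
    injOn_bruhat g
  have h1 : (volume : Measure (ℝ × ℝ)).restrict {z | z.1 ≠ z.2} = volume :=
    Measure.restrict_eq_self_of_ae_mem ae_ne
  rw [image_bruhat, h1] at h
  rw [h, chartMeasure_eq_restrict_bruhatSource]
  refine integral_congr_ae ?_
  filter_upwards [ae_restrict_mem measurableSet_bruhatSource] with s hs
  have := Real.cosh_pos s.1
  rw [det_fderivBruhat hs.2, abs_of_nonneg (by positivity)]

/-! ## The operators `T_μ^±` and the Fourier transform -/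

theorem ae_wedge_ne_zero {v : ℝ × ℝ} (hv : v ≠ 0) : ∀ᵐ ζ : ℝ, wedge (ζ, 1) v ≠ 0 := by
  have h1 : {ζ : ℝ | wedge (ζ, 1) v = 0}.Subsingleton := by
    intro ζ hζ η hη
    rw [Set.mem_ofPred_eq] at hζ hη
    simp only [wedge] at hζ hη
    have h2 : v.2 ≠ 0 := by
      intro h2
      rw [h2] at hζ
      exact hv (Prod.ext (by simpa using hζ) h2)
    exact mul_right_cancel₀ h2 (by linarith)
  have h2 := h1.measure_zero (volume : Measure ℝ)
  rwa [measure_eq_zero_iff_ae_notMem] at h2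

/-- The closed form of the pairing fails only where two of the three lines coincide, a null set. The
constant is `(2πi)⁻² * (-2πi)`. -/
theorem ae_integrandT_eq (ε : ℤˣ) (f : ℝ × ℝ → ℝ × ℝ → ℂ) {v : ℝ × ℝ} (hv : v ≠ 0) {μ : ℂ}
    (h : -1 < μ.re) (h0 : μ.re < 0) : ∀ᵐ z : ℝ × ℝ, integrandT ε f v μ z =
      -(2 * (Real.pi : ℂ) * Complex.I)⁻¹ * (f (z.1, 1) (z.2, 1) *
        ((z.1 - z.2 : ℝ) : ℂ)⁻¹ * kernelK (-ε) μ (z.1, 1) (z.2, 1) v) := by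
  have h1 := (Measure.quasiMeasurePreserving_fst (μ := (volume : Measure ℝ))
    (ν := (volume : Measure ℝ))).ae (ae_wedge_ne_zero hv)
  have h2 := (Measure.quasiMeasurePreserving_snd (μ := (volume : Measure ℝ))
    (ν := (volume : Measure ℝ))).ae (ae_wedge_ne_zero hv)
  rw [← Measure.volume_eq_prod] at h1 h2
  filter_upwards [h1, h2, ae_ne] with z hz1 hz2 hz
  have e : wedge (z.1, 1) (z.2, 1) = z.1 - z.2 := by simp [wedge]
  have hpi : (2 * (Real.pi : ℂ) * Complex.I) ≠ 0 := Complex.two_pi_I_ne_zero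
  rw [integrandT, pairingQ_eq ε h h0 (by rw [e]; exact sub_ne_zero.2 hz) (mul_ne_zero hz1 hz2), e]
  generalize 2 * (Real.pi : ℂ) * Complex.I = q at hpi ⊢
  field_simp

theorem normSq_paramLineP (s : ℝ × ℝ) : normSq (paramLineP s) = Real.cosh s.1 := by
  have hc := Real.sin_sq_add_cos_sq (s.2 / 2)
  have e1 : Real.cosh s.1 = Real.cosh (s.1 / 2) ^ 2 + Real.sinh (s.1 / 2) ^ 2 := by
    rw [← Real.cosh_two_mul]; ring_nf
  rw [normSq, paramLineP, e1]
  linear_combination (Real.cosh (s.1 / 2) ^ 2 + Real.sinh (s.1 / 2) ^ 2) * hc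

theorem normSq_paramLineWP (s : ℝ × ℝ) : normSq (paramLineWP s) = Real.cosh s.1 := by
  have hc := Real.sin_sq_add_cos_sq (s.2 / 2)
  have e1 : Real.cosh s.1 = Real.cosh (s.1 / 2) ^ 2 + Real.sinh (s.1 / 2) ^ 2 := by
    rw [← Real.cosh_two_mul]; ring_nf
  rw [normSq, paramLineWP, e1]
  linear_combination (Real.cosh (s.1 / 2) ^ 2 + Real.sinh (s.1 / 2) ^ 2) * hc

theorem ne_zero_of_normSq_pos {v : ℝ × ℝ} (h : 0 < normSq v) : v ≠ 0 := by
  rintro rfl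
  simp [normSq] at h

theorem paramLineP_ne_zero (s : ℝ × ℝ) : paramLineP s ≠ 0 :=
  ne_zero_of_normSq_pos (by rw [normSq_paramLineP]; exact Real.cosh_pos _)

theorem paramLineWP_ne_zero (s : ℝ × ℝ) : paramLineWP s ≠ 0 :=
  ne_zero_of_normSq_pos (by rw [normSq_paramLineWP]; exact Real.cosh_pos _)

theorem IsBiSection.continuous_comp {f : ℝ × ℝ → ℝ × ℝ → ℂ} (hf : IsBiSection f) {X : Type*}
    [TopologicalSpace X] {a b : X → ℝ × ℝ} (ha : Continuous a) (hb : Continuous b)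
    (ha0 : ∀ x, a x ≠ 0) (hb0 : ∀ x, b x ≠ 0) : Continuous fun x => f (a x) (b x) :=
  hf.smooth.continuousOn.comp_continuous (ha.prodMk hb) fun x => ⟨ha0 x, hb0 x⟩

/-- Homogeneity of degree `-1` in each variable reduces the bound to compactness of the product of
two unit circles. -/
theorem IsBiSection.exists_bound {f : ℝ × ℝ → ℝ × ℝ → ℂ} (hf : IsBiSection f) :
    ∃ C, ∀ v w : ℝ × ℝ, v ≠ 0 → w ≠ 0 → ‖f v w‖ * √(normSq v * normSq w) ≤ C := by
  have hc : Continuous unitVec := by unfold unitVec; fun_prop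
  have h1 : Continuous fun x : ℝ × ℝ => f (unitVec x.1) (unitVec x.2) :=
    hf.continuous_comp (hc.comp continuous_fst) (hc.comp continuous_snd)
      (fun _ => unitVec_ne_zero _) fun _ => unitVec_ne_zero _
  obtain ⟨C, hC⟩ := (isCompact_Icc.prod isCompact_Icc :
    IsCompact (Set.Icc (-Real.pi) Real.pi ×ˢ Set.Icc (-Real.pi) Real.pi)).exists_bound_of_continuousOn
      h1.continuousOn
  refine ⟨C, fun v w hv hw => ?_⟩
  obtain ⟨r, α, hr, hα, rfl⟩ := exists_eq_smul_unitVec hv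
  obtain ⟨q, β, hq, hβ, rfl⟩ := exists_eq_smul_unitVec hw
  have h2 := hC (α, β) ⟨Set.Ioc_subset_Icc_self hα, Set.Ioc_subset_Icc_self hβ⟩
  have e : √(normSq (r • unitVec α) * normSq (q • unitVec β)) = r * q := by
    rw [normSq_smul, normSq_smul, normSq_unitVec, normSq_unitVec, mul_one, mul_one, ← mul_pow,
      Real.sqrt_sq (by positivity)]
  rw [e, hf.homogeneous _ _ _ _ hr.ne' hq.ne' (unitVec_ne_zero _) (unitVec_ne_zero _), norm_mul,
    norm_mul, norm_inv, norm_inv, Complex.norm_real, Complex.norm_real, Real.norm_of_nonneg hr.le,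
    Real.norm_of_nonneg hq.le]
  refine le_trans (le_of_eq ?_) h2
  field_simp

/-- Both representing vectors have squared length `cosh t`, so the pull-back of `f` is at most `C /
cosh t`. This cancels the density and leaves `|kap| ^ μ.re`. -/
theorem IsBiSection.integrable_pulledKernel {f : ℝ × ℝ → ℝ × ℝ → ℂ} (hf : IsBiSection f) (ε : ℤˣ)
    {μ : ℂ} (h : -1 < μ.re) (h0 : μ.re < 0) {v : ℝ × ℝ} (hv : v ≠ 0) :
    Integrable (fun p => pulledKernel ε μ p v * pullback f p) deSitterMeasure := by
  obtain ⟨C, hC⟩ := hf.exists_bound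
  obtain ⟨r, α, hr, -, rfl⟩ := exists_eq_smul_unitVec hv
  have hP : Continuous paramLineP := by unfold paramLineP; fun_prop
  have hWP : Continuous paramLineWP := by unfold paramLineWP; fun_prop
  have hc : Continuous fun s => ((Real.cosh s.1 : ℝ) : ℂ) * f (paramLineP s) (paramLineWP s) := by
    refine Continuous.mul (by fun_prop) ?_
    exact hf.continuous_comp hP hWP paramLineP_ne_zero paramLineWP_ne_zero
  have hk : Measurable fun s : ℝ × ℝ => r ^ 2 * kap s.1 (s.2 + 2 * α) := by
    have : Measurable fun s : ℝ × ℝ => kap s.1 (s.2 + 2 * α) :=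
      measurable_kap.comp (measurable_fst.prodMk (measurable_snd.add_const (2 * α)))
    exact this.const_mul _
  have hi : Integrable (fun s : ℝ × ℝ => ((|kap s.1 (s.2 + 2 * α)| ^ μ.re : ℝ) : ℂ))
      chartMeasure := by
    have h1 := (integrable_abs_kap_rpow h h0).ofReal (𝕜 := ℂ)
    rw [chartMeasure_eq_prod] at h1 ⊢
    refine integrable_prod_shift
      (Complex.measurable_ofReal.comp (measurable_abs_kap_rpow μ.re)) (fun t θ => ?_) (2 * α) h1
    simp only [Function.comp_apply, kap_periodic t θ]
  rw [integrable_deSitter_iff]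
  refine ((hi.norm.const_mul (C * (r ^ 2) ^ μ.re))).mono' (Measurable.aestronglyMeasurable ?_)
    (Eventually.of_forall fun s => ?_)
  · have : (fun s => ((Real.cosh s.1 : ℝ) : ℂ) * (pulledKernel ε μ (deSitterParam s)
        (r • unitVec α) * pullback f (deSitterParam s))) = fun s =>
        (((Real.cosh s.1 : ℝ) : ℂ) * f (paramLineP s) (paramLineWP s)) *
          signedPow ε μ (r ^ 2 * kap s.1 (s.2 + 2 * α)) := by
      funext s
      rw [pulledKernel_eq, pointForm_smul, pointForm_deSitterParam, hf.pullback_deSitterParam]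
      ring
    rw [this]
    exact hc.measurable.mul ((measurable_signedPow ε μ).comp hk)
  · have h1 := hC _ _ (paramLineP_ne_zero s) (paramLineWP_ne_zero s)
    rw [normSq_paramLineP, normSq_paramLineWP, Real.sqrt_mul_self (Real.cosh_pos _).le] at h1
    have h2 := norm_signedPow_le ε μ (r ^ 2 * kap s.1 (s.2 + 2 * α))
    rw [abs_mul, Real.mul_rpow (abs_nonneg _) (abs_nonneg _), abs_of_nonneg (by positivity)] at h2
    rw [pulledKernel_eq, pointForm_smul, pointForm_deSitterParam, hf.pullback_deSitterParam,
      norm_mul, norm_mul, Complex.norm_real, Real.norm_of_nonneg (Real.cosh_pos _).le,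
      Complex.norm_real, Real.norm_of_nonneg (by positivity)]
    calc Real.cosh s.1 * (‖signedPow ε μ (r ^ 2 * kap s.1 (s.2 + 2 * α))‖ *
          ‖f (paramLineP s) (paramLineWP s)‖)
        = (‖f (paramLineP s) (paramLineWP s)‖ * Real.cosh s.1) *
          ‖signedPow ε μ (r ^ 2 * kap s.1 (s.2 + 2 * α))‖ := by ring
      _ ≤ C * ((r ^ 2) ^ μ.re * |kap s.1 (s.2 + 2 * α)| ^ μ.re) := by
          have : 0 ≤ C := le_trans (by positivity) h1
          gcongr
      _ = _ := by ring

theorem exists_param_eq_smul {s : ℝ × ℝ} (hs : bruhatDenom s ≠ 0) : ∃ c d : ℝ, c ≠ 0 ∧ d ≠ 0 ∧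
    c * d * (-2) = bruhatDenom s ∧ paramLineP s = d • ((bruhat s).1, 1) ∧
      paramLineWP s = c • ((bruhat s).2, 1) := by
  obtain ⟨g, hg, h1, h2⟩ := exists_represents_param s
  obtain ⟨g1, g2, g3⟩ := (represents_iff _ _).1 hg
  have dg : g 0 0 * g 1 1 - g 0 1 * g 1 0 = 1 := by rw [← Matrix.det_fin_two]; exact g.2
  have hN : bruhatDenom s = 2 * g 1 0 * g 1 1 := by
    rw [← g3]
    simp only [bruhatDenom, deSitterParam]
  have hX : Real.cosh s.1 * Real.cos s.2 = g 0 0 * g 1 1 + g 0 1 * g 1 0 := by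
    rw [← g1]
    simp only [deSitterParam]
  have hc : g 1 0 ≠ 0 := fun h => hs (by rw [hN, h]; ring)
  have hd : g 1 1 ≠ 0 := fun h => hs (by rw [hN, h]; ring)
  refine ⟨-g 1 0, g 1 1, neg_ne_zero.2 hc, hd, by rw [hN]; ring, ?_, ?_⟩
  · rw [← h1, lineP, bruhat, hN, hX]
    ext
    · simp only [Prod.smul_mk, smul_eq_mul]
      field_simp
      linear_combination -dg
    · simp
  · rw [← h2, lineWP, bruhat, hN, hX]
    ext
    · simp only [Prod.smul_mk, smul_eq_mul]
      field_simp
      linear_combination -dg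
    · simp

theorem IsBiSection.pullback_bruhat {f : ℝ × ℝ → ℝ × ℝ → ℂ} (hf : IsBiSection f) {s : ℝ × ℝ}
    (hs : bruhatDenom s ≠ 0) : pullback f (deSitterParam s) =
      (((bruhat s).1 - (bruhat s).2 : ℝ) : ℂ) * f ((bruhat s).1, 1) ((bruhat s).2, 1) := by
  obtain ⟨c, d, hc, hd, hN, h1, h2⟩ := exists_param_eq_smul hs
  rw [hf.pullback_deSitterParam, h1, h2, hf.homogeneous _ _ _ _ hd hc (by simp) (by simp),
    bruhat_sub hs, ← hN]
  have hc' : (c : ℂ) ≠ 0 := by exact_mod_cast hc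
  have hd' : (d : ℂ) ≠ 0 := by exact_mod_cast hd
  push_cast
  field_simp

theorem pulledKernel_bruhat (ε : ℤˣ) (μ : ℂ) {s : ℝ × ℝ} (hs : bruhatDenom s ≠ 0) (v : ℝ × ℝ) :
    pulledKernel ε μ (deSitterParam s) v =
      kernelK ε μ ((bruhat s).1, 1) ((bruhat s).2, 1) v := by
  obtain ⟨g, hg, h3, h4⟩ := exists_represents_param s
  obtain ⟨c, d, hc, hd, hN, h1, h2⟩ := exists_param_eq_smul hs
  have e : wedge ((bruhat s).1, 1) ((bruhat s).2, 1) = (bruhat s).1 - (bruhat s).2 := by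
    simp [wedge]
  have e2 : ∀ (r : ℝ) (u : ℝ × ℝ), wedge (r • u) v = r * wedge u v := by
    intro r u
    simp only [wedge, Prod.smul_fst, Prod.smul_snd, smul_eq_mul]
    ring
  rw [pulledKernel_eq, kernelK, ← wedge_mul_wedge_eq_pointForm hg, h3, h4, h1, h2, e2, e2, e,
    bruhat_sub hs, ← hN]
  congr 1
  field_simp

theorem IsBiSection.integrand_bruhat {f : ℝ × ℝ → ℝ × ℝ → ℂ} (hf : IsBiSection f) (ε : ℤˣ) (μ : ℂ)
    (v : ℝ × ℝ) {s : ℝ × ℝ} (hs : bruhatDenom s ≠ 0) :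
    ((Real.cosh s.1 : ℝ) : ℂ) * (pulledKernel ε μ (deSitterParam s) v *
        pullback f (deSitterParam s)) =
      (2 * Real.cosh s.1 / bruhatDenom s ^ 2) •
        (2 * (f ((bruhat s).1, 1) ((bruhat s).2, 1) * (((bruhat s).1 - (bruhat s).2 : ℝ) : ℂ)⁻¹ *
          kernelK ε μ ((bruhat s).1, 1) ((bruhat s).2, 1) v)) := by
  have hs' : (bruhatDenom s : ℂ) ≠ 0 := by exact_mod_cast hs
  rw [pulledKernel_bruhat ε μ hs, hf.pullback_bruhat hs, bruhat_sub hs, Complex.real_smul]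
  push_cast
  field_simp

/-- The constant `-4πi` is the factor `2` of the invariant measure divided by the constant
`-(2πi)⁻¹` of `ae_integrandT_eq`. -/
theorem IsBiSection.integral_pulledKernel_eq {f : ℝ × ℝ → ℝ × ℝ → ℂ} (hf : IsBiSection f) (ε : ℤˣ)
    {μ : ℂ} (h : -1 < μ.re) (h0 : μ.re < 0) {v : ℝ × ℝ} (hv : v ≠ 0) :
    Integrable (integrandT ε f v μ) ∧
      ∫ p, pulledKernel (-ε) μ p v * pullback f p ∂deSitterMeasure =
        -(4 * (Real.pi : ℂ) * Complex.I) * ∫ z, integrandT ε f v μ z := by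
  have hpi : (2 * (Real.pi : ℂ) * Complex.I) ≠ 0 := Complex.two_pi_I_ne_zero
  obtain ⟨g, hg⟩ : ∃ g : ℝ × ℝ → ℂ, g = fun z => 2 * (f (z.1, 1) (z.2, 1) *
    ((z.1 - z.2 : ℝ) : ℂ)⁻¹ * kernelK (-ε) μ (z.1, 1) (z.2, 1) v) := ⟨_, rfl⟩
  have he : (fun s => ((Real.cosh s.1 : ℝ) : ℂ) * (pulledKernel (-ε) μ (deSitterParam s) v *
      pullback f (deSitterParam s))) =ᵐ[chartMeasure]
      fun s => (2 * Real.cosh s.1 / bruhatDenom s ^ 2) • g (bruhat s) := by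
    rw [chartMeasure_eq_restrict_bruhatSource]
    filter_upwards [ae_restrict_mem measurableSet_bruhatSource] with s hs
    rw [hf.integrand_bruhat _ _ _ hs.2, hg]
  have hi := hf.integrable_pulledKernel (-ε) h h0 hv
  rw [integrable_deSitter_iff, integrable_congr he, ← integrable_bruhat_iff] at hi
  have hT : integrandT ε f v μ =ᵐ[volume]
      fun z => -(4 * (Real.pi : ℂ) * Complex.I)⁻¹ * g z := by
    filter_upwards [ae_integrandT_eq ε f hv h h0] with z hz
    rw [hz, hg, show 4 * (Real.pi : ℂ) * Complex.I = 2 * (2 * Real.pi * Complex.I) by ring]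
    generalize 2 * (Real.pi : ℂ) * Complex.I = q at hpi ⊢
    field_simp
  refine ⟨(integrable_congr hT).2 (hi.const_mul _), ?_⟩
  rw [integral_deSitter, integral_congr_ae he, ← integral_bruhat, integral_congr_ae hT,
    integral_const_mul, show 4 * (Real.pi : ℂ) * Complex.I = 2 * (2 * Real.pi * Complex.I) by ring]
  generalize 2 * (Real.pi : ℂ) * Complex.I = q at hpi ⊢
  field_simp

/-- Composition with `ν ↦ a * ν` and multiplication by `c` preserve meromorphy and regularity. This
transfers a continuation between the parameters `lam` and `μ = -lam / 2`. -/
theorem HasContinuedIntegral.affine {X Y : Type*} [MeasurableSpace X] [MeasurableSpace Y]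
    {m : Measure X} {m' : Measure Y} {S S' : Set ℂ} {k : ℂ → X → ℂ} {k' : ℂ → Y → ℂ}
    {ν₀ I a c : ℂ}
    (hk : ∀ ν ∈ S', a * ν ∈ S ∧ Integrable (k' ν) m' ∧
      ∫ y, k' ν y ∂m' = c * ∫ x, k (a * ν) x ∂m)
    (h : HasContinuedIntegral m S k (a * ν₀) I) : HasContinuedIntegral m' S' k' ν₀ (c * I) := by
  obtain ⟨M, hM, hMS, hMa, rfl⟩ := h
  have ha : ∀ z : ℂ, AnalyticAt ℂ (fun ν => a * ν) z := fun z => by fun_prop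
  refine ⟨fun ν => c * M (a * ν), fun z _ => ?_, fun ν hν => ?_, ?_, rfl⟩
  · exact (MeromorphicAt.const c z).mul
      (MeromorphicAt.comp_analyticAt (f := M) (g := fun ν => a * ν) (hM _ (Set.mem_univ _)) (ha z))
  · obtain ⟨h1, h2, h3⟩ := hk ν hν
    exact ⟨h2, by rw [h3, ← (hMS _ h1).2]⟩
  · exact analyticAt_const.mul (AnalyticAt.fun_comp (g := M) (f := fun ν => a * ν) hMa (ha _))

theorem IsBiSection.hasT_iff {f : ℝ × ℝ → ℝ × ℝ → ℂ} (hf : IsBiSection f) (ε : ℤˣ) (lam : ℂ)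
    {v : ℝ × ℝ} (hv : v ≠ 0) (A : ℂ) : HasT ε (-lam / 2) f v A ↔
      HasContinuedIntegral deSitterMeasure {ν | 0 < ν.re ∧ ν.re < 2}
        (fun ν p => pulledKernel (-ε) (-ν / 2) p v * pullback f p) lam
          (-(4 * (Real.pi : ℂ) * Complex.I) * A) := by
  have hc : -(4 * (Real.pi : ℂ) * Complex.I) ≠ 0 := by simp [Real.pi_ne_zero]
  have e1 : ∀ ν : ℂ, (-1 / 2) * ν = -ν / 2 := fun ν => by ring
  have hre : ∀ ν : ℂ, (-ν / 2).re = -ν.re / 2 := fun ν => by simp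
  constructor
  · intro h
    rw [HasT, ← e1] at h
    refine h.affine fun ν hν => ?_
    rw [e1]
    obtain ⟨h1, h2⟩ := hν
    have h3 : -1 < (-ν / 2).re := by rw [hre]; linarith
    have h4 : (-ν / 2).re < 0 := by rw [hre]; linarith
    exact ⟨⟨h3, h4⟩, hf.integrable_pulledKernel _ h3 h4 hv,
      (hf.integral_pulledKernel_eq ε h3 h4 hv).2⟩
  · intro h
    rw [HasT]
    -- The converse uses the inverse substitution `lam = -2 * μ` and the inverse constant.
    rw [show lam = -2 * (-lam / 2) by ring] at h
    have h1 := h.affine (c := (-(4 * (Real.pi : ℂ) * Complex.I))⁻¹) (m' := volume)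
      (S' := {ν | -1 < ν.re ∧ ν.re < 0}) (k' := integrandT ε f v) fun ν hν => ?_
    · rwa [inv_mul_cancel_left₀ hc] at h1
    · obtain ⟨h3, h4⟩ := hν
      have h5 := hf.integral_pulledKernel_eq ε h3 h4 hv
      refine ⟨⟨by simp; linarith, by simp; linarith⟩, h5.1, ?_⟩
      rw [show -(-2 * ν) / 2 = ν by ring, h5.2, inv_mul_cancel_left₀ hc]

/-! ## The theorem -/

theorem mainTheorem6 :
    (∀ (ε : ℤˣ) (lam : ℂ), (∀ n : ℕ, lam ≠ 2 * ((n : ℂ) + 1)) →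
      ∀ h : deSitter → ℂ, IsTestFunction h →
        (∃ F : ℝ × ℝ → ℂ, IsFourierTransform ε lam h F) ∧
        ∀ F : ℝ × ℝ → ℂ, IsFourierTransform ε lam h F → ∀ v : ℝ × ℝ, v ≠ 0 →
          HasContinuedIntegral deSitterMeasure {ν | ν.re < 2}
            (fun ν p => pulledKernel (-ε) (-ν / 2) p v * h p) lam (F v)) ∧
    ∃ c : ℂ, c ≠ 0 ∧ ∀ (ε : ℤˣ) (f : ℝ × ℝ → ℝ × ℝ → ℂ), IsBiSection f →
      (IsTestFunction (pullback f) →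
        ∀ lam : ℂ, (∀ n : ℕ, lam ≠ 2 * ((n : ℂ) + 1)) →
          ∀ F : ℝ × ℝ → ℂ, IsFourierTransform ε lam (pullback f) F → ∀ v : ℝ × ℝ, v ≠ 0 →
            ∃ A : ℂ, HasT ε (-lam / 2) f v A ∧ F v = c * A) ∧
      (∀ lam : ℂ, 0 < lam.re → lam.re < 2 → ∀ v : ℝ × ℝ, v ≠ 0 →
        Integrable (integrandT ε f v (-lam / 2)) volume ∧
        Integrable (fun p => pulledKernel (-ε) (-lam / 2) p v * pullback f p) deSitterMeasure ∧
        ∫ p, pulledKernel (-ε) (-lam / 2) p v * pullback f p ∂deSitterMeasure =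
          c * ∫ z, integrandT ε f v (-lam / 2) z) ∧
      (∀ (lam : ℂ) (v : ℝ × ℝ), v ≠ 0 → ∀ A : ℂ,
        HasT ε (-lam / 2) f v A ↔
          HasContinuedIntegral deSitterMeasure {ν | 0 < ν.re ∧ ν.re < 2}
            (fun ν p => pulledKernel (-ε) (-ν / 2) p v * pullback f p) lam (c * A)) := by
  refine ⟨fun ε lam hlam h hh => ⟨exists_isFourierTransform ε hlam hh, fun F hF v hv =>
    hF.hasContinuedIntegral hlam hh hv⟩, -(4 * (Real.pi : ℂ) * Complex.I), by
      simp [Real.pi_ne_zero], fun ε f hf => ⟨fun hh lam hlam F hF v hv => ?_,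
      fun lam h1 h2 v hv => ?_, fun lam v hv A => hf.hasT_iff ε lam hv A⟩⟩
  · have hc : -(4 * (Real.pi : ℂ) * Complex.I) ≠ 0 := by simp [Real.pi_ne_zero]
    have e := mul_inv_cancel_left₀ hc (F v)
    refine ⟨(-(4 * (Real.pi : ℂ) * Complex.I))⁻¹ * F v, (hf.hasT_iff ε lam hv _).2 ?_, e.symm⟩
    rw [e]
    -- For a compactly supported pull-back the first part gives convergence on `Re ν < 2`, which
    -- contains the strip of the operators `T`.
    exact (hF.hasContinuedIntegral hlam hh hv).congr fun ν hν => hν.2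
  · have hre : (-lam / 2).re = -lam.re / 2 := by simp
    have h3 : -1 < (-lam / 2).re := by rw [hre]; linarith
    have h4 : (-lam / 2).re < 0 := by rw [hre]; linarith
    obtain ⟨h5, h6⟩ := hf.integral_pulledKernel_eq ε h3 h4 hv
    exact ⟨h5, hf.integrable_pulledKernel _ h3 h4 hv, h6⟩
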